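/- For a finite set $P\subset\mathbb{R}^d$ and a $k$-tuple of centers $S$ in $\mathbb{R}^d$ let $\mathrm{cost}(p,S)=\min_{c\in S}\|p-c\|_2^2$ and $\mathrm{cost}(P,S)=\sum_{p\in P}\mathrm{cost}(p,S)$. Points $q_1,\dots,q_m$ with weights $w_1,\dots,w_m$ form an $\varepsilon$-coreset of $P$ (of size $m$) if $\left|\sum_{i=1}^m w_i\,\mathrm{cost}(q_i,S)-\mathrm{cost}(P,S)\right|\le\varepsilon\,\mathrm{cost}(P,S)$ for every $k$-tuple $S$ of centers in $\mathbb{R}^d$. Sensitivity Sampling with $m$ samples is the following procedure. Given a nonempty finite $P\subset\mathbb{R}^d$, an integer $k\ge1$ and a $\gamma$-approximate $k$-means solution $A=(a_1,\dots,a_k)$ (that is, $\mathrm{cost}(P,A)\le\gamma\,\mathrm{cost}(P,S)$ for every $k$-tuple $S$), assign each point of $P$ to a nearest center of $A$ (ties broken arbitrarily), let $C_j$ be the cluster of points assigned to $a_j$, and for $p\in C_j$ let $\Delta_p=\mathrm{cost}(C_j,A)/|C_j|$ and $$s(p)=\frac14\left(\frac1{k|C_j|}+\frac{\mathrm{cost}(p,A)}{k\,\mathrm{cost}(C_j,A)}+\frac{\mathrm{cost}(p,A)}{\mathrm{cost}(P,A)}+\frac{\Delta_p}{\mathrm{cost}(P,A)}\right),$$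 where $0/0$ is read as $0$. Let $\mu(p)=s(p)/\sum_{p'\in P}s(p')$ (the sum is $1$ if every cluster has positive cost). Draw $q_1,\dots,q_m$ independently from $\mu$ and give $q_i$ the weight $w_i=1/(m\,\mu(q_i))$. Theorem. There is an absolute constant $c\in\mathbb{N}$ and for every $\gamma\ge1$ a constant $C>0$ depending only on $\gamma$ such that for all $d$, all $k\ge1$, all nonempty finite $P\subset\mathbb{R}^d$, all $\gamma$-approximate $k$-means solutions $A$ of $P$ with any such assignment, all $\varepsilon\in(0,1)$ and all integers $$m\ \ge\ C\cdot\frac{k}{\varepsilon^2}\,\min\left(\sqrt k,\ \varepsilon^{-2}\right)\cdot\left(1+\log\frac{k}{\varepsilon}\right)^{c},$$ the output of Sensitivity Sampling with $m$ samples is an $\varepsilon$-coreset of $P$ with probability at least $2/3$. In particular, Sensitivity Sampling yields an $\varepsilon$-coreset of size $\tilde O\left(\frac{k}{\varepsilon^2}\min(\sqrt k,\varepsilon^{-2})\right)$ with probability at least $2/3$. -/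

import Mathlib

open MeasureTheory

noncomputable section

namespace KMeans

/-- The space `ℝ^d` with the Euclidean norm. -/
abbrev Pt (d : ℕ) : Type := EuclideanSpace ℝ (Fin d)

variable {d k m : ℕ}

/-- `cost(p, S) = min_{c ∈ S} ‖p - c‖²` for an ordered `k`-tuple of centers `S`
(an infimum over a finite family; it is used for `k ≥ 1` only). -/
def pointCost (p : Pt d) (S : Fin k → Pt d) : ℝ := ⨅ j, ‖p - S j‖ ^ 2

/-- `cost(P, S) = ∑_{p ∈ P} cost(p, S)`. -/
def cost (P : Finset (Pt d)) (S : Fin k → Pt d) : ℝ := ∑ p ∈ P, pointCost p S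

/-- `A` is a `γ`-approximate `k`-means solution for `P`: its cost is at most `γ` times the cost
of every `k`-tuple of centers, hence at most `γ` times the optimum. -/
def IsApproxSolution (γ : ℝ) (P : Finset (Pt d)) (A : Fin k → Pt d) : Prop :=
  ∀ S : Fin k → Pt d, cost P A ≤ γ * cost P S

/-- `asg` assigns each point of `P` to (the index of) a nearest center of `A`; ties are broken
arbitrarily. Values outside `P` play no role. -/
def IsNearestAssignment (P : Finset (Pt d)) (A : Fin k → Pt d) (asg : Pt d → Fin k) : Prop :=
  ∀ p ∈ P, ∀ j, ‖p - A (asg p)‖ ≤ ‖p - A j‖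

/-- The cluster `C_j` of the points of `P` assigned to the center with index `j`. -/
def cluster (P : Finset (Pt d)) (asg : Pt d → Fin k) (j : Fin k) : Finset (Pt d) :=
  P.filter (fun p => asg p = j)

/-- The average cost `Δ_j = cost(C_j, A) / |C_j|` of the cluster `C_j`. -/
def avgCost (P : Finset (Pt d)) (A : Fin k → Pt d) (asg : Pt d → Fin k) (j : Fin k) : ℝ :=
  cost (cluster P asg j) A / ((cluster P asg j).card : ℝ)

/-- The sampling score of a point `p` in the cluster `C_j`,
`1/4 (1/(k|C_j|) + cost(p,A)/(k cost(C_j,A)) + cost(p,A)/cost(P,A) + Δ_j/cost(P,A))`,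
where a fraction `0/0` (which occurs if the cost of `C_j` or of `P` is zero) is read as `0`. -/
def score (P : Finset (Pt d)) (A : Fin k → Pt d) (asg : Pt d → Fin k) (p : Pt d) : ℝ :=
  (1 / 4) *
    (1 / ((k : ℝ) * ((cluster P asg (asg p)).card : ℝ))
      + pointCost p A / ((k : ℝ) * cost (cluster P asg (asg p)) A)
      + pointCost p A / cost P A
      + avgCost P A asg (asg p) / cost P A)

/-- The sampling probability `μ(p)`: the score, divided by the total score. The total score is `1`
if every cluster has positive cost (`sum_score_eq_one` below), and then `μ(p)` is the score. -/
def samplingProb (P : Finset (Pt d)) (A : Fin k → Pt d) (asg : Pt d → Fin k) (p : Pt d) : ℝ :=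
  score P A asg p / ∑ q ∈ P, score P A asg q

theorem pointCost_nonneg (p : Pt d) (S : Fin k → Pt d) : 0 ≤ pointCost p S :=
  Real.iInf_nonneg fun _ => sq_nonneg _

theorem cost_nonneg (P : Finset (Pt d)) (S : Fin k → Pt d) : 0 ≤ cost P S :=
  Finset.sum_nonneg fun p _ => pointCost_nonneg p S

theorem score_pos (P : Finset (Pt d)) (A : Fin k → Pt d) (asg : Pt d → Fin k) {p : Pt d}
    (hp : p ∈ P) : 0 < score P A asg p := by
  have hk : (0 : ℝ) < k := by exact_mod_cast (asg p).pos
  have hc : (0 : ℝ) < ((cluster P asg (asg p)).card : ℝ) := by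
    exact_mod_cast Finset.card_pos.2 ⟨p, by simp [cluster, hp]⟩
  have h1 := pointCost_nonneg p A
  have h2 := cost_nonneg P A
  have h3 := cost_nonneg (cluster P asg (asg p)) A
  have h4 : 0 ≤ avgCost P A asg (asg p) := div_nonneg h3 hc.le
  unfold score
  positivity

theorem sum_score_eq_one (P : Finset (Pt d)) (A : Fin k → Pt d) (asg : Pt d → Fin k)
    (hk : 0 < k) (h : ∀ j, 0 < cost (cluster P asg j) A) :
    ∑ p ∈ P, score P A asg p = 1 := by
  have hk' : (0 : ℝ) < k := by exact_mod_cast hk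
  have hfib : ∀ f : Pt d → ℝ, ∑ p ∈ P, f p = ∑ j : Fin k, ∑ p ∈ cluster P asg j, f p := by
    intro f
    exact (Finset.sum_fiberwise P asg f).symm
  have hP : cost P A = ∑ j : Fin k, cost (cluster P asg j) A := hfib _
  have hPpos : 0 < cost P A := by
    rw [hP]
    exact Finset.sum_pos (fun j _ => h j) ⟨⟨0, hk⟩, Finset.mem_univ _⟩
  have key : ∀ j : Fin k, ∑ p ∈ cluster P asg j, score P A asg p
      = (1 / 4) * (1 / k + 1 / k + 2 * (cost (cluster P asg j) A / cost P A)) := by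
    intro j
    have hne : (cluster P asg j).Nonempty := by
      by_contra hcon
      have := h j
      rw [Finset.not_nonempty_iff_eq_empty.1 hcon] at this
      simp [cost] at this
    have hc : (0 : ℝ) < ((cluster P asg j).card : ℝ) := by exact_mod_cast Finset.card_pos.2 hne
    have hcost := h j
    have e : ∀ p ∈ cluster P asg j, score P A asg p = (1 / 4) *
        (1 / ((k : ℝ) * ((cluster P asg j).card : ℝ))
          + pointCost p A / ((k : ℝ) * cost (cluster P asg j) A)
          + pointCost p A / cost P A + avgCost P A asg j / cost P A) := by
      intro p hp
      have : asg p = j := (Finset.mem_filter.1 hp).2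
      simp only [score, this]
    rw [Finset.sum_congr rfl e, ← Finset.mul_sum]
    simp only [Finset.sum_add_distrib, ← Finset.sum_div, Finset.sum_const, nsmul_eq_mul]
    change _ * (_ + cost (cluster P asg j) A / _ + cost (cluster P asg j) A / _ + _) = _
    unfold avgCost
    field_simp
    ring
  rw [hfib, Finset.sum_congr rfl fun j _ => key j, ← Finset.mul_sum, Finset.sum_add_distrib,
    ← Finset.mul_sum, ← Finset.sum_div, ← hP, div_self hPpos.ne']
  simp only [Finset.sum_const, Finset.card_univ, Fintype.card_fin, nsmul_eq_mul]
  field_simp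
  norm_num

theorem sum_samplingProb (P : Finset (Pt d)) (hP : P.Nonempty) (A : Fin k → Pt d)
    (asg : Pt d → Fin k) :
    ∑ p : P, ENNReal.ofReal (samplingProb P A asg p) = 1 := by
  have hpos : 0 < ∑ q ∈ P, score P A asg q := Finset.sum_pos (fun q hq => score_pos P A asg hq) hP
  rw [← ENNReal.ofReal_sum_of_nonneg
    (f := fun p : P => samplingProb P A asg p)
    (fun p _ => div_nonneg (score_pos P A asg p.2).le hpos.le)]
  rw [Finset.sum_coe_sort P (fun p => samplingProb P A asg p)]
  unfold samplingProb
  rw [← Finset.sum_div, div_self hpos.ne', ENNReal.ofReal_one]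

/-- The distribution `μ` on the points of `P`. -/
def samplingPMF (P : Finset (Pt d)) (hP : P.Nonempty) (A : Fin k → Pt d)
    (asg : Pt d → Fin k) : PMF P :=
  PMF.ofFintype (fun p => ENNReal.ofReal (samplingProb P A asg p)) (sum_samplingProb P hP A asg)

/-- The joint law of `m` independent samples `q_1, …, q_m` from `μ`. -/
def sampleLaw (P : Finset (Pt d)) (hP : P.Nonempty) (A : Fin k → Pt d) (asg : Pt d → Fin k)
    (m : ℕ) : Measure (Fin m → P) :=
  Measure.pi fun _ => (samplingPMF P hP A asg).toMeasure

/-- The weights `w_i = 1 / (m μ(q_i))` of the sampled points. -/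
def sampleWeight (P : Finset (Pt d)) (A : Fin k → Pt d) (asg : Pt d → Fin k)
    (q : Fin m → P) (i : Fin m) : ℝ :=
  1 / ((m : ℝ) * samplingProb P A asg (q i))

/-- The points `q_1, …, q_m` with the weights `w_1, …, w_m` form an `ε`-coreset of `P` for
`k`-means: the weighted cost is within a factor `1 ± ε` of `cost(P, S)` for all `k`-tuples `S`
of centers. -/
def IsCoreset (k : ℕ) (ε : ℝ) (P : Finset (Pt d)) (q : Fin m → Pt d) (w : Fin m → ℝ) : Prop :=
  ∀ S : Fin k → Pt d, |∑ i, w i * pointCost (q i) S - cost P S| ≤ ε * cost P S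

end KMeans

end

/-!
The proof bounds, for all center tuples `S` simultaneously, the deviation of the weighted cost of
the sample from `cost P S`. Write `D i` for the distance of the sample point `x i` to its reference
center `a j`, `δ j` for the distance of `a j` to the nearest center of `S`, and `n j` for the size of
the `j`-th cluster. All errors are measured against `scaleCost = cost P A + ∑ n j * δ j ^ 2`, which
is at most `(3 γ + 2) cost P S` because `A` is `γ`-approximate (`scaleCost_le`).

**Symmetrization.** For a single `S`, Chebyshev's inequality gives concentration
(`pr_single_deviation_le`). Hence (`pr_exists_deviation_le`) it suffices to bound the signed sums
`∑ ± w i * pointCost (x i) S` over random signs, for a fixed sample. All that is needed of the sample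
(`WeightedSample`) is `m * w i ≤ 4 k n j`, `m * w i * D i ^ 2 ≤ 4 cost P A`, which hold always, and
`∑ w i ≤ 4 n j` over each cluster, which holds with high probability by a Chernoff bound
(`pr_cluster_weight_le`).

**Splitting the sum.** Let `κ` be about `min (√k) (ε⁻²)`, and call a cluster heavy if `n j * δ j ^ 2`
exceeds `κ / k` times the scale.
* Points with `D i ≤ ε * δ j` have cost `δ j ^ 2` up to a factor `1 ± O(ε)`, so that they reduce to
  signed sums of weights in single clusters (`abs_sum_far_le`).
* Points with `δ j ≤ D i`, and points of light clusters, are treated by a chain of nets for the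
  vectors of costs, starting from `0`, with errors relative to `max (D i) (δ j) ^ 2`. The logarithms
  of the net sizes are about `k / β ^ 2` at precision `β`, and the variance proxy is `O(κ / m)`.
* For the remaining points of heavy clusters, with `ε * δ j < D i < δ j`, the chain starts from a
  vector that is constant on clusters and has errors relative to `D i * δ j`. The variance proxy is
  then only `O(1 / m)`, but the nets are larger: their logarithmic sizes are about `k κ / β ^ 2`.

In both chains the product of the two quantities is `k κ / (m β ^ 2)`, and the levels `β = 2 ^ (-h)`
contribute equally, which is why `m` of order `k κ / ε ^ 2` suffices up to logarithms
(`abs_sum_sgn_sub_le`, `chain_budget`, `WeightedSample.pr_sign_deviation_le`).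

**Nets.** The squared distance from `x i` to a center is determined by inner products of one vector
`u` with finitely many vectors. These can be approximated either greedily, with a net whose size
does not depend on the dimension (`exists_isInnerNet_greedy`), or by rounding each of them
separately (`exists_isInnerNet_grid`). The first method costs a factor `ε⁻²` in the fine chain. The
second costs the number of heavy clusters, which is at most `k / κ`, hence at most `√k` for
`κ = √k`. This is the origin of the minimum. The nets are only valid up to a common scale, which is
chosen by `exists_scale`; the sets of indices on which they are used are cut out in each cluster by
an interval of values of `D`, so that there are few of them (`masks`).
-/

noncomputable section

namespace KMeans

/-! ### Finite probability spaces -/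

open Classical in
/-- The probability of the event `A` under the weights `p` on a finite set. The weights are neither
assumed to be nonnegative nor to have sum `1` here. -/
def pr {Ω : Type*} [Fintype Ω] (p : Ω → ℝ) (A : Ω → Prop) : ℝ := ∑ ω, if A ω then p ω else 0

/-- The weight of the tuple `q` under the product of copies of the weights `p`. -/
def prodWt {ι α : Type*} [Fintype ι] (p : α → ℝ) (q : ι → α) : ℝ := ∏ i, p (q i)

section pr

variable {Ω : Type*} [Fintype Ω] {p : Ω → ℝ} {A B : Ω → Prop}

theorem pr_mono (hp : ∀ ω, 0 ≤ p ω) (h : ∀ ω, A ω → B ω) : pr p A ≤ pr p B := by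
  refine Finset.sum_le_sum fun ω _ => ?_
  by_cases hA : A ω
  · simp [hA, h ω hA]
  · by_cases hB : B ω <;> simp [hA, hB, hp]

theorem pr_le_one (hp : ∀ ω, 0 ≤ p ω) (h1 : ∑ ω, p ω = 1) : pr p A ≤ 1 := by
  rw [← h1]
  exact Finset.sum_le_sum fun ω _ => by split_ifs <;> simp [hp]

theorem pr_add_pr_not : pr p A + pr p (fun ω => ¬ A ω) = ∑ ω, p ω := by
  unfold pr
  rw [← Finset.sum_add_distrib]
  exact Finset.sum_congr rfl fun ω _ => by by_cases h : A ω <;> simp [h]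

theorem pr_or_le (hp : ∀ ω, 0 ≤ p ω) : pr p (fun ω => A ω ∨ B ω) ≤ pr p A + pr p B := by
  unfold pr
  rw [← Finset.sum_add_distrib]
  refine Finset.sum_le_sum fun ω _ => ?_
  by_cases hA : A ω <;> by_cases hB : B ω <;> simp [hA, hB, hp]

theorem pr_exists_le {β : Type*} (hp : ∀ ω, 0 ≤ p ω) (F : Finset β) (A : β → Ω → Prop) :
    pr p (fun ω => ∃ y ∈ F, A y ω) ≤ ∑ y ∈ F, pr p (A y) := by
  classical
  induction F using Finset.induction_on with
  | empty => simp [pr]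
  | insert a s ha ih =>
    rw [Finset.sum_insert ha]
    refine le_trans ?_ (add_le_add le_rfl ih)
    simp only [Finset.exists_mem_insert]
    exact pr_or_le hp

/-- Markov's inequality. -/
theorem pr_le_sum (hp : ∀ ω, 0 ≤ p ω) (g : Ω → ℝ) (hg : ∀ ω, 0 ≤ g ω) (h : ∀ ω, A ω → 1 ≤ g ω) :
    pr p A ≤ ∑ ω, p ω * g ω := by
  refine Finset.sum_le_sum fun ω _ => ?_
  by_cases hA : A ω
  · simpa [hA] using le_mul_of_one_le_right (hp ω) (h ω hA)
  · simpa [hA] using mul_nonneg (hp ω) (hg ω)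

end pr

section prodWt

theorem prodWt_nonneg {ι α : Type*} [Fintype ι] {p : α → ℝ} (hp : ∀ a, 0 ≤ p a) (q : ι → α) :
    0 ≤ prodWt p q :=
  Finset.prod_nonneg fun _ _ => hp _

variable {ι α : Type*} [Fintype ι] [DecidableEq ι] [Fintype α] {p : α → ℝ}

/-- The mean of a product of functions of independent variables is the product of the means. -/
theorem sum_prodWt_mul (p : α → ℝ) (f : ι → α → ℝ) :
    ∑ q : ι → α, prodWt p q * ∏ i, f i (q i) = ∏ i, ∑ a, p a * f i a := by
  classical
  rw [Finset.prod_univ_sum, Fintype.piFinset_univ]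
  exact Finset.sum_congr rfl fun q _ => Finset.prod_mul_distrib.symm

theorem sum_prodWt (h1 : ∑ a, p a = 1) : ∑ q : ι → α, prodWt p q = 1 := by
  have := sum_prodWt_mul (ι := ι) p (fun _ _ => 1)
  simpa [h1] using this

/-- The second moment of a sum of independent centred random variables. -/
theorem sum_prodWt_sq (h1 : ∑ a, p a = 1) (g : α → ℝ) (hg : ∑ a, p a * g a = 0) :
    ∑ q : ι → α, prodWt p q * (∑ i, g (q i)) ^ 2 = Fintype.card ι * ∑ a, p a * g a ^ 2 := by
  classical
  have key : ∀ i j : ι, ∑ q : ι → α, prodWt p q * (g (q i) * g (q j))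
      = if i = j then ∑ a, p a * g a ^ 2 else 0 := by
    intro i j
    by_cases hij : i = j
    · subst hij
      have := sum_prodWt_mul p (fun t a => if t = i then g a ^ 2 else 1)
      rw [Finset.prod_eq_single i] at this
      · simp only [if_true] at this ⊢
        rw [← this]
        refine Finset.sum_congr rfl fun q _ => ?_
        rw [Finset.prod_ite_eq' Finset.univ i (fun t => g (q t) ^ 2)]
        simp [sq]
      · intro b _ hb; simp [hb, h1]
      · simp
    · have := sum_prodWt_mul p (fun t a => (if t = i then g a else 1) * if t = j then g a else 1)
      rw [Finset.prod_eq_zero (Finset.mem_univ i)] at this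
      · rw [if_neg hij, ← this]
        refine Finset.sum_congr rfl fun q _ => ?_
        rw [Finset.prod_mul_distrib, Finset.prod_ite_eq' Finset.univ i (fun t => g (q t)),
          Finset.prod_ite_eq' Finset.univ j (fun t => g (q t))]
        simp
      · simpa [hij] using hg
  calc _ = ∑ q : ι → α, ∑ i, ∑ j, prodWt p q * (g (q i) * g (q j)) := by
        refine Finset.sum_congr rfl fun q _ => ?_
        rw [sq, Finset.sum_mul_sum, Finset.mul_sum]
        exact Finset.sum_congr rfl fun i _ => Finset.mul_sum _ _ _
    _ = ∑ i, ∑ j, ∑ q : ι → α, prodWt p q * (g (q i) * g (q j)) := by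
        rw [Finset.sum_comm]
        exact Finset.sum_congr rfl fun i _ => Finset.sum_comm
    _ = _ := by simp [key]

/-- Chebyshev's inequality for a sum of independent copies of `f`. -/
theorem pr_abs_sum_gt_le_half (hp : ∀ a, 0 ≤ p a) (h1 : ∑ a, p a = 1) (f : α → ℝ) {t : ℝ}
    (ht : 0 < t) (hv : 2 * (Fintype.card ι * ∑ a, p a * f a ^ 2) ≤ t ^ 2) :
    pr (prodWt p) (fun q : ι → α => t < |∑ i, f (q i) - Fintype.card ι * ∑ a, p a * f a|)
      ≤ 1 / 2 := by
  set c := ∑ a, p a * f a with hc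
  have hg : ∑ a, p a * (f a - c) = 0 := by
    simp only [mul_sub, Finset.sum_sub_distrib, ← Finset.sum_mul, h1]
    rw [← hc]; ring
  have hvar : ∑ a, p a * (f a - c) ^ 2 ≤ ∑ a, p a * f a ^ 2 := by
    have : ∑ a, p a * (f a - c) ^ 2 = ∑ a, p a * f a ^ 2 - c ^ 2 := by
      have e : ∀ a, p a * (f a - c) ^ 2 = p a * f a ^ 2 - 2 * c * (p a * f a) + c ^ 2 * p a := by
        intro a; ring
      simp only [e, Finset.sum_add_distrib, Finset.sum_sub_distrib, ← Finset.mul_sum, h1, ← hc]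
      ring
    rw [this]; nlinarith [sq_nonneg c]
  have hsum : ∀ q : ι → α, ∑ i, f (q i) - Fintype.card ι * c = ∑ i, (f (q i) - c) := by
    intro q; simp [Finset.sum_sub_distrib]
  have h2 := pr_le_sum (p := prodWt p) (prodWt_nonneg hp)
    (A := fun q : ι → α => t < |∑ i, f (q i) - Fintype.card ι * c|)
    (fun q => (∑ i, (f (q i) - c)) ^ 2 / t ^ 2) (fun q => by positivity) (by
      intro q hq
      rw [one_le_div (by positivity), ← hsum, ← sq_abs (∑ i, f (q i) - _)]
      exact pow_le_pow_left₀ ht.le hq.le 2)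
  refine h2.trans ?_
  simp only [← mul_div_assoc]
  rw [← Finset.sum_div, sum_prodWt_sq h1 _ hg, div_le_iff₀ (by positivity)]
  have : (Fintype.card ι : ℝ) * ∑ a, p a * (f a - c) ^ 2
      ≤ Fintype.card ι * ∑ a, p a * f a ^ 2 := by gcongr
  linarith

/-- A Chernoff bound: a sum of independent copies of a variable with values in `[0, B]` and mean at
most `1` rarely exceeds four times its number of terms. -/
theorem pr_sum_gt_four_le (hp : ∀ a, 0 ≤ p a) (h1 : ∑ a, p a = 1) (f : α → ℝ) {B : ℝ}
    (hB : 0 < B) (hf0 : ∀ a, 0 ≤ f a) (hfB : ∀ a, f a ≤ B) (hmean : ∑ a, p a * f a ≤ 1) :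
    pr (prodWt p) (fun q : ι → α => 4 * Fintype.card ι < ∑ i, f (q i))
      ≤ Real.exp (-(2 * Fintype.card ι / B)) := by
  have h2 := pr_le_sum (p := prodWt p) (prodWt_nonneg hp)
    (A := fun q : ι → α => 4 * (Fintype.card ι : ℝ) < ∑ i, f (q i))
    (fun q => Real.exp ((∑ i, f (q i) - 4 * Fintype.card ι) / B)) (fun q => (Real.exp_pos _).le) (by
      intro q hq
      exact Real.one_le_exp (div_nonneg (by linarith) hB.le))
  refine h2.trans ?_
  have e : ∀ q : ι → α, Real.exp ((∑ i, f (q i) - 4 * Fintype.card ι) / B)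
      = Real.exp (-(4 * Fintype.card ι / B)) * ∏ i, Real.exp (f (q i) / B) := by
    intro q
    rw [← Real.exp_sum, ← Real.exp_add, ← Finset.sum_div]
    congr 1; ring
  have hconv : ∀ a, Real.exp (f a / B) ≤ 1 + 2 * (f a / B) := by
    intro a
    have hx0 : 0 ≤ f a / B := div_nonneg (hf0 a) hB.le
    have hx1 : f a / B ≤ 1 := (div_le_one hB).2 (hfB a)
    have := Real.abs_exp_sub_one_le (x := f a / B) (by rw [abs_of_nonneg hx0]; exact hx1)
    rw [abs_of_nonneg hx0] at this
    linarith [le_abs_self (Real.exp (f a / B) - 1)]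
  have hm : ∑ a, p a * Real.exp (f a / B) ≤ Real.exp (2 / B) := by
    calc _ ≤ ∑ a, p a * (1 + 2 * (f a / B)) :=
          Finset.sum_le_sum fun a _ => mul_le_mul_of_nonneg_left (hconv a) (hp a)
      _ = 1 + 2 / B * ∑ a, p a * f a := by
          rw [Finset.mul_sum]
          nth_rewrite 2 [← h1]
          rw [← Finset.sum_add_distrib]
          exact Finset.sum_congr rfl fun a _ => by ring
      _ ≤ 1 + 2 / B * 1 := by gcongr
      _ ≤ _ := by linarith [Real.add_one_le_exp (2 / B)]
  calc ∑ q : ι → α, prodWt p q * Real.exp ((∑ i, f (q i) - 4 * Fintype.card ι) / B)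
      = Real.exp (-(4 * Fintype.card ι / B)) *
          ∑ q : ι → α, prodWt p q * ∏ i, Real.exp (f (q i) / B) := by
        rw [Finset.mul_sum]
        exact Finset.sum_congr rfl fun q _ => by rw [e]; ring
    _ = Real.exp (-(4 * Fintype.card ι / B)) * (∑ a, p a * Real.exp (f a / B)) ^ Fintype.card ι := by
        rw [sum_prodWt_mul p (fun _ a => Real.exp (f a / B))]; simp
    _ ≤ Real.exp (-(4 * Fintype.card ι / B)) * Real.exp (2 / B) ^ Fintype.card ι := by
        gcongr
        exact Finset.sum_nonneg fun a _ => mul_nonneg (hp a) (Real.exp_pos _).le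
    _ = _ := by
        rw [← Real.exp_nat_mul, ← Real.exp_add]; congr 1; ring

end prodWt

/-! ### Random signs -/

/-- The sign `±1` encoded by a Boolean. -/
def sgn (b : Bool) : ℝ := if b then 1 else -1

/-- The uniform distribution on the sign vectors indexed by `ι`. -/
def signWt {ι : Type*} [Fintype ι] : (ι → Bool) → ℝ := prodWt fun _ => 1 / 2

section signs

theorem signWt_nonneg {ι : Type*} [Fintype ι] (σ : ι → Bool) : 0 ≤ signWt σ :=
  prodWt_nonneg (fun _ => by norm_num) σ

variable {ι : Type*} [Fintype ι] [DecidableEq ι]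

theorem sum_signWt : ∑ σ : ι → Bool, signWt σ = 1 := sum_prodWt (by simp)

/-- Hoeffding's inequality for a signed sum with fixed coefficients. -/
theorem pr_sign_gt_le (y : ι → ℝ) {t : ℝ} (ht : 0 ≤ t) :
    pr signWt (fun σ : ι → Bool => t * √(∑ i, y i ^ 2) < ∑ i, sgn (σ i) * y i)
      ≤ Real.exp (-(t ^ 2 / 2)) := by
  set v := √(∑ i, y i ^ 2) with hv
  have hv2 : v ^ 2 = ∑ i, y i ^ 2 := Real.sq_sqrt (Finset.sum_nonneg fun i _ => sq_nonneg _)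
  -- For `y = 0` the exponent `t / v` below would be a division by zero; both sides vanish.
  rcases eq_or_lt_of_le (Real.sqrt_nonneg (∑ i, y i ^ 2)) with h0 | h0
  · rw [← hv] at h0
    have hy : ∀ i, y i = 0 := by
      intro i
      have := (Finset.sum_eq_zero_iff_of_nonneg (fun i _ => sq_nonneg (y i))).1
        (by rw [← hv2, ← h0]; simp : ∑ i, y i ^ 2 = 0) i (Finset.mem_univ i)
      simpa using this
    have : pr signWt (fun σ : ι → Bool => t * v < ∑ i, sgn (σ i) * y i) = 0 := by
      unfold pr
      exact Finset.sum_eq_zero fun σ _ => by simp [hy, ← h0]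
    rw [this]; positivity
  · rw [← hv] at h0
    set l := t / v with hl
    have h2 := pr_le_sum (p := signWt) signWt_nonneg
      (A := fun σ : ι → Bool => t * v < ∑ i, sgn (σ i) * y i)
      (fun σ => Real.exp (l * (∑ i, sgn (σ i) * y i - t * v))) (fun q => (Real.exp_pos _).le) (by
        intro q hq
        exact Real.one_le_exp (mul_nonneg (div_nonneg ht h0.le) (by linarith)))
    refine h2.trans ?_
    have e : ∀ σ : ι → Bool, Real.exp (l * (∑ i, sgn (σ i) * y i - t * v))
        = Real.exp (-(t ^ 2)) * ∏ i, Real.exp (l * (sgn (σ i) * y i)) := by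
      intro σ
      rw [← Real.exp_sum, ← Real.exp_add, ← Finset.mul_sum]
      congr 1
      have : l * (t * v) = t ^ 2 := by rw [hl]; field_simp
      rw [mul_sub, this]; ring
    calc ∑ σ : ι → Bool, signWt σ * Real.exp (l * (∑ i, sgn (σ i) * y i - t * v))
        = Real.exp (-(t ^ 2)) *
          ∑ σ : ι → Bool, signWt σ * ∏ i, Real.exp (l * (sgn (σ i) * y i)) := by
          rw [Finset.mul_sum]
          exact Finset.sum_congr rfl fun q _ => by rw [e]; ring
      _ = Real.exp (-(t ^ 2)) * ∏ i, Real.cosh (l * y i) := by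
          unfold signWt
          rw [sum_prodWt_mul _ (fun i b => Real.exp (l * (sgn b * y i)))]
          congr 1
          refine Finset.prod_congr rfl fun i _ => ?_
          rw [Real.cosh_eq]
          simp [sgn]; ring
      _ ≤ Real.exp (-(t ^ 2)) * ∏ i, Real.exp ((l * y i) ^ 2 / 2) := by
          gcongr with i
          exact Real.cosh_le_exp_half_sq _
      _ = _ := by
          rw [← Real.exp_sum, ← Real.exp_add]
          congr 1
          simp only [mul_pow]
          rw [← Finset.sum_div, ← Finset.mul_sum, ← hv2, hl]
          field_simp; ring

/-- Hoeffding's inequality for all vectors of a finite family at once. -/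
theorem pr_exists_sign_gt_le (F : Finset (ι → ℝ)) {t : ℝ} (ht : 0 ≤ t) :
    pr signWt (fun σ : ι → Bool => ∃ y ∈ F, t * √(∑ i, y i ^ 2) < |∑ i, sgn (σ i) * y i|)
      ≤ 2 * F.card * Real.exp (-(t ^ 2 / 2)) := by
  refine (pr_exists_le signWt_nonneg F _).trans ?_
  have : ∀ y ∈ F, pr signWt (fun σ : ι → Bool => t * √(∑ i, y i ^ 2) < |∑ i, sgn (σ i) * y i|)
      ≤ 2 * Real.exp (-(t ^ 2 / 2)) := by
    intro y _
    have h1 := pr_sign_gt_le y ht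
    have h2 := pr_sign_gt_le (fun i => - y i) ht
    refine (pr_mono signWt_nonneg (fun σ h => ?_)).trans
      ((pr_or_le signWt_nonneg).trans ((add_le_add h1 h2).trans_eq (by ring)))
    simpa [lt_abs, Finset.sum_neg_distrib] using h
  refine (Finset.sum_le_sum this).trans_eq ?_
  simp; ring

end signs

/-! ### Symmetrization -/

section symm

/-- The weights of a pair of independent samples. -/
def pairWt {α : Type*} (p : α → ℝ) (z : α × α) : ℝ := p z.1 * p z.2

theorem pairWt_nonneg {α : Type*} {p : α → ℝ} (hp : ∀ a, 0 ≤ p a) (z : α × α) : 0 ≤ pairWt p z :=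
  mul_nonneg (hp _) (hp _)

/-- Exchange the entries of the pairs whose sign is negative. -/
def swapSign {ι α : Type*} (σ : ι → Bool) (z : ι → α × α) : ι → α × α :=
  fun i => if σ i then z i else (z i).swap

theorem swapSign_involutive {ι α : Type*} (σ : ι → Bool) :
    Function.Involutive (swapSign (α := α) σ) := by
  intro z; funext i
  unfold swapSign
  by_cases h : σ i <;> simp [h]

variable {ι α 𝒮 : Type*} [Fintype ι] [DecidableEq ι] [Fintype α] {p : α → ℝ}

theorem sum_prodWt_pairWt (f : (ι → α) → (ι → α) → ℝ) :
    ∑ z : ι → α × α, prodWt (pairWt p) z * f (fun i => (z i).1) (fun i => (z i).2)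
      = ∑ q : ι → α, ∑ q' : ι → α, prodWt p q * prodWt p q' * f q q' := by
  rw [← Fintype.sum_prod_type' (fun q q' => prodWt p q * prodWt p q' * f q q')]
  refine Fintype.sum_equiv (Equiv.arrowProdEquivProdArrow ι (fun _ => α) (fun _ => α)) _ _
    fun z => ?_
  simp only [prodWt, pairWt, Finset.prod_mul_distrib]
  rfl

open Classical in
theorem pr_eq_sum {Ω : Type*} [Fintype Ω] (p : Ω → ℝ) (A : Ω → Prop) :
    pr p A = ∑ ω, p ω * if A ω then 1 else 0 :=
  Finset.sum_congr rfl fun ω _ => by split_ifs <;> simp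

/-- The law of a family of independent pairs is invariant under exchanging entries of pairs. -/
theorem pr_swapSign (σ : ι → Bool) (A : (ι → α × α) → Prop) :
    pr (prodWt (pairWt p)) (fun z => A (swapSign σ z)) = pr (prodWt (pairWt p)) A := by
  unfold pr
  refine Fintype.sum_equiv (swapSign_involutive σ).toPerm _ _ fun z => ?_
  have : prodWt (pairWt p) (swapSign σ z) = prodWt (pairWt p) z := by
    unfold prodWt
    refine Finset.prod_congr rfl fun i _ => ?_
    unfold swapSign pairWt
    split_ifs
    · rfl
    · simp [mul_comm]
  rw [← this]
  rfl

/-- Two independent samples deviate from each other no more than a sample with random signs: swapping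
the entries of the pairs at random does not change the law of the difference, and the two halves of
the signed difference are equally distributed. -/
theorem pr_symm_pair_le (hp : ∀ a, 0 ≤ p a) (h1 : ∑ a, p a = 1) (h : 𝒮 → α → ℝ) (t : 𝒮 → ℝ) :
    pr (prodWt (pairWt p))
        (fun z : ι → α × α => ∃ S, t S < |∑ i, (h S (z i).1 - h S (z i).2)|)
      ≤ 2 * ∑ q : ι → α, prodWt p q *
          pr signWt (fun σ : ι → Bool => ∃ S, t S / 2 < |∑ i, sgn (σ i) * h S (q i)|) := by
  classical
  set A : (ι → α × α) → Prop := fun z => ∃ S, t S < |∑ i, (h S (z i).1 - h S (z i).2)| with hA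
  set G : (ι → α) → (ι → Bool) → Prop :=
    fun q σ => ∃ S, t S / 2 < |∑ i, sgn (σ i) * h S (q i)| with hG
  have hsub : ∀ σ z, A (swapSign σ z) → G (fun i => (z i).1) σ ∨ G (fun i => (z i).2) σ := by
    rintro σ z ⟨S, hS⟩
    have e : ∑ i, (h S (swapSign σ z i).1 - h S (swapSign σ z i).2)
        = ∑ i, sgn (σ i) * h S (z i).1 - ∑ i, sgn (σ i) * h S (z i).2 := by
      rw [← Finset.sum_sub_distrib]
      refine Finset.sum_congr rfl fun i _ => ?_
      unfold swapSign sgn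
      split_ifs <;> simp
      ring
    rw [e] at hS
    by_contra hcon
    simp only [hG, not_or, not_exists, not_lt] at hcon
    have := abs_sub (∑ i, sgn (σ i) * h S (z i).1) (∑ i, sgn (σ i) * h S (z i).2)
    linarith [hcon.1 S, hcon.2 S]
  have step : ∀ σ : ι → Bool, pr (prodWt (pairWt p)) A
      ≤ 2 * ∑ q : ι → α, prodWt p q * if G q σ then 1 else 0 := by
    intro σ
    rw [← pr_swapSign σ A]
    refine (pr_mono (prodWt_nonneg (pairWt_nonneg hp)) (hsub σ)).trans
      ((pr_or_le (prodWt_nonneg (pairWt_nonneg hp))).trans ?_)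
    rw [pr_eq_sum, pr_eq_sum,
      sum_prodWt_pairWt (fun q _ => if G q σ then 1 else 0),
      sum_prodWt_pairWt (fun _ q => if G q σ then 1 else 0), two_mul]
    refine add_le_add (le_of_eq ?_) (le_of_eq ?_)
    · refine Finset.sum_congr rfl fun q _ => ?_
      rw [← Finset.sum_mul, ← Finset.mul_sum, sum_prodWt h1, mul_one]
    · rw [Finset.sum_comm]
      refine Finset.sum_congr rfl fun q _ => ?_
      rw [← Finset.sum_mul, ← Finset.sum_mul, sum_prodWt h1, one_mul]
  calc pr (prodWt (pairWt p)) A = ∑ σ : ι → Bool, signWt σ * pr (prodWt (pairWt p)) A := by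
        rw [← Finset.sum_mul, sum_signWt, one_mul]
    _ ≤ ∑ σ : ι → Bool, signWt σ * (2 * ∑ q : ι → α, prodWt p q * if G q σ then 1 else 0) :=
        Finset.sum_le_sum fun σ _ => mul_le_mul_of_nonneg_left (step σ) (signWt_nonneg σ)
    _ = _ := by
        simp only [pr_eq_sum, Finset.mul_sum]
        rw [Finset.sum_comm]
        refine Finset.sum_congr rfl fun q _ => Finset.sum_congr rfl fun σ _ => ?_
        ring

/-- Symmetrization: if each single sum concentrates with probability `1/2`, then uniform deviations
of the sums from their means are controlled by the same sums with random signs. -/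
theorem pr_exists_deviation_le (hp : ∀ a, 0 ≤ p a) (h1 : ∑ a, p a = 1) (h : 𝒮 → α → ℝ)
    (c t : 𝒮 → ℝ)
    (hc : ∀ S, pr (prodWt p) (fun q : ι → α => t S < |∑ i, h S (q i) - c S|) ≤ 1 / 2) :
    pr (prodWt p) (fun q : ι → α => ∃ S, 2 * t S < |∑ i, h S (q i) - c S|)
      ≤ 4 * ∑ q : ι → α, prodWt p q *
          pr signWt (fun σ : ι → Bool => ∃ S, t S / 2 < |∑ i, sgn (σ i) * h S (q i)|) := by
  classical
  set A : (ι → α) → Prop := fun q => ∃ S, 2 * t S < |∑ i, h S (q i) - c S| with hA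
  set B : (ι → α) → (ι → α) → Prop :=
    fun q q' => ∃ S, t S < |∑ i, (h S (q i) - h S (q' i))| with hB
  -- If `q` deviates by `2 t` for `S`, then with probability `1 / 2` an independent sample deviates by
  -- at most `t` for the same `S`, and so the two samples deviate by `t` from each other.
  have hhalf : ∀ q, A q → 1 / 2 ≤ ∑ q' : ι → α, prodWt p q' * if B q q' then 1 else 0 := by
    rintro q ⟨S, hS⟩
    rw [← pr_eq_sum]
    have h2 := pr_add_pr_not (p := prodWt p)
      (A := fun q : ι → α => t S < |∑ i, h S (q i) - c S|)
    rw [sum_prodWt h1] at h2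
    have h3 : pr (prodWt p) (fun q : ι → α => ¬ t S < |∑ i, h S (q i) - c S|)
        ≤ pr (prodWt p) (B q) := by
      refine pr_mono (prodWt_nonneg hp) fun q' hq' => ⟨S, ?_⟩
      rw [not_lt] at hq'
      rw [Finset.sum_sub_distrib]
      have := abs_sub (∑ i, h S (q i) - ∑ i, h S (q' i)) (c S - ∑ i, h S (q' i))
      rw [show ∑ i, h S (q i) - ∑ i, h S (q' i) - (c S - ∑ i, h S (q' i))
        = ∑ i, h S (q i) - c S by ring, abs_sub_comm (c S)] at this
      linarith
    linarith [hc S]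
  have h4 : pr (prodWt p) A ≤ 2 * pr (prodWt (pairWt p))
        (fun z : ι → α × α => ∃ S, t S < |∑ i, (h S (z i).1 - h S (z i).2)|) := by
    rw [pr_eq_sum (prodWt (pairWt p)),
      sum_prodWt_pairWt (fun q q' => if B q q' then (1 : ℝ) else 0), Finset.mul_sum]
    unfold pr
    refine Finset.sum_le_sum fun q _ => ?_
    simp only [mul_assoc]
    rw [← Finset.mul_sum]
    have h0 : 0 ≤ ∑ q' : ι → α, prodWt p q' * if B q q' then (1 : ℝ) else 0 :=
      Finset.sum_nonneg fun q' _ => mul_nonneg (prodWt_nonneg hp _) (by split_ifs <;> norm_num)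
    have h5 := prodWt_nonneg hp q
    by_cases hq : A q
    · have := hhalf q hq
      simp only [hq, if_true]
      nlinarith
    · simp only [hq, if_false]
      positivity
  linarith [pr_symm_pair_le (ι := ι) hp h1 h t]

end symm

/-! ### Distances to a tuple of centers -/

section distance

variable {d k : ℕ}

/-- The distance of `p` to the nearest center of `S`; unlike `pointCost` it is Lipschitz in `p`. -/
def centerDist (p : Pt d) (S : Fin k → Pt d) : ℝ := √(pointCost p S)

theorem centerDist_nonneg (p : Pt d) (S : Fin k → Pt d) : 0 ≤ centerDist p S := Real.sqrt_nonneg _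

theorem centerDist_sq (p : Pt d) (S : Fin k → Pt d) : centerDist p S ^ 2 = pointCost p S :=
  Real.sq_sqrt (pointCost_nonneg p S)

theorem pointCost_le (p : Pt d) (S : Fin k → Pt d) (j : Fin k) : pointCost p S ≤ ‖p - S j‖ ^ 2 :=
  ciInf_le (Set.finite_range _).bddBelow j

theorem centerDist_le (p : Pt d) (S : Fin k → Pt d) (j : Fin k) : centerDist p S ≤ ‖p - S j‖ :=
  Real.sqrt_le_iff.2 ⟨norm_nonneg _, pointCost_le p S j⟩

theorem exists_centerDist_eq [Nonempty (Fin k)] (p : Pt d) (S : Fin k → Pt d) :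
    ∃ j, centerDist p S = ‖p - S j‖ := by
  obtain ⟨j, hj⟩ := exists_eq_ciInf_of_finite (f := fun j => ‖p - S j‖ ^ 2)
  refine ⟨j, ?_⟩
  rw [centerDist, pointCost, ← hj, Real.sqrt_sq (norm_nonneg _)]

theorem centerDist_le_add [Nonempty (Fin k)] (p q : Pt d) (S : Fin k → Pt d) :
    centerDist p S ≤ centerDist q S + ‖p - q‖ := by
  obtain ⟨j, hj⟩ := exists_centerDist_eq q S
  rw [hj]
  refine (centerDist_le p S j).trans ?_
  have := norm_add_le (q - S j) (p - q)
  rwa [show q - S j + (p - q) = p - S j by abel] at this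

end distance

/-! ### Nets for linear functionals -/

section innerNet

open scoped RealInnerProductSpace

variable {V ι : Type*} [NormedAddCommGroup V] [InnerProductSpace ℝ V]

/-- The functions in `G` approximate, for each `u` in the unit ball, the inner products of `u` with
the vectors `b x`, `x ∈ J`, up to the error `η ‖b x‖`. -/
def IsInnerNet (J : Finset ι) (b : ι → V) (η : ℝ) (G : Finset (ι → ℝ)) : Prop :=
  ∀ u : V, ‖u‖ ≤ 1 → ∃ g ∈ G, ∀ x ∈ J, |⟪b x, u⟫ - g x| ≤ η * ‖b x‖

/-- The scale `R` at which a net is used is only required to be an upper bound for `‖u‖`. -/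
theorem IsInnerNet.scale {J : Finset ι} {b : ι → V} {η : ℝ} {G : Finset (ι → ℝ)}
    (h : IsInnerNet J b η G) {R : ℝ} {u : V} (hu : ‖u‖ ≤ R) :
    ∃ g ∈ G, ∀ x ∈ J, |⟪b x, u⟫ - R * g x| ≤ η * R * ‖b x‖ := by
  rcases eq_or_lt_of_le ((norm_nonneg u).trans hu) with h0 | h0
  · subst h0
    obtain ⟨g, hg, _⟩ := h 0 (by simp)
    refine ⟨g, hg, fun x _ => ?_⟩
    have : u = 0 := by simpa using hu
    simp [this]
  · obtain ⟨g, hg, hg'⟩ := h (R⁻¹ • u) (by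
      rw [norm_smul, norm_inv, Real.norm_of_nonneg h0.le, inv_mul_le_iff₀ h0]; simpa using hu)
    refine ⟨g, hg, fun x hx => ?_⟩
    have h1 := hg' x hx
    rw [inner_smul_right] at h1
    calc |⟪b x, u⟫ - R * g x| = R * |R⁻¹ * ⟪b x, u⟫ - g x| := by
          rw [← abs_of_pos h0, ← abs_mul, abs_of_pos h0]
          congr 1; field_simp
      _ ≤ R * (η * ‖b x‖) := by gcongr
      _ = _ := by ring

/-- A greedy approximation: as long as some `b x` detects `u - g`, a step of length `η` in the
direction `± b x` decreases `‖u - g‖ ^ 2` by at least `η ^ 2`, so at most `N` steps occur. -/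
theorem exists_greedy_net [Fintype ι] (b : ι → V) {η : ℝ} (hη : 0 < η) (N : ℕ) :
    ∃ G : Finset V, G.card ≤ (2 * Fintype.card ι + 1) ^ N ∧ 0 ∈ G ∧
      ∀ u : V, ‖u‖ ^ 2 ≤ N * η ^ 2 → ∃ g ∈ G, ∀ x, |⟪b x, u - g⟫| ≤ η * ‖b x‖ := by
  classical
  induction N with
  | zero =>
    refine ⟨{0}, by simp, by simp, fun u hu => ⟨0, by simp, fun x => ?_⟩⟩
    have : u = 0 := by simpa using hu
    simp only [this, sub_zero, inner_zero_right, abs_zero]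
    positivity
  | succ N ih =>
    obtain ⟨G, hcard, h0, hG⟩ := ih
    set e : ι → V := fun x => (η / ‖b x‖) • b x with he
    set Z : Finset V := insert 0 (Finset.univ.image e ∪ Finset.univ.image fun x => - e x) with hZ
    have hZcard : Z.card ≤ 2 * Fintype.card ι + 1 := by
      refine (Finset.card_insert_le _ _).trans (Nat.add_le_add_right ?_ 1)
      refine (Finset.card_union_le _ _).trans ?_
      have h1 : (Finset.univ.image e).card ≤ Fintype.card ι := Finset.card_image_le
      have h2 : (Finset.univ.image fun x => - e x).card ≤ Fintype.card ι := Finset.card_image_le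
      omega
    refine ⟨(G ×ˢ Z).image fun p => p.1 + p.2, ?_, ?_, ?_⟩
    · refine Finset.card_image_le.trans ?_
      rw [Finset.card_product, pow_succ]
      exact Nat.mul_le_mul hcard hZcard
    · exact Finset.mem_image.2 ⟨(0, 0), by simp [h0, hZ], by simp⟩
    · intro u hu
      by_cases hall : ∀ x, |⟪b x, u⟫| ≤ η * ‖b x‖
      · exact ⟨0, Finset.mem_image.2 ⟨(0, 0), by simp [h0, hZ], by simp⟩, by simpa using hall⟩
      · push Not at hall
        obtain ⟨x, hx⟩ := hall
        have hb : 0 < ‖b x‖ := by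
          rw [norm_pos_iff]; intro h; simp [h] at hx
        have hne : ‖e x‖ = η := by
          rw [he]; simp only
          rw [norm_smul, Real.norm_of_nonneg (by positivity)]; field_simp
        have hin : ⟪u, e x⟫ = η / ‖b x‖ * ⟪b x, u⟫ := by
          rw [he]; simp only
          rw [inner_smul_right, real_inner_comm]
        obtain ⟨z, hz, hzn, hzi⟩ : ∃ z ∈ Z, ‖z‖ = η ∧ η ^ 2 ≤ ⟪u, z⟫ := by
          have key : η ^ 2 ≤ η / ‖b x‖ * |⟪b x, u⟫| := by
            rw [div_mul_eq_mul_div, le_div_iff₀ hb]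
            nlinarith
          rcases le_total 0 ⟪b x, u⟫ with hs | hs
          · refine ⟨e x, by simp [hZ], hne, ?_⟩
            rwa [hin, ← abs_of_nonneg hs]
          · refine ⟨- e x, by simp [hZ], by rw [norm_neg, hne], ?_⟩
            rwa [inner_neg_right, hin, ← mul_neg, ← abs_of_nonpos hs]
        obtain ⟨g, hg, hg'⟩ := hG (u - z) (by
          rw [norm_sub_sq_real, hzn]
          push_cast at hu
          nlinarith)
        refine ⟨g + z, Finset.mem_image.2 ⟨(g, z), by simp [hg, hz], rfl⟩, fun y => ?_⟩
        have := hg' y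
        rwa [sub_sub, add_comm z g] at this

/-- A net for the inner products whose size does not depend on the dimension and only polynomially
(with exponent about `η⁻²`) on the number of vectors. -/
theorem exists_isInnerNet_greedy [Fintype ι] (J : Finset ι) (b : ι → V) {η : ℝ} (hη : 0 < η) :
    ∃ G : Finset (ι → ℝ), G.card ≤ (2 * Fintype.card ι + 1) ^ ⌈1 / η ^ 2⌉₊ ∧
      IsInnerNet J b η G := by
  classical
  obtain ⟨G, hcard, -, hG⟩ := exists_greedy_net b hη ⌈1 / η ^ 2⌉₊
  refine ⟨G.image fun g x => ⟪b x, g⟫, Finset.card_image_le.trans hcard, fun u hu => ?_⟩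
  obtain ⟨g, hg, hg'⟩ := hG u (by
    have h1 := Nat.le_ceil (1 / η ^ 2)
    rw [div_le_iff₀ (by positivity)] at h1
    nlinarith [norm_nonneg u])
  refine ⟨_, Finset.mem_image_of_mem _ hg, fun x _ => ?_⟩
  rw [← inner_sub_right]
  exact hg' x

/-- A net for the inner products with few vectors: each inner product is rounded separately. -/
theorem exists_isInnerNet_grid (J : Finset ι) (b : ι → V) {η : ℝ} (hη : 0 < η) :
    ∃ G : Finset (ι → ℝ), G.card ≤ (2 * ⌈1 / η⌉₊ + 1) ^ J.card ∧ IsInnerNet J b η G := by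
  classical
  set K := ⌈1 / η⌉₊ with hK
  set I : Finset ℤ := Finset.Icc (-(K : ℤ)) K with hI
  refine ⟨(Fintype.piFinset fun _ : J => I).image fun z x =>
    if hx : x ∈ J then η * ‖b x‖ * z ⟨x, hx⟩ else 0, ?_, fun u hu => ?_⟩
  · refine Finset.card_image_le.trans ?_
    rw [Fintype.card_piFinset]
    have : I.card = 2 * K + 1 := by
      rw [hI, Int.card_Icc]; omega
    simp [this]
  · refine ⟨_, Finset.mem_image_of_mem _ (a := fun x : J => ⌊⟪b x, u⟫ / (η * ‖b x‖)⌋) ?_, ?_⟩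
    · rw [Fintype.mem_piFinset]
      intro x
      rw [hI, Finset.mem_Icc]
      have habs : |⟪b x, u⟫ / (η * ‖b x‖)| ≤ K := by
        rw [abs_div, abs_of_nonneg (by positivity : 0 ≤ η * ‖b x‖)]
        refine le_trans ?_ (Nat.le_ceil (1 / η))
        have h1 : |⟪b x, u⟫| ≤ ‖b x‖ :=
          (abs_real_inner_le_norm _ _).trans (mul_le_of_le_one_right (norm_nonneg _) hu)
        rcases eq_or_lt_of_le (norm_nonneg (b x)) with h0 | h0
        · rw [← h0]; simp; positivity
        · rw [div_le_div_iff₀ (by positivity) hη]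
          nlinarith
      rw [abs_le] at habs
      constructor
      · rw [Int.le_floor]; push_cast; exact habs.1
      · have := (Int.floor_le (⟪b x, u⟫ / (η * ‖b x‖))).trans habs.2
        exact_mod_cast this
    · intro x hx
      simp only [hx, dif_pos]
      rcases eq_or_lt_of_le (norm_nonneg (b x)) with h0 | h0
      · have : b x = 0 := by rw [← norm_eq_zero, ← h0]
        simp [this]
      · have hpos : 0 < η * ‖b x‖ := by positivity
        have e : ⟪b x, u⟫ - η * ‖b x‖ * ⌊⟪b x, u⟫ / (η * ‖b x‖)⌋
            = η * ‖b x‖ * Int.fract (⟪b x, u⟫ / (η * ‖b x‖)) := by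
          rw [Int.fract]; field_simp
        rw [e, abs_of_nonneg (mul_nonneg hpos.le (Int.fract_nonneg _))]
        exact mul_le_of_le_one_right hpos.le (Int.fract_lt_one _).le

end innerNet

/-! ### Nets for the cost vectors -/

/-- A scale `R` for a center at distance `r` from the set of reference points, taken from a finite
list: for each `i`, either `R` is comparable to `r` or at most `2 D i`, or `D i` is negligible
compared with `r`, and the comparison of `R` with `D i` tells which case occurs. -/
theorem exists_scale {ι : Type*} [Fintype ι] (D : ι → ℝ) (r : ℝ) (L : ℕ) :
    (∃ l, ∃ t ≤ L, 0 < D l ∧ r ≤ 2 ^ t * D l ∧ ∀ i, 0 < D i →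
      (2 ^ t * D l ≤ 2 ^ L * D i ∧ 2 ^ t * D l ≤ 2 * max r (D i)) ∨
      (2 ^ L * D i < 2 ^ t * D l ∧ 2 ^ L * D i < 2 * r)) ∨
    ∀ i, 0 < D i → 2 ^ L * D i < 2 * r := by
  classical
  by_cases h1 : ∃ l, ∃ t ≤ L, 0 < D l ∧ r ≤ 2 ^ t * D l ∧ 2 ^ t * D l ≤ 2 * r
  · obtain ⟨l, t, ht, hl, ha, hb⟩ := h1
    refine Or.inl ⟨l, t, ht, hl, ha, fun i _ => ?_⟩
    rcases lt_or_ge (2 ^ L * D i) (2 ^ t * D l) with h | h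
    · exact Or.inr ⟨h, h.trans_le hb⟩
    · exact Or.inl ⟨h, hb.trans (by gcongr; exact le_max_left _ _)⟩
  · push Not at h1
    have gap : ∀ i, 0 < D i → D i < r → 2 ^ L * D i < r := by
      intro i hi hir
      have : ∀ t ≤ L, 2 ^ t * D i < r := by
        intro t
        induction t with
        | zero => intro _; simpa using hir
        | succ t ih =>
          intro ht
          by_contra hcon
          have h2 := h1 i (t + 1) ht hi (not_lt.1 hcon)
          have h3 := ih (by omega)
          rw [pow_succ] at h2
          linarith
      exact this L le_rfl
    by_cases h2 : ∃ l, 0 < D l ∧ r ≤ D l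
    · obtain ⟨l0, hl0⟩ := h2
      obtain ⟨l, hl, hmin⟩ := Finset.exists_min_image
        (Finset.univ.filter fun l => 0 < D l ∧ r ≤ D l) D ⟨l0, by simpa using hl0⟩
      simp only [Finset.mem_filter, Finset.mem_univ, true_and] at hl hmin
      refine Or.inl ⟨l, 0, Nat.zero_le _, hl.1, by simpa using hl.2, fun i hi => ?_⟩
      rw [pow_zero, one_mul]
      rcases lt_or_ge (D i) r with hir | hir
      · have := gap i hi hir
        exact Or.inr ⟨this.trans_le hl.2, by
          have : 0 < 2 ^ L * D i := by positivity
          linarith⟩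
      · have h3 := hmin i ⟨hi, hir⟩
        have h4 : D i ≤ 2 ^ L * D i := le_mul_of_one_le_left hi.le (one_le_pow₀ one_le_two)
        exact Or.inl ⟨h3.trans h4, by linarith [le_max_right r (D i)]⟩
    · push Not at h2
      refine Or.inr fun i hi => ?_
      have := gap i hi (h2 i hi)
      have : 0 < 2 ^ L * D i := by positivity
      linarith

section costNet

open scoped RealInnerProductSpace

variable {d k : ℕ} {ι : Type*} [Fintype ι] (a : Fin k → Pt d) (x : ι → Pt d) (cl : ι → Fin k)

/-- A net for the squared distances to one center. With `u` the offset of the center from its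
nearest reference point `a j₀`, the squared distance is a combination of `‖u‖ ^ 2` and of inner
products of `u` with `x i - a (cl i)` and with `a j₀ - a (cl i)`; the net rounds all of these at a
scale given by `exists_scale`. Points too close to their reference point for this scale get the
value `4 D ^ 2 / ε ^ 2`, which is larger than all costs of interest. -/
theorem exists_centerNet {J : Finset (Fin k)} {ε η ζ : ℝ} {L N₂ : ℕ}
    (hL : 6 / ε ≤ 2 ^ L) (hη : 0 < η) (hζ : 0 < ζ)
    {G₁ : Finset (ι → ℝ)} (h₁ : IsInnerNet Finset.univ (fun i => x i - a (cl i)) η G₁)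
    {G₂ : Fin k → Finset (Fin k → ℝ)} (h₂ : ∀ j₀, IsInnerNet J (fun j => a j₀ - a j) ζ (G₂ j₀))
    (hN₂ : ∀ j₀, (G₂ j₀).card ≤ N₂) :
    ∃ 𝒩 : Finset (ι → ℝ),
      𝒩.card ≤ 1 + Fintype.card ι * (L + 1) * k * (⌈1 / ζ⌉₊ + 1) * G₁.card * N₂ ∧
      ∀ s : Pt d, ∃ v ∈ 𝒩, ∀ i, cl i ∈ J → 0 < ‖x i - a (cl i)‖ →
        |v i - ‖x i - s‖ ^ 2| ≤
          12 * (η * ‖x i - a (cl i)‖ * max ‖s - a (cl i)‖ ‖x i - a (cl i)‖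
            + ζ * max ‖s - a (cl i)‖ ‖x i - a (cl i)‖ ^ 2) ∨
        (3 * ‖x i - a (cl i)‖ / ε < ‖s - a (cl i)‖ ∧
          v i = 4 * ‖x i - a (cl i)‖ ^ 2 / ε ^ 2) := by
  classical
  set D : ι → ℝ := fun i => ‖x i - a (cl i)‖ with hD
  set big : ι → ℝ := fun i => 4 * D i ^ 2 / ε ^ 2 with hbig
  set val : ι × ℕ × ((j : Fin k) × (Fin k → ℝ)) × ℕ × (ι → ℝ) → ι → ℝ := fun c i =>
    if 2 ^ L * D i < 2 ^ c.2.1 * D c.1 then big i else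
      D i ^ 2 - 2 * ⟪x i - a (cl i), a c.2.2.1.1 - a (cl i)⟫
        - 2 * ((2 ^ c.2.1 * D c.1) * c.2.2.2.2 i) + ζ * (2 ^ c.2.1 * D c.1) ^ 2 * c.2.2.2.1
        + 2 * ((2 ^ c.2.1 * D c.1) * c.2.2.1.2 (cl i)) + ‖a c.2.2.1.1 - a (cl i)‖ ^ 2 with hval
  -- The parameters are the scale `2 ^ t * D l`, the nearest reference point with the roundings of
  -- the inner products of `u` with reference points, the rounding of `‖u‖ ^ 2`, and the roundings of
  -- the inner products of `u` with the points.
  set Q := (Finset.univ : Finset ι) ×ˢ Finset.range (L + 1) ×ˢ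
    (Finset.univ.sigma G₂) ×ˢ Finset.range (⌈1 / ζ⌉₊ + 1) ×ˢ G₁ with hQ
  refine ⟨insert big (Q.image val), ?_, fun s => ?_⟩
  · refine (Finset.card_insert_le _ _).trans ?_
    rw [add_comm]
    refine Nat.add_le_add_left (Finset.card_image_le.trans ?_) 1
    simp only [hQ, Finset.card_product, Finset.card_univ, Finset.card_range, Finset.card_sigma]
    have : ∑ j, (G₂ j).card ≤ k * N₂ := by
      simpa using Finset.sum_le_card_nsmul Finset.univ (fun j => (G₂ j).card) N₂ fun j _ => hN₂ j
    calc _ ≤ Fintype.card ι * ((L + 1) * ((k * N₂) * ((⌈1 / ζ⌉₊ + 1) * G₁.card))) := by gcongr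
      _ = _ := by ring
  by_cases hJ : J.Nonempty
  swap
  · refine ⟨big, by simp, fun i hi => ?_⟩
    rw [Finset.not_nonempty_iff_eq_empty] at hJ
    simp [hJ] at hi
  obtain ⟨j₀, hj₀, hmin⟩ := Finset.exists_min_image J (fun j => ‖s - a j‖) hJ
  set u := s - a j₀ with hu
  rcases exists_scale D ‖u‖ L with ⟨l, t, ht, hl, hR, hcase⟩ | hcase
  swap
  · refine ⟨big, by simp, fun i hi hDi => Or.inr ⟨?_, rfl⟩⟩
    have h3 := hcase i hDi
    have h4 := hmin _ hi
    have h5 : 6 / ε * D i ≤ 2 ^ L * D i := by gcongr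
    have e : 3 * D i / ε = 6 / ε * D i / 2 := by ring
    change 3 * D i / ε < _
    rw [e]; linarith
  · set R := 2 ^ t * D l with hRdef
    have hRpos : 0 < R := by positivity
    obtain ⟨g₁, hg₁, hg₁'⟩ := h₁.scale hR
    obtain ⟨g₂, hg₂, hg₂'⟩ := (h₂ j₀).scale hR
    set n := ⌊‖u‖ ^ 2 / (ζ * R ^ 2)⌋₊ with hn
    have hnle : n ≤ ⌈1 / ζ⌉₊ := by
      have h3 : ‖u‖ ^ 2 / (ζ * R ^ 2) ≤ 1 / ζ := by
        rw [div_le_div_iff₀ (by positivity) hζ]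
        have : ‖u‖ ^ 2 ≤ R ^ 2 := by gcongr
        nlinarith
      have h4 : (n : ℝ) ≤ ⌈1 / ζ⌉₊ :=
        (Nat.floor_le (by positivity)).trans (h3.trans (Nat.le_ceil _))
      exact_mod_cast h4
    have hnerr : |ζ * R ^ 2 * n - ‖u‖ ^ 2| ≤ ζ * R ^ 2 := by
      have hp : 0 < ζ * R ^ 2 := by positivity
      have h3 : (n : ℝ) ≤ ‖u‖ ^ 2 / (ζ * R ^ 2) := Nat.floor_le (by positivity)
      have h4 : ‖u‖ ^ 2 / (ζ * R ^ 2) < n + 1 := Nat.lt_floor_add_one _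
      rw [le_div_iff₀ hp] at h3
      rw [div_lt_iff₀ hp] at h4
      rw [abs_le]; constructor <;> nlinarith
    refine ⟨val (l, t, ⟨j₀, g₂⟩, n, g₁), ?_, fun i hi hDi => ?_⟩
    · refine Finset.mem_insert_of_mem (Finset.mem_image_of_mem _ ?_)
      simp only [hQ, Finset.mem_product, Finset.mem_univ, Finset.mem_range, Finset.mem_sigma,
        true_and]
      exact ⟨by omega, hg₂, by omega, hg₁⟩
    · change 0 < D i at hDi
      have hr := hmin _ hi
      change _ ≤ 12 * (η * D i * max _ (D i) + ζ * max _ (D i) ^ 2) ∨ (3 * D i / ε < _ ∧ _ = big i)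
      set r := ‖s - a (cl i)‖ with hrdef
      rcases hcase i hDi with ⟨h3, h4⟩ | ⟨h3, h4⟩
      · left
        have hv : val (l, t, ⟨j₀, g₂⟩, n, g₁) i = D i ^ 2
            - 2 * ⟪x i - a (cl i), a j₀ - a (cl i)⟫ - 2 * (R * g₁ i) + ζ * R ^ 2 * n
            + 2 * (R * g₂ (cl i)) + ‖a j₀ - a (cl i)‖ ^ 2 := by
          simp only [hval]
          rw [if_neg (not_lt.2 h3)]
        set b := a j₀ - a (cl i) with hb
        have hexp : ‖x i - s‖ ^ 2 = D i ^ 2 - 2 * ⟪x i - a (cl i), b⟫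
            - 2 * ⟪x i - a (cl i), u⟫ + ‖u‖ ^ 2 + 2 * ⟪b, u⟫ + ‖b‖ ^ 2 := by
          have e1 : x i - s = (x i - a (cl i)) - (b + u) := by rw [hb, hu]; abel
          rw [e1, norm_sub_sq_real, norm_add_sq_real, inner_add_right]
          ring
        have e1 := hg₁' i (Finset.mem_univ i)
        have e2 := hg₂' (cl i) hi
        rw [← hb] at e2
        -- This is where the choice of `j₀` as the nearest reference point enters: `‖u‖ ≤ r`.
        have hbn : ‖b‖ ≤ 2 * r := by
          have : b = (s - a (cl i)) - u := by rw [hb, hu]; abel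
          rw [this]
          refine (norm_sub_le _ _).trans ?_
          linarith
        rw [hv, hexp]
        set ϱ := max r (D i) with hϱ
        have hrϱ : r ≤ ϱ := le_max_left _ _
        have hϱ0 : 0 ≤ ϱ := (norm_nonneg _).trans hrϱ
        have hRϱ : R ≤ 2 * ϱ := h4.trans (by
          have : max ‖u‖ (D i) ≤ ϱ := max_le_max hr le_rfl
          linarith)
        have b1 : η * R * D i ≤ η * (2 * ϱ) * D i := by gcongr
        have b2 : ζ * R * ‖b‖ ≤ ζ * (2 * ϱ) * (2 * ϱ) := by
          have : ‖b‖ ≤ 2 * ϱ := by linarith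
          gcongr
        have b3 : ζ * R ^ 2 ≤ ζ * (2 * ϱ) ^ 2 := by gcongr
        change |⟪x i - a (cl i), u⟫ - R * g₁ i| ≤ η * R * D i at e1
        have hDϱ : 0 ≤ η * D i * ϱ := by positivity
        rw [abs_le] at e1 e2 hnerr ⊢
        constructor <;> linarith
      · right
        refine ⟨?_, ?_⟩
        · have h5 : 6 / ε * D i ≤ 2 ^ L * D i := by gcongr
          have e : 3 * D i / ε = 6 / ε * D i / 2 := by ring
          rw [e]; linarith
        · simp only [hval]
          rw [if_pos h3]

/-- A net for the vectors of costs `(cost(x i, S))_i`, of size at most the `k`-th power of the size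
of the net for one center. -/
theorem exists_costNet {J : Finset (Fin k)} {ε η ζ : ℝ} {L N₂ : ℕ} (hε : 0 < ε) (hε1 : ε ≤ 1)
    (hL : 6 / ε ≤ 2 ^ L) (hη : 0 < η) (hζ : 0 < ζ) (hη' : η ≤ 1 / 64) (hζ' : ζ ≤ 1 / 64)
    {G₁ : Finset (ι → ℝ)} (h₁ : IsInnerNet Finset.univ (fun i => x i - a (cl i)) η G₁)
    {G₂ : Fin k → Finset (Fin k → ℝ)} (h₂ : ∀ j₀, IsInnerNet J (fun j => a j₀ - a j) ζ (G₂ j₀))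
    (hN₂ : ∀ j₀, (G₂ j₀).card ≤ N₂) :
    ∃ 𝒱 : Finset (ι → ℝ),
      𝒱.card ≤ (1 + Fintype.card ι * (L + 1) * k * (⌈1 / ζ⌉₊ + 1) * G₁.card * N₂) ^ k ∧
      ∀ S : Fin k → Pt d, ∃ v ∈ 𝒱, ∀ i, cl i ∈ J →
        ε * centerDist (a (cl i)) S < ‖x i - a (cl i)‖ →
        |v i - pointCost (x i) S| ≤
          200 * (η * ‖x i - a (cl i)‖ * max ‖x i - a (cl i)‖ (centerDist (a (cl i)) S)
            + ζ * max ‖x i - a (cl i)‖ (centerDist (a (cl i)) S) ^ 2) := by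
  classical
  obtain ⟨𝒩, hcard, h𝒩⟩ := exists_centerNet a x cl hL hη hζ h₁ h₂ hN₂
  refine ⟨(Fintype.piFinset fun _ : Fin k => 𝒩).image fun f i => ⨅ l, f l i, ?_, fun S => ?_⟩
  · refine Finset.card_image_le.trans ?_
    rw [Fintype.card_piFinset]
    simpa using Nat.pow_le_pow_left hcard k
  choose f hf hf' using fun l => h𝒩 (S l)
  refine ⟨_, Finset.mem_image_of_mem _ (Fintype.mem_piFinset.2 hf), fun i hi hδ => ?_⟩
  have : Nonempty (Fin k) := ⟨cl i⟩
  set D := ‖x i - a (cl i)‖ with hD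
  set δ := centerDist (a (cl i)) S with hδdef
  have hδ0 : 0 ≤ δ := centerDist_nonneg _ _
  have hDpos : 0 < D := lt_of_le_of_lt (by positivity) hδ
  set ρ := max D δ with hρ
  have hDρ : D ≤ ρ := le_max_left _ _
  have hδρ : δ ≤ ρ := le_max_right _ _
  have hδD : δ ≤ D / ε := by rw [le_div_iff₀ hε]; linarith
  have hDD : D ≤ D / ε := by rw [le_div_iff₀ hε]; nlinarith
  have hcd : centerDist (x i) S ≤ δ + D := centerDist_le_add _ _ _
  have hcost : pointCost (x i) S ≤ (δ + D) ^ 2 := by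
    rw [← centerDist_sq]
    exact pow_le_pow_left₀ (centerDist_nonneg _ _) hcd 2
  have hcost2 : pointCost (x i) S ≤ 4 * ρ ^ 2 := hcost.trans (by nlinarith)
  have hbig : pointCost (x i) S ≤ 4 * D ^ 2 / ε ^ 2 := by
    refine hcost.trans ?_
    have : δ + D ≤ 2 * (D / ε) := by linarith
    calc (δ + D) ^ 2 ≤ (2 * (D / ε)) ^ 2 := by gcongr
      _ = _ := by ring
  have hE : 0 ≤ η * D * ρ + ζ * ρ ^ 2 := by positivity
  rw [abs_le]
  constructor
  -- Lower bound: no center gets a value far below the cost. For centers at distance more than `4 ρ`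
  -- the error grows with the distance, but then so does the true value.
  · rw [neg_le_sub_iff_le_add, ← sub_le_iff_le_add]
    refine le_ciInf fun l => ?_
    rcases hf' l i hi hDpos with h | ⟨-, h⟩
    swap
    · rw [h]; linarith
    have hxs : ‖S l - a (cl i)‖ - D ≤ ‖x i - S l‖ := by
      have := norm_sub_norm_le (S l - a (cl i)) (x i - a (cl i))
      rw [sub_sub_sub_cancel_right, norm_sub_rev (S l) (x i)] at this
      exact this
    have hle := pointCost_le (x i) S l
    rw [abs_le] at h
    set r := ‖S l - a (cl i)‖ with hr
    rcases le_total r (4 * ρ) with hr4 | hr4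
    · have hϱ : max r D ≤ 4 * ρ := max_le hr4 (by linarith)
      have hϱ0 : 0 ≤ max r D := hDpos.le.trans (le_max_right _ _)
      have b1 : η * D * max r D ≤ η * D * (4 * ρ) := by gcongr
      have b2 : ζ * max r D ^ 2 ≤ ζ * (4 * ρ) ^ 2 := by gcongr
      have b3 : 0 ≤ η * D * ρ := by positivity
      have b4 : 0 ≤ ζ * ρ ^ 2 := by positivity
      nlinarith
    · have hϱ : max r D = r := max_eq_left (by linarith)
      rw [hϱ] at h
      have hr0 : 0 ≤ r := norm_nonneg _
      have b0 : (3 / 4 * r) ^ 2 ≤ ‖x i - S l‖ ^ 2 := by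
        refine pow_le_pow_left₀ (by positivity) ?_ 2
        linarith
      have b1 : η * D * r ≤ 1 / 64 * (r / 4) * r := by
        have : D ≤ r / 4 := by linarith
        gcongr
      have b2 : ζ * r ^ 2 ≤ 1 / 64 * r ^ 2 := by gcongr
      have b3 : (4 * ρ) ^ 2 ≤ r ^ 2 := pow_le_pow_left₀ (by positivity) hr4 2
      nlinarith
  -- Upper bound: the nearest center to `x i` is too close to receive the default value.
  · obtain ⟨l, hl⟩ := exists_centerDist_eq (x i) S
    have hr : ‖S l - a (cl i)‖ ≤ δ + 2 * D := by
      have := norm_sub_le (x i - a (cl i)) (x i - S l)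
      rw [sub_sub_sub_cancel_left] at this
      rw [← hl] at this
      linarith
    rcases hf' l i hi hDpos with h | ⟨h, -⟩
    swap
    · exfalso
      have : 3 * D / ε = D / ε + 2 * (D / ε) := by ring
      change 3 * D / ε < _ at h
      linarith
    have hinf : ⨅ l, f l i ≤ f l i := ciInf_le (Set.finite_range _).bddBelow l
    rw [← hl, centerDist_sq, abs_le] at h
    have hϱ : max ‖S l - a (cl i)‖ D ≤ 3 * ρ := max_le (by linarith) (by linarith)
    have hϱ0 : 0 ≤ max ‖S l - a (cl i)‖ D := hDpos.le.trans (le_max_right _ _)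
    have b1 : η * D * max ‖S l - a (cl i)‖ D ≤ η * D * (3 * ρ) := by gcongr
    have b2 : ζ * max ‖S l - a (cl i)‖ D ^ 2 ≤ ζ * (3 * ρ) ^ 2 := by gcongr
    have b3 : 0 ≤ η * D * ρ := by positivity
    have b4 : 0 ≤ ζ * ρ ^ 2 := by positivity
    change -(12 * (η * D * max _ D + ζ * max _ D ^ 2)) ≤ _ ∧ _ ≤
      12 * (η * D * max _ D + ζ * max _ D ^ 2) at h
    nlinarith

end costNet

/-! ### Sizes of the nets -/

section netSize

variable {d k m : ℕ} (a : Fin k → Pt d) (x : Fin m → Pt d) (cl : Fin m → Fin k)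

/-- The logarithmic factor in the sizes of all nets. Every quantity that is polynomial in `m` is
bounded by a power of `exp (logFactor m) = 100 * m`. -/
def logFactor (m : ℕ) : ℝ := Real.log (100 * m)

theorem exp_logFactor (hm : 1 ≤ m) : Real.exp (logFactor m) = 100 * m :=
  Real.exp_log (by have : (1 : ℝ) ≤ m := by exact_mod_cast hm
                   linarith)

theorem one_le_logFactor (hm : 1 ≤ m) : 1 ≤ logFactor m := by
  have h1 : (1 : ℝ) ≤ m := by exact_mod_cast hm
  rw [logFactor, Real.le_log_iff_exp_le (by linarith)]
  linarith [Real.exp_one_lt_d9]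

theorem pow_le_exp_logFactor (hm : 1 ≤ m) {b n : ℕ} {e : ℝ} (hb : (b : ℝ) ≤ 100 * m)
    (hn : (n : ℝ) ≤ e) : ((b : ℝ)) ^ n ≤ Real.exp (e * logFactor m) := by
  calc (b : ℝ) ^ n ≤ (100 * m) ^ n := by gcongr
    _ = Real.exp (n * logFactor m) := by rw [← exp_logFactor hm, Real.exp_nat_mul]
    _ ≤ _ := by
      have := one_le_logFactor hm
      gcongr

theorem one_add_mul_exp_le (hm : 1 ≤ m) {p Λ : ℝ} (hp : 1 ≤ p) (hΛ : 1 ≤ Λ) :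
    1 + m * (8 * m) * m * (66 * m ^ 2) * Real.exp (1024 * p * logFactor m)
      * Real.exp (1025 * p * Λ * logFactor m) ≤ Real.exp (2100 * Λ * p * logFactor m) := by
  have hl := one_le_logFactor hm
  have hm5 : (1 : ℝ) ≤ (m : ℝ) ^ 5 := one_le_pow₀ (by exact_mod_cast hm)
  set E := Real.exp (1024 * p * logFactor m + 1025 * p * Λ * logFactor m) with hE
  have hE1 : 1 ≤ E := Real.one_le_exp (by positivity)
  have e : 1 + m * (8 * m) * m * (66 * m ^ 2) * Real.exp (1024 * p * logFactor m)
      * Real.exp (1025 * p * Λ * logFactor m) = 1 + 528 * (m : ℝ) ^ 5 * E := by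
    rw [hE, Real.exp_add]; ring
  have h5 : (100 * (m : ℝ)) ^ 5 = Real.exp (5 * logFactor m) := by
    rw [← exp_logFactor hm, ← Real.exp_nat_mul]; norm_num
  have h6 : p ≤ Λ * p := le_mul_of_one_le_left (by linarith) hΛ
  rw [e]
  calc 1 + 528 * (m : ℝ) ^ 5 * E ≤ 1 * E + 528 * (m : ℝ) ^ 5 * E := by linarith
    _ = (1 + 528 * (m : ℝ) ^ 5) * E := by ring
    _ ≤ (100 * m) ^ 5 * E := by
        gcongr
        rw [mul_pow]; linarith
    _ = Real.exp ((5 * 1 + 1024 * p + 1025 * (Λ * p)) * logFactor m) := by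
        rw [h5, hE, ← Real.exp_add]; congr 1; ring
    _ ≤ Real.exp ((5 * (Λ * p) + 1024 * (Λ * p) + 1025 * (Λ * p)) * logFactor m) := by
        gcongr; linarith
    _ ≤ _ := by
        apply Real.exp_le_exp.2
        have : 0 ≤ Λ * p * logFactor m := by positivity
        linarith

/-- `exists_costNet` with a greedy net for the points at precision `1 / (32 * 2 ^ h)` and an
arbitrary net, of size `Λ` times larger on the logarithmic scale, for the reference points. -/
theorem exists_costNet_card {J : Finset (Fin k)} {ε ζ Λ : ℝ} {h : ℕ} (hε : 0 < ε) (hε1 : ε ≤ 1)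
    (hm : 1 ≤ m) (hkm : k ≤ m) (hεm : 1 / ε ≤ m) (hh : 1 ≤ h) (hζ : 0 < ζ) (hζ' : ζ ≤ 1 / 64)
    (hζm : 1 / ζ ≤ 64 * (m : ℝ) ^ 2) (hΛ : 1 ≤ Λ)
    (hG₂ : ∀ j₀, ∃ G : Finset (Fin k → ℝ), IsInnerNet J (fun j => a j₀ - a j) ζ G ∧
      (G.card : ℝ) ≤ Real.exp (1025 * 4 ^ h * Λ * logFactor m)) :
    ∃ 𝒱 : Finset (Fin m → ℝ),
      (𝒱.card : ℝ) ≤ Real.exp (2100 * k * Λ * 4 ^ h * logFactor m) ∧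
      ∀ S : Fin k → Pt d, ∃ v ∈ 𝒱, ∀ i, cl i ∈ J →
        ε * centerDist (a (cl i)) S < ‖x i - a (cl i)‖ →
        |v i - pointCost (x i) S| ≤
          200 * (1 / (32 * 2 ^ h) * ‖x i - a (cl i)‖
              * max ‖x i - a (cl i)‖ (centerDist (a (cl i)) S)
            + ζ * max ‖x i - a (cl i)‖ (centerDist (a (cl i)) S) ^ 2) := by
  have hm1 : (1 : ℝ) ≤ m := by exact_mod_cast hm
  have hl := one_le_logFactor hm
  set η : ℝ := 1 / (32 * 2 ^ h) with hη
  have hη0 : 0 < η := by positivity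
  have h2h : (2 : ℝ) ≤ 2 ^ h := by simpa using pow_le_pow_right₀ one_le_two hh
  have hη' : η ≤ 1 / 64 := by
    rw [hη]; apply one_div_le_one_div_of_le <;> linarith
  obtain ⟨G₁, hG₁c, hG₁⟩ := exists_isInnerNet_greedy Finset.univ (fun i => x i - a (cl i)) hη0
  choose G₂ hG₂ hG₂c using hG₂
  set N₂ : ℕ := ⌊Real.exp (1025 * 4 ^ h * Λ * logFactor m)⌋₊ with hN₂
  have hN₂' : ∀ j₀, (G₂ j₀).card ≤ N₂ := fun j₀ => Nat.le_floor (hG₂c j₀)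
  set L := ⌈6 / ε⌉₊ with hL
  have hL1 : 6 / ε ≤ 2 ^ L := by
    refine (Nat.le_ceil _).trans ?_
    exact_mod_cast (Nat.lt_two_pow_self (n := ⌈6 / ε⌉₊)).le
  have hL2 : ((L : ℝ) + 1) ≤ 8 * m := by
    have h6 : 6 / ε = 6 * (1 / ε) := by ring
    have : (L : ℝ) < 6 / ε + 1 := Nat.ceil_lt_add_one (by positivity)
    linarith
  obtain ⟨𝒱, hcard, h𝒱⟩ := exists_costNet a x cl hε hε1 hL1 hη0 hζ hη' hζ' hG₁ hG₂ hN₂'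
  refine ⟨𝒱, ?_, h𝒱⟩
  have hc1 : (G₁.card : ℝ) ≤ Real.exp (1024 * 4 ^ h * logFactor m) := by
    have h1 : (G₁.card : ℝ) ≤ ((2 * m + 1 : ℕ) : ℝ) ^ (1024 * 4 ^ h) := by
      have e : ⌈1 / η ^ 2⌉₊ = 1024 * 4 ^ h := by
        have : 1 / η ^ 2 = ((1024 * 4 ^ h : ℕ) : ℝ) := by
          rw [hη]; push_cast
          rw [one_div_pow, one_div_one_div, mul_pow, ← pow_mul, mul_comm h, pow_mul]; norm_num
        rw [this, Nat.ceil_natCast]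
      rw [e, Fintype.card_fin] at hG₁c
      exact_mod_cast hG₁c
    exact h1.trans (pow_le_exp_logFactor hm (by push_cast; linarith) (by push_cast; rfl))
  have hc2 : (N₂ : ℝ) ≤ Real.exp (1025 * 4 ^ h * Λ * logFactor m) :=
    Nat.floor_le (Real.exp_pos _).le
  have hc3 : ((⌈1 / ζ⌉₊ : ℝ) + 1) ≤ 66 * m ^ 2 := by
    have : (⌈1 / ζ⌉₊ : ℝ) < 1 / ζ + 1 := Nat.ceil_lt_add_one (by positivity)
    nlinarith
  have hk : (k : ℝ) ≤ m := by exact_mod_cast hkm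
  have hbase : ((1 + Fintype.card (Fin m) * (L + 1) * k * (⌈1 / ζ⌉₊ + 1) * G₁.card * N₂ : ℕ) : ℝ)
      ≤ Real.exp (2100 * Λ * 4 ^ h * logFactor m) := by
    rw [Fintype.card_fin]
    push_cast
    refine le_trans ?_ (one_add_mul_exp_le hm (one_le_pow₀ (by norm_num) : (1 : ℝ) ≤ 4 ^ h) hΛ)
    gcongr
  calc (𝒱.card : ℝ) ≤ ((1 + Fintype.card (Fin m) * (L + 1) * k * (⌈1 / ζ⌉₊ + 1) * G₁.card * N₂
        : ℕ) : ℝ) ^ k := by exact_mod_cast hcard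
    _ ≤ Real.exp (2100 * Λ * 4 ^ h * logFactor m) ^ k := by gcongr
    _ = _ := by rw [← Real.exp_nat_mul]; congr 1; ring

/-- A net for the cost vectors with errors relative to `max D δ ^ 2`. -/
theorem exists_coarseNet {ε : ℝ} {h : ℕ} (hε : 0 < ε) (hε1 : ε ≤ 1)
    (hm : 1 ≤ m) (hkm : k ≤ m) (hεm : 1 / ε ≤ m) (hh : 1 ≤ h) (hhm : (2 : ℝ) ^ h ≤ 2 * m) :
    ∃ 𝒱 : Finset (Fin m → ℝ),
      (𝒱.card : ℝ) ≤ Real.exp (2100 * k * 4 ^ h * logFactor m) ∧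
      ∀ S : Fin k → Pt d, ∃ v ∈ 𝒱, ∀ i,
        ε * centerDist (a (cl i)) S < ‖x i - a (cl i)‖ →
        |v i - pointCost (x i) S| ≤
          13 / 2 ^ h * max ‖x i - a (cl i)‖ (centerDist (a (cl i)) S) ^ 2 := by
  have hm1 : (1 : ℝ) ≤ m := by exact_mod_cast hm
  have hk : (k : ℝ) ≤ m := by exact_mod_cast hkm
  have hl := one_le_logFactor hm
  have h2h : (2 : ℝ) ≤ 2 ^ h := by simpa using pow_le_pow_right₀ one_le_two hh
  obtain ⟨𝒱, hcard, h𝒱⟩ := exists_costNet_card a x cl (J := Finset.univ) (ζ := 1 / (32 * 2 ^ h))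
    (Λ := 1) hε hε1 hm hkm hεm hh (by positivity)
    (by apply one_div_le_one_div_of_le <;> linarith) (by rw [one_div_one_div]; nlinarith) le_rfl
    (fun j₀ => by
      obtain ⟨G, hGc, hG⟩ := exists_isInnerNet_greedy Finset.univ (fun j => a j₀ - a j)
        (η := 1 / (32 * 2 ^ h)) (by positivity)
      refine ⟨G, hG, ?_⟩
      have e : ⌈1 / (1 / (32 * 2 ^ h) : ℝ) ^ 2⌉₊ = 1024 * 4 ^ h := by
        have : 1 / (1 / (32 * 2 ^ h) : ℝ) ^ 2 = ((1024 * 4 ^ h : ℕ) : ℝ) := by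
          push_cast
          rw [one_div_pow, one_div_one_div, mul_pow, ← pow_mul, mul_comm h, pow_mul]; norm_num
        rw [this, Nat.ceil_natCast]
      rw [e, Fintype.card_fin] at hGc
      have h1 : (G.card : ℝ) ≤ ((2 * k + 1 : ℕ) : ℝ) ^ (1024 * 4 ^ h) := by exact_mod_cast hGc
      refine h1.trans (pow_le_exp_logFactor hm (by push_cast; linarith) ?_)
      push_cast
      have h4 : (1 : ℝ) ≤ 4 ^ h := one_le_pow₀ (by norm_num)
      linarith)
  refine ⟨𝒱, by simpa using hcard, fun S => ?_⟩
  obtain ⟨v, hv, hv'⟩ := h𝒱 S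
  refine ⟨v, hv, fun i hi => (hv' i (Finset.mem_univ _) hi).trans ?_⟩
  set D := ‖x i - a (cl i)‖
  set ρ := max D (centerDist (a (cl i)) S)
  have hD0 : 0 ≤ D := norm_nonneg _
  have hDρ : D ≤ ρ := le_max_left _ _
  calc 200 * (1 / (32 * 2 ^ h) * D * ρ + 1 / (32 * 2 ^ h) * ρ ^ 2)
      ≤ 200 * (1 / (32 * 2 ^ h) * ρ * ρ + 1 / (32 * 2 ^ h) * ρ ^ 2) := by gcongr
    _ = 12.5 / 2 ^ h * ρ ^ 2 := by field_simp; ring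
    _ ≤ _ := by gcongr; norm_num

/-- A net for the cost vectors on the clusters in `J`, with errors relative to `D * max D δ`. Since
`ε * δ < D`, the precision `ε / (32 * 2 ^ h)` suffices for the reference points. -/
theorem exists_fineNet {J : Finset (Fin k)} {ε κ : ℝ} {h : ℕ} (hε : 0 < ε) (hε1 : ε ≤ 1)
    (hm : 1 ≤ m) (hkm : k ≤ m) (hεm : 1 / ε ≤ m) (hh : 1 ≤ h) (hhm : (2 : ℝ) ^ h ≤ 2 * m)
    (hκ : 1 ≤ κ) (hJ : κ = 1 / ε ^ 2 ∨ (J.card : ℝ) ≤ κ) :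
    ∃ 𝒱 : Finset (Fin m → ℝ),
      (𝒱.card : ℝ) ≤ Real.exp (2100 * k * κ * 4 ^ h * logFactor m) ∧
      ∀ S : Fin k → Pt d, ∃ v ∈ 𝒱, ∀ i, cl i ∈ J →
        ε * centerDist (a (cl i)) S < ‖x i - a (cl i)‖ →
        |v i - pointCost (x i) S| ≤ 13 / 2 ^ h *
          (‖x i - a (cl i)‖ * max ‖x i - a (cl i)‖ (centerDist (a (cl i)) S)) := by
  have hm1 : (1 : ℝ) ≤ m := by exact_mod_cast hm
  have hk : (k : ℝ) ≤ m := by exact_mod_cast hkm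
  have hl := one_le_logFactor hm
  have h2h : (2 : ℝ) ≤ 2 ^ h := by simpa using pow_le_pow_right₀ one_le_two hh
  have h4 : (1 : ℝ) ≤ 4 ^ h := one_le_pow₀ (by norm_num)
  set ζ : ℝ := 1 / (32 * 2 ^ h) * ε with hζ
  have hζ0 : 0 < ζ := by positivity
  have hζi : 1 / ζ ≤ 64 * (m : ℝ) ^ 2 := by
    have : 1 / ζ = 32 * 2 ^ h * (1 / ε) := by rw [hζ]; field_simp
    rw [this]
    calc 32 * 2 ^ h * (1 / ε) ≤ 32 * (2 * m) * (m : ℝ) := by gcongr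
      _ = _ := by ring
  obtain ⟨𝒱, hcard, h𝒱⟩ := exists_costNet_card a x cl (J := J) (ζ := ζ)
    (Λ := κ) hε hε1 hm hkm hεm hh hζ0
    (by
      have : (1 : ℝ) / (32 * 2 ^ h) ≤ 1 / 64 := by apply one_div_le_one_div_of_le <;> linarith
      have h0 : (0 : ℝ) ≤ 1 / (32 * 2 ^ h) := by positivity
      rw [hζ]; nlinarith) hζi hκ
    (fun j₀ => by
      rcases hJ with hJ | hJ
      · obtain ⟨G, hGc, hG⟩ := exists_isInnerNet_greedy J (fun j => a j₀ - a j) hζ0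
        refine ⟨G, hG, ?_⟩
        rw [Fintype.card_fin] at hGc
        have h1 : (G.card : ℝ) ≤ ((2 * k + 1 : ℕ) : ℝ) ^ ⌈1 / ζ ^ 2⌉₊ := by exact_mod_cast hGc
        refine h1.trans (pow_le_exp_logFactor hm (by push_cast; linarith) ?_)
        have e : 1 / ζ ^ 2 = 1024 * 4 ^ h * κ := by
          rw [hζ, hJ, mul_pow, one_div_pow, mul_pow, ← pow_mul, mul_comm h, pow_mul]
          field_simp; norm_num
        have h2 : (⌈1 / ζ ^ 2⌉₊ : ℝ) < 1 / ζ ^ 2 + 1 := Nat.ceil_lt_add_one (by positivity)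
        nlinarith
      -- With few clusters, rounding costs only a logarithm per cluster, whatever the precision.
      · obtain ⟨G, hGc, hG⟩ := exists_isInnerNet_grid J (fun j => a j₀ - a j) hζ0
        refine ⟨G, hG, ?_⟩
        have h2 : (⌈1 / ζ⌉₊ : ℝ) < 1 / ζ + 1 := Nat.ceil_lt_add_one (by positivity)
        have h3 : ((2 * ⌈1 / ζ⌉₊ + 1 : ℕ) : ℝ) ≤ (100 * m) ^ 2 := by
          push_cast; nlinarith
        calc (G.card : ℝ) ≤ ((2 * ⌈1 / ζ⌉₊ + 1 : ℕ) : ℝ) ^ J.card := by exact_mod_cast hGc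
          _ ≤ ((100 * m) ^ 2) ^ J.card := by gcongr
          _ = Real.exp (J.card * (2 * logFactor m)) := by
              rw [← exp_logFactor hm, Real.exp_nat_mul, ← Real.exp_nat_mul]; norm_num
          _ ≤ _ := by
              apply Real.exp_le_exp.2
              calc (J.card : ℝ) * (2 * logFactor m) ≤ κ * (2 * logFactor m) := by gcongr
                _ = 2 * 1 * κ * logFactor m := by ring
                _ ≤ 1025 * 4 ^ h * κ * logFactor m := by gcongr; norm_num)
  refine ⟨𝒱, hcard, fun S => ?_⟩
  obtain ⟨v, hv, hv'⟩ := h𝒱 S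
  refine ⟨v, hv, fun i hi hδ => (hv' i hi hδ).trans ?_⟩
  set D := ‖x i - a (cl i)‖
  set δ := centerDist (a (cl i)) S
  set ρ := max D δ with hρ
  have hD0 : 0 ≤ D := norm_nonneg _
  have hρ0 : 0 ≤ ρ := hD0.trans (le_max_left _ _)
  have hDρ : ε * ρ ≤ D := by
    rcases max_choice D δ with h | h <;> rw [hρ, h]
    · nlinarith
    · exact hδ.le
  calc 200 * (1 / (32 * 2 ^ h) * D * ρ + ζ * ρ ^ 2)
      = 200 * (1 / (32 * 2 ^ h) * D * ρ + 1 / (32 * 2 ^ h) * (ε * ρ) * ρ) := by rw [hζ]; ring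
    _ ≤ 200 * (1 / (32 * 2 ^ h) * D * ρ + 1 / (32 * 2 ^ h) * D * ρ) := by gcongr
    _ = 12.5 / 2 ^ h * (D * ρ) := by field_simp; ring
    _ ≤ _ := by gcongr; norm_num

end netSize

/-! ### Masks -/

section masks

variable {k m : ℕ}

open Classical in
/-- The sets of indices that are upward closed with respect to `D`: the empty set and the sets
`{i | D l ≤ D i}`. -/
def upSets (D : Fin m → ℝ) : Finset (Finset (Fin m)) :=
  insert ∅ (Finset.univ.image fun l => Finset.univ.filter fun i => D l ≤ D i)

open Classical in
/-- The sets of indices on which `D` takes its values in some interval, as differences of upward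
closed sets. -/
def intervals (D : Fin m → ℝ) : Finset (Finset (Fin m)) :=
  (upSets D ×ˢ upSets D).image fun p => p.1 \ p.2

open Classical in
/-- The sets of indices whose intersection with each cluster is cut out by an interval for `D`. -/
def masks (cl : Fin m → Fin k) (D : Fin m → ℝ) : Finset (Finset (Fin m)) :=
  (Fintype.piFinset fun _ : Fin k => intervals D).image
    fun I => Finset.univ.filter fun i => i ∈ I (cl i)

theorem card_intervals_le (D : Fin m → ℝ) : (intervals D).card ≤ (m + 1) ^ 2 := by
  classical
  have h : (upSets D).card ≤ m + 1 := by
    refine (Finset.card_insert_le _ _).trans (Nat.add_le_add_right ?_ 1)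
    exact Finset.card_image_le.trans (by simp)
  refine Finset.card_image_le.trans ?_
  rw [Finset.card_product, sq]
  exact Nat.mul_le_mul h h

theorem card_masks_le (cl : Fin m → Fin k) (D : Fin m → ℝ) :
    (masks cl D).card ≤ ((m + 1) ^ 2) ^ k := by
  classical
  refine Finset.card_image_le.trans ?_
  rw [Fintype.card_piFinset]
  simpa using Nat.pow_le_pow_left (card_intervals_le D) k

theorem filter_mem_upSets (D : Fin m → ℝ) {P : Fin m → Prop} [DecidablePred P]
    (hP : ∀ i l, P i → D i ≤ D l → P l) : Finset.univ.filter P ∈ upSets D := by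
  classical
  rcases (Finset.univ.filter P).eq_empty_or_nonempty with h | h
  · rw [h]; exact Finset.mem_insert_self _ _
  · obtain ⟨l, hl, hmin⟩ := Finset.exists_min_image _ D h
    refine Finset.mem_insert_of_mem (Finset.mem_image.2 ⟨l, Finset.mem_univ _, ?_⟩)
    ext i
    simp only [Finset.mem_filter, Finset.mem_univ, true_and] at hl hmin ⊢
    exact ⟨fun hi => hP l i hl hi, fun hi => hmin i hi⟩

theorem mem_intervals (D : Fin m → ℝ) (P Q : Fin m → Prop)
    (hP : ∀ i l, P i → D i ≤ D l → P l) (hQ : ∀ i l, Q i → D i ≤ D l → Q l)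
    {A : Finset (Fin m)} (hA : ∀ i, i ∈ A ↔ P i ∧ ¬ Q i) : A ∈ intervals D := by
  classical
  refine Finset.mem_image.2 ⟨(Finset.univ.filter P, Finset.univ.filter Q), ?_, ?_⟩
  · exact Finset.mem_product.2 ⟨filter_mem_upSets D hP, filter_mem_upSets D hQ⟩
  · ext i; simp [hA]

theorem mem_masks (cl : Fin m → Fin k) (D : Fin m → ℝ) {I : Fin k → Finset (Fin m)}
    (hI : ∀ j, I j ∈ intervals D) {A : Finset (Fin m)} (hA : ∀ i, i ∈ A ↔ i ∈ I (cl i)) :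
    A ∈ masks cl D := by
  classical
  refine Finset.mem_image.2 ⟨I, Fintype.mem_piFinset.2 hI, ?_⟩
  ext i; simp [hA]

end masks

/-! ### Chaining -/

section chaining

variable {m : ℕ}

/-- The vector `w y`, restricted to the set `A` of indices. -/
def restr (w : Fin m → ℝ) (A : Finset (Fin m)) (y : Fin m → ℝ) : Fin m → ℝ :=
  fun i => if i ∈ A then w i * y i else 0

theorem sum_sgn_restr (w : Fin m → ℝ) (A : Finset (Fin m)) (y : Fin m → ℝ) (σ : Fin m → Bool) :
    ∑ i, sgn (σ i) * restr w A y i = ∑ i ∈ A, sgn (σ i) * (w i * y i) := by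
  simp [restr]

theorem sum_restr_sq (w : Fin m → ℝ) (A : Finset (Fin m)) (y : Fin m → ℝ) :
    ∑ i, restr w A y i ^ 2 = ∑ i ∈ A, (w i * y i) ^ 2 := by
  simp [restr, ite_pow]

theorem abs_sgn (b : Bool) : |sgn b| = 1 := by cases b <;> simp [sgn]

theorem abs_sum_sgn_le (A : Finset (Fin m)) (y e : Fin m → ℝ) (σ : Fin m → Bool)
    (h : ∀ i ∈ A, |y i| ≤ e i) : |∑ i ∈ A, sgn (σ i) * y i| ≤ ∑ i ∈ A, e i := by
  refine (Finset.abs_sum_le_sum_abs _ _).trans (Finset.sum_le_sum fun i hi => ?_)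
  rw [abs_mul, abs_sgn, one_mul]
  exact h i hi

/-- The chaining bound: `v 0, …, v H` approximate `f` on `A` with errors that halve in each step, and
the signed sums of the increments behave as Hoeffding's inequality predicts, with a deviation
parameter that doubles in each step. Then every step contributes equally. -/
theorem abs_sum_sgn_sub_le {w f e : Fin m → ℝ} {A : Finset (Fin m)} {v : ℕ → Fin m → ℝ} {H : ℕ}
    {T : ℝ} {σ : Fin m → Bool} (hw : ∀ i, 0 ≤ w i) (hT : 0 ≤ T)
    (hv : ∀ h ≤ H, ∀ i ∈ A, |v h i - f i| ≤ 13 / 2 ^ h * e i)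
    (hσ : ∀ h < H, |∑ i, sgn (σ i) * restr w A (v (h + 1) - v h) i|
      ≤ T * 2 ^ h * √(∑ i, restr w A (v (h + 1) - v h) i ^ 2)) :
    |∑ i ∈ A, sgn (σ i) * (w i * f i)| ≤ |∑ i ∈ A, sgn (σ i) * (w i * v 0 i)|
      + H * (20 * T * √(∑ i ∈ A, (w i * e i) ^ 2)) + 13 / 2 ^ H * ∑ i ∈ A, w i * e i := by
  set N := √(∑ i ∈ A, (w i * e i) ^ 2) with hN
  have step : ∀ h < H, |∑ i ∈ A, sgn (σ i) * (w i * (v (h + 1) i - v h i))| ≤ 20 * T * N := by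
    intro h hh
    have h1 := hσ h hh
    rw [sum_sgn_restr, sum_restr_sq] at h1
    refine h1.trans ?_
    have h2 : ∑ i ∈ A, (w i * (v (h + 1) - v h) i) ^ 2
        ≤ (20 / 2 ^ h) ^ 2 * ∑ i ∈ A, (w i * e i) ^ 2 := by
      rw [Finset.mul_sum]
      refine Finset.sum_le_sum fun i hi => ?_
      rw [← mul_pow, ← sq_abs]
      refine pow_le_pow_left₀ (abs_nonneg _) ?_ 2
      have a1 := hv h hh.le i hi
      have a2 := hv (h + 1) hh i hi
      have a3 : |v (h + 1) i - v h i| ≤ 20 / 2 ^ h * e i := by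
        have e1 := abs_sub (v (h + 1) i - f i) (v h i - f i)
        rw [sub_sub_sub_cancel_right] at e1
        have e0 : 0 ≤ 13 / 2 ^ h * e i := (abs_nonneg _).trans a1
        have e2 : (13 : ℝ) / 2 ^ (h + 1) * e i = 13 / 2 ^ h * e i / 2 := by
          rw [pow_succ]; field_simp
        have e3 : (20 : ℝ) / 2 ^ h * e i = 20 / 13 * (13 / 2 ^ h * e i) := by field_simp
        rw [e3]; linarith
      rw [abs_mul, abs_of_nonneg (hw i)]
      calc w i * |(v (h + 1) - v h) i| ≤ w i * (20 / 2 ^ h * e i) :=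
            mul_le_mul_of_nonneg_left a3 (hw i)
        _ = _ := by ring
    calc T * 2 ^ h * √(∑ i ∈ A, (w i * (v (h + 1) - v h) i) ^ 2)
        ≤ T * 2 ^ h * √((20 / 2 ^ h) ^ 2 * ∑ i ∈ A, (w i * e i) ^ 2) := by gcongr
      _ = T * 2 ^ h * (20 / 2 ^ h * N) := by
          rw [Real.sqrt_mul (by positivity), Real.sqrt_sq (by positivity)]
      _ = _ := by field_simp
  have tele : ∑ i ∈ A, sgn (σ i) * (w i * f i) = ∑ i ∈ A, sgn (σ i) * (w i * v 0 i)
      + ∑ h ∈ Finset.range H, ∑ i ∈ A, sgn (σ i) * (w i * (v (h + 1) i - v h i))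
      + ∑ i ∈ A, sgn (σ i) * (w i * (f i - v H i)) := by
    rw [Finset.sum_comm, ← Finset.sum_add_distrib, ← Finset.sum_add_distrib]
    refine Finset.sum_congr rfl fun i _ => ?_
    rw [← Finset.mul_sum, ← Finset.mul_sum, Finset.sum_range_sub (fun h => v h i)]
    ring
  have last : |∑ i ∈ A, sgn (σ i) * (w i * (f i - v H i))| ≤ 13 / 2 ^ H * ∑ i ∈ A, w i * e i := by
    rw [Finset.mul_sum]
    refine abs_sum_sgn_le A _ _ σ fun i hi => ?_
    have := hv H le_rfl i hi
    rw [abs_mul, abs_of_nonneg (hw i), abs_sub_comm]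
    calc w i * |v H i - f i| ≤ w i * (13 / 2 ^ H * e i) := mul_le_mul_of_nonneg_left this (hw i)
      _ = _ := by ring
  have mid : |∑ h ∈ Finset.range H, ∑ i ∈ A, sgn (σ i) * (w i * (v (h + 1) i - v h i))|
      ≤ H * (20 * T * N) := by
    refine (Finset.abs_sum_le_sum_abs _ _).trans ?_
    refine (Finset.sum_le_card_nsmul _ _ _ fun h hh => step h (Finset.mem_range.1 hh)).trans_eq ?_
    simp
  rw [tele]
  refine (abs_add_le _ _).trans (add_le_add ((abs_add_le _ _).trans (add_le_add le_rfl mid)) last)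

open Classical in
/-- The restricted increments between two families of vectors. -/
def increments (w : Fin m → ℝ) (𝓜 : Finset (Finset (Fin m))) (𝒱 𝒱' : Finset (Fin m → ℝ)) :
    Finset (Fin m → ℝ) :=
  (𝓜 ×ˢ 𝒱 ×ˢ 𝒱').image fun p => restr w p.1 (p.2.2 - p.2.1)

theorem card_increments_le (w : Fin m → ℝ) (𝓜 : Finset (Finset (Fin m)))
    (𝒱 𝒱' : Finset (Fin m → ℝ)) :
    ((increments w 𝓜 𝒱 𝒱').card : ℝ) ≤ 𝓜.card * (𝒱.card * 𝒱'.card) := by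
  classical
  have : (increments w 𝓜 𝒱 𝒱').card ≤ 𝓜.card * (𝒱.card * 𝒱'.card) := by
    refine Finset.card_image_le.trans ?_
    rw [Finset.card_product, Finset.card_product]
  exact_mod_cast this

theorem restr_mem_increments {w : Fin m → ℝ} {𝓜 : Finset (Finset (Fin m))}
    {𝒱 𝒱' : Finset (Fin m → ℝ)} {A : Finset (Fin m)} {v v' : Fin m → ℝ} (hA : A ∈ 𝓜) (hv : v ∈ 𝒱)
    (hv' : v' ∈ 𝒱') : restr w A (v' - v) ∈ increments w 𝓜 𝒱 𝒱' := by
  classical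
  exact Finset.mem_image.2 ⟨(A, v, v'), by simp [hA, hv, hv'], rfl⟩

/-- The random signs rarely violate the deviation bound somewhere along the chain of families `F`:
the deviation parameter `T * 2 ^ h` at level `h` makes up for the family size `exp (Λ * 4 ^ h * _)`. -/
theorem pr_exists_level_le {H : ℕ} (F : ℕ → Finset (Fin m → ℝ)) {Λ T : ℝ} (hm : 1 ≤ m)
    (hHm : H ≤ m) (hT0 : 0 ≤ T) (hT : T ^ 2 = 2 * (Λ + 3) * logFactor m)
    (hF : ∀ h < H, ((F h).card : ℝ) ≤ Real.exp (Λ * 4 ^ h * logFactor m)) :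
    pr signWt (fun σ : Fin m → Bool => ∃ h ∈ Finset.range H, ∃ y ∈ F h,
      T * 2 ^ h * √(∑ i, y i ^ 2) < |∑ i, sgn (σ i) * y i|) ≤ 1 / 100 := by
  have hl := one_le_logFactor hm
  have hm1 : (1 : ℝ) ≤ m := by exact_mod_cast hm
  have hHm' : (H : ℝ) ≤ m := by exact_mod_cast hHm
  refine (pr_exists_le signWt_nonneg _ _).trans ?_
  have key : ∀ h ∈ Finset.range H, pr signWt (fun σ : Fin m → Bool => ∃ y ∈ F h,
      T * 2 ^ h * √(∑ i, y i ^ 2) < |∑ i, sgn (σ i) * y i|) ≤ 2 * ((100 * (m : ℝ)) ^ 3)⁻¹ := by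
    intro h hh
    refine (pr_exists_sign_gt_le (F h) (by positivity)).trans ?_
    have h1 := hF h (Finset.mem_range.1 hh)
    have h4 : (1 : ℝ) ≤ 4 ^ h := one_le_pow₀ (by norm_num)
    have e1 : (T * 2 ^ h) ^ 2 / 2 = (Λ + 3) * 4 ^ h * logFactor m := by
      rw [mul_pow, hT, ← pow_mul, mul_comm h, pow_mul]; norm_num; ring
    have e2 : ((100 * (m : ℝ)) ^ 3)⁻¹ = Real.exp (-(3 * logFactor m)) := by
      rw [Real.exp_neg, ← exp_logFactor hm, ← Real.exp_nat_mul]; norm_num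
    rw [e1, e2]
    calc 2 * ((F h).card : ℝ) * Real.exp (-((Λ + 3) * 4 ^ h * logFactor m))
        ≤ 2 * Real.exp (Λ * 4 ^ h * logFactor m)
          * Real.exp (-((Λ + 3) * 4 ^ h * logFactor m)) := by gcongr
      _ = 2 * Real.exp (-(3 * 4 ^ h * logFactor m)) := by
          rw [mul_assoc, ← Real.exp_add]; congr 2; ring
      _ ≤ _ := by
          gcongr
          linarith
  refine (Finset.sum_le_card_nsmul _ _ _ key).trans ?_
  rw [Finset.card_range, nsmul_eq_mul]
  have h3 : (100 * (m : ℝ)) * 100 ≤ (100 * m) ^ 3 := by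
    have : (1 : ℝ) ≤ (100 * m) ^ 2 / 10000 := by
      rw [mul_pow]; nlinarith
    nlinarith
  have h4 : ((100 * (m : ℝ)) ^ 3)⁻¹ ≤ (100 * (m : ℝ) * 100)⁻¹ := inv_anti₀ (by positivity) h3
  calc (H : ℝ) * (2 * ((100 * (m : ℝ)) ^ 3)⁻¹) ≤ m * (2 * (100 * (m : ℝ) * 100)⁻¹) := by gcongr
    _ = 2 / 10000 := by field_simp; norm_num
    _ ≤ _ := by norm_num

end chaining

/-! ### Signed sums over a weighted sample -/

/-- What is used about the sample: points `x i` in clusters `cl i` with reference points `a j`,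
with weights `w i` that are bounded in terms of the cluster sizes `n j` and of the total cost `Φ`
of the reference points. -/
structure WeightedSample {d k m : ℕ} (a : Fin k → Pt d) (x : Fin m → Pt d) (cl : Fin m → Fin k)
    (w : Fin m → ℝ) (n : Fin k → ℝ) (Φ : ℝ) : Prop where
  w_nonneg : ∀ i, 0 ≤ w i
  n_nonneg : ∀ j, 0 ≤ n j
  cost_nonneg : 0 ≤ Φ
  w_le : ∀ i, m * w i ≤ 4 * k * n (cl i)
  w_mul_sq_le : ∀ i, m * (w i * ‖x i - a (cl i)‖ ^ 2) ≤ 4 * Φ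
  sum_w_le : ∀ j, ∑ i with cl i = j, w i ≤ 4 * n j

section sample

variable {d k m : ℕ} {a : Fin k → Pt d} {x : Fin m → Pt d} {cl : Fin m → Fin k}
  {w : Fin m → ℝ} {n : Fin k → ℝ} {Φ : ℝ}

/-- The normalization `Φ + ∑ n_j d(a_j, S)²`, comparable to the cost of `S`. -/
def scaleCost (a : Fin k → Pt d) (n : Fin k → ℝ) (Φ : ℝ) (S : Fin k → Pt d) : ℝ :=
  Φ + ∑ j, n j * centerDist (a j) S ^ 2

namespace WeightedSample

variable (hs : WeightedSample a x cl w n Φ)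
include hs

theorem sum_w_mul_sq_le (hm : 1 ≤ m) : ∑ i, w i * ‖x i - a (cl i)‖ ^ 2 ≤ 4 * Φ := by
  have hm1 : (0 : ℝ) < m := by exact_mod_cast hm
  have h1 : ∀ i, w i * ‖x i - a (cl i)‖ ^ 2 ≤ 4 * Φ / m := fun i => by
    rw [le_div_iff₀ hm1, mul_comm]; exact hs.w_mul_sq_le i
  calc _ ≤ ∑ _i : Fin m, 4 * Φ / m := Finset.sum_le_sum fun i _ => h1 i
    _ = 4 * Φ := by simp; field_simp

/-- Weighted sums over the sample of a function of the cluster are controlled by the cluster sizes. -/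
theorem sum_w_mul_le {c : Fin k → ℝ} (hc : ∀ j, 0 ≤ c j) :
    ∑ i, w i * c (cl i) ≤ 4 * ∑ j, n j * c j := by
  rw [← Finset.sum_fiberwise Finset.univ cl, Finset.mul_sum]
  refine Finset.sum_le_sum fun j _ => ?_
  calc ∑ i with cl i = j, w i * c (cl i) = (∑ i with cl i = j, w i) * c j := by
        rw [Finset.sum_mul]
        exact Finset.sum_congr rfl fun i hi => by rw [(Finset.mem_filter.1 hi).2]
    _ ≤ 4 * n j * c j := mul_le_mul_of_nonneg_right (hs.sum_w_le j) (hc j)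
    _ = _ := by ring

theorem cost_le_scaleCost (S : Fin k → Pt d) : Φ ≤ scaleCost a n Φ S :=
  le_add_of_nonneg_right (Finset.sum_nonneg fun j _ => mul_nonneg (hs.n_nonneg j) (sq_nonneg _))

theorem sum_le_scaleCost (S : Fin k → Pt d) :
    ∑ j, n j * centerDist (a j) S ^ 2 ≤ scaleCost a n Φ S :=
  le_add_of_nonneg_left hs.cost_nonneg

theorem scaleCost_nonneg (S : Fin k → Pt d) : 0 ≤ scaleCost a n Φ S :=
  hs.cost_nonneg.trans (hs.cost_le_scaleCost S)

theorem sum_w_mul_centerDist_le (S : Fin k → Pt d) :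
    ∑ i, w i * centerDist (a (cl i)) S ^ 2 ≤ 4 * scaleCost a n Φ S :=
  (hs.sum_w_mul_le fun j => sq_nonneg (centerDist (a j) S)).trans
    (by have := hs.sum_le_scaleCost S; gcongr)

theorem sum_w_mul_max_le (hm : 1 ≤ m) (S : Fin k → Pt d) (A : Finset (Fin m)) :
    ∑ i ∈ A, w i * max ‖x i - a (cl i)‖ (centerDist (a (cl i)) S) ^ 2
      ≤ 4 * scaleCost a n Φ S := by
  calc _ ≤ ∑ i ∈ A, w i * (‖x i - a (cl i)‖ ^ 2 + centerDist (a (cl i)) S ^ 2) := by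
        refine Finset.sum_le_sum fun i _ => mul_le_mul_of_nonneg_left ?_ (hs.w_nonneg i)
        rcases max_choice ‖x i - a (cl i)‖ (centerDist (a (cl i)) S) with h | h <;> rw [h]
        · linarith [sq_nonneg (centerDist (a (cl i)) S)]
        · linarith [sq_nonneg ‖x i - a (cl i)‖]
    _ ≤ ∑ i, w i * (‖x i - a (cl i)‖ ^ 2 + centerDist (a (cl i)) S ^ 2) :=
        Finset.sum_le_univ_sum_of_nonneg fun i => mul_nonneg (hs.w_nonneg i) (by positivity)
    _ ≤ 4 * Φ + 4 * ∑ j, n j * centerDist (a j) S ^ 2 := by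
        simp only [mul_add, Finset.sum_add_distrib]
        exact add_le_add (hs.sum_w_mul_sq_le hm)
          (hs.sum_w_mul_le fun j => sq_nonneg (centerDist (a j) S))
    _ = _ := by rw [scaleCost]; ring

/-- Squared envelope of the coarse chain. For a point far from its reference point the bound on
`w i * D i ^ 2` applies, and for a point of a light cluster the bound on `w i` does. -/
theorem sum_coarse_envelope_le (hm : 1 ≤ m) {κ : ℝ} (hκ : 1 ≤ κ) (S : Fin k → Pt d)
    (A : Finset (Fin m))
    (hA : ∀ i ∈ A, centerDist (a (cl i)) S ≤ ‖x i - a (cl i)‖ ∨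
      k * (n (cl i) * centerDist (a (cl i)) S ^ 2) ≤ κ * scaleCost a n Φ S) :
    ∑ i ∈ A, (w i * max ‖x i - a (cl i)‖ (centerDist (a (cl i)) S) ^ 2) ^ 2
      ≤ 16 * κ * scaleCost a n Φ S ^ 2 / m := by
  have hm1 : (0 : ℝ) < m := by exact_mod_cast hm
  have hM := hs.scaleCost_nonneg S
  have hΦ := hs.cost_le_scaleCost S
  set M := scaleCost a n Φ S with hMdef
  have hi : ∀ i ∈ A, (w i * max ‖x i - a (cl i)‖ (centerDist (a (cl i)) S) ^ 2) ^ 2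
      ≤ 4 * κ * M / m * (w i * max ‖x i - a (cl i)‖ (centerDist (a (cl i)) S) ^ 2) := by
    intro i hi
    set D := ‖x i - a (cl i)‖
    set δ := centerDist (a (cl i)) S
    have hw := hs.w_nonneg i
    rw [sq (w i * _)]
    refine mul_le_mul_of_nonneg_right ?_ (by positivity)
    rw [le_div_iff₀ hm1]
    have hD : w i * D ^ 2 * m ≤ 4 * κ * M := by
      have := hs.w_mul_sq_le i
      have h2 : 4 * Φ ≤ 4 * (κ * M) := by nlinarith
      calc w i * D ^ 2 * m = m * (w i * D ^ 2) := by ring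
        _ ≤ 4 * Φ := this
        _ ≤ _ := by linarith
    rcases max_choice D δ with h | h
    · rw [h]; exact hD
    · rw [h]
      rcases hA i hi with h1 | h1
      · refine le_trans ?_ hD
        have : δ ^ 2 ≤ D ^ 2 := pow_le_pow_left₀ (centerDist_nonneg _ _) h1 2
        gcongr
      · have := mul_le_mul_of_nonneg_right (hs.w_le i) (sq_nonneg δ)
        nlinarith
  refine (Finset.sum_le_sum hi).trans ?_
  rw [← Finset.mul_sum]
  calc _ ≤ 4 * κ * M / m * (4 * M) := by
        have := hs.sum_w_mul_max_le hm S A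
        gcongr
    _ = _ := by ring

/-- Squared envelope of the fine chain: one factor `w i * D i ^ 2` is always `O(1 / m)`, and the other
factor `w i * δ ^ 2` is summable. No bound on the size of single weights is needed. -/
theorem sum_fine_envelope_le (hm : 1 ≤ m) (S : Fin k → Pt d) (A : Finset (Fin m)) :
    ∑ i ∈ A, (w i * (‖x i - a (cl i)‖ * centerDist (a (cl i)) S)) ^ 2
      ≤ 16 * scaleCost a n Φ S ^ 2 / m := by
  have hm1 : (0 : ℝ) < m := by exact_mod_cast hm
  have hM := hs.scaleCost_nonneg S
  have hΦ := hs.cost_le_scaleCost S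
  set M := scaleCost a n Φ S with hMdef
  have hi : ∀ i, (w i * (‖x i - a (cl i)‖ * centerDist (a (cl i)) S)) ^ 2
      ≤ 4 * M / m * (w i * centerDist (a (cl i)) S ^ 2) := by
    intro i
    set D := ‖x i - a (cl i)‖
    set δ := centerDist (a (cl i)) S
    have hw := hs.w_nonneg i
    have h1 : w i * D ^ 2 ≤ 4 * M / m := by
      rw [le_div_iff₀ hm1]
      have := hs.w_mul_sq_le i
      calc w i * D ^ 2 * m = m * (w i * D ^ 2) := by ring
        _ ≤ 4 * Φ := this
        _ ≤ _ := by linarith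
    calc (w i * (D * δ)) ^ 2 = w i * D ^ 2 * (w i * δ ^ 2) := by ring
      _ ≤ _ := by gcongr
  calc _ ≤ ∑ i, (w i * (‖x i - a (cl i)‖ * centerDist (a (cl i)) S)) ^ 2 :=
        Finset.sum_le_univ_sum_of_nonneg fun i => sq_nonneg _
    _ ≤ ∑ i, 4 * M / m * (w i * centerDist (a (cl i)) S ^ 2) := Finset.sum_le_sum fun i _ => hi i
    _ ≤ 4 * M / m * (4 * M) := by
        rw [← Finset.mul_sum]
        have := hs.sum_w_mul_centerDist_le S
        gcongr
    _ = _ := by ring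

end WeightedSample

open Classical in
/-- Weighted indicator vectors of the pieces of clusters that are cut out by intervals. -/
def clusterVectors (w : Fin m → ℝ) (cl : Fin m → Fin k) (D : Fin m → ℝ) : Finset (Fin m → ℝ) :=
  ((Finset.univ : Finset (Fin k)) ×ˢ intervals D).image fun p =>
     restr w (p.2.filter fun i => cl i = p.1) 1

theorem pr_clusterVectors_le (w : Fin m → ℝ) (cl : Fin m → Fin k) (D : Fin m → ℝ) (hm : 1 ≤ m)
    (hkm : k ≤ m) :
    pr signWt (fun σ : Fin m → Bool => ∃ y ∈ clusterVectors w cl D,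
      √(10 * logFactor m) * √(∑ i, y i ^ 2) < |∑ i, sgn (σ i) * y i|) ≤ 1 / 100 := by
  classical
  have hl := one_le_logFactor hm
  have hm1 : (1 : ℝ) ≤ m := by exact_mod_cast hm
  have hk : (k : ℝ) ≤ m := by exact_mod_cast hkm
  refine (pr_exists_sign_gt_le _ (Real.sqrt_nonneg _)).trans ?_
  have h1 : (clusterVectors w cl D).card ≤ k * (m + 1) ^ 2 := by
    refine Finset.card_image_le.trans ?_
    rw [Finset.card_product, Finset.card_univ, Fintype.card_fin]
    exact Nat.mul_le_mul le_rfl (card_intervals_le D)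
  have h2 : ((clusterVectors w cl D).card : ℝ) ≤ (100 * m) ^ 3 := by
    calc ((clusterVectors w cl D).card : ℝ) ≤ k * (m + 1) ^ 2 := by exact_mod_cast h1
      _ ≤ m * (2 * m) ^ 2 := by gcongr; linarith
      _ = 4 * (m : ℝ) ^ 3 := by ring
      _ ≤ _ := by
        rw [mul_pow]
        have : (0 : ℝ) ≤ (m : ℝ) ^ 3 := by positivity
        linarith
  have h3 : Real.exp (-(√(10 * logFactor m) ^ 2 / 2)) = ((100 * (m : ℝ)) ^ 5)⁻¹ := by
    rw [Real.sq_sqrt (by positivity), ← exp_logFactor hm, ← Real.exp_nat_mul, ← Real.exp_neg]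
    congr 1; push_cast; ring
  rw [h3]
  calc 2 * ((clusterVectors w cl D).card : ℝ) * ((100 * (m : ℝ)) ^ 5)⁻¹
      ≤ 2 * (100 * m) ^ 3 * ((100 * (m : ℝ)) ^ 5)⁻¹ := by gcongr
    _ = 2 / (100 * m) ^ 2 := by field_simp
    _ ≤ 2 / (100 * 1) ^ 2 := by gcongr
    _ ≤ _ := by norm_num

/-- A vector that is constant on clusters contributes little to the signed sums, even after
restriction to an interval of values of `D` in each cluster. -/
theorem WeightedSample.abs_sum_sgn_cluster_le (hs : WeightedSample a x cl w n Φ) (hm : 1 ≤ m)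
    {ε : ℝ} (hε : 0 < ε) (hmε : 160 * logFactor m * k / ε ^ 2 ≤ m) {D : Fin m → ℝ}
    {σ : Fin m → Bool}
    (hσ : ∀ y ∈ clusterVectors w cl D,
      |∑ i, sgn (σ i) * y i| ≤ √(10 * logFactor m) * √(∑ i, y i ^ 2))
    {I : Fin k → Finset (Fin m)} (hI : ∀ j, I j ∈ intervals D) (c : Fin k → ℝ) (hc : ∀ j, 0 ≤ c j)
    {A : Finset (Fin m)} (hA : ∀ i, i ∈ A ↔ i ∈ I (cl i)) :
    |∑ i ∈ A, sgn (σ i) * (w i * c (cl i))| ≤ ε * ∑ j, n j * c j := by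
  classical
  have hl := one_le_logFactor hm
  have hm1 : (0 : ℝ) < m := by exact_mod_cast hm
  have key : ∀ j, |∑ i ∈ (I j).filter (fun i => cl i = j), sgn (σ i) * w i| ≤ ε * n j := by
    intro j
    have h1 := hσ (restr w ((I j).filter fun i => cl i = j) 1)
      (Finset.mem_image.2 ⟨(j, I j), by simp [hI], rfl⟩)
    rw [sum_sgn_restr, sum_restr_sq] at h1
    simp only [Pi.one_apply, mul_one] at h1
    refine h1.trans ?_
    rw [← Real.sqrt_mul (by positivity)]
    apply Real.sqrt_le_iff.2 ⟨mul_nonneg hε.le (hs.n_nonneg j), ?_⟩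
    have h2 : ∑ i ∈ (I j).filter (fun i => cl i = j), w i ^ 2 ≤ 4 * k * n j / m * (4 * n j) := by
      calc _ ≤ ∑ i with cl i = j, w i ^ 2 := by
            apply Finset.sum_le_sum_of_subset_of_nonneg
            · exact Finset.filter_subset_filter _ (Finset.subset_univ _)
            · exact fun i _ _ => sq_nonneg _
        _ ≤ ∑ i with cl i = j, 4 * k * n j / m * w i := by
            refine Finset.sum_le_sum fun i hi => ?_
            rw [sq]
            refine mul_le_mul_of_nonneg_right ?_ (hs.w_nonneg i)
            rw [le_div_iff₀ hm1, mul_comm]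
            have := hs.w_le i
            rwa [(Finset.mem_filter.1 hi).2] at this
        _ ≤ _ := by
            rw [← Finset.mul_sum]
            have := hs.n_nonneg j
            exact mul_le_mul_of_nonneg_left (hs.sum_w_le j) (by positivity)
    rw [div_le_iff₀ (by positivity)] at hmε
    calc 10 * logFactor m * ∑ i ∈ (I j).filter (fun i => cl i = j), w i ^ 2
        ≤ 10 * logFactor m * (4 * k * n j / m * (4 * n j)) := by gcongr
      _ = 160 * logFactor m * k / m * n j ^ 2 := by ring
      _ ≤ ε ^ 2 * n j ^ 2 := by
          gcongr
          rw [div_le_iff₀ hm1]; linarith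
      _ = _ := by ring
  have e : ∑ i ∈ A, sgn (σ i) * (w i * c (cl i))
      = ∑ j, c j * ∑ i ∈ (I j).filter (fun i => cl i = j), sgn (σ i) * w i := by
    rw [← Finset.sum_fiberwise A cl]
    refine Finset.sum_congr rfl fun j _ => ?_
    rw [Finset.mul_sum]
    have : A.filter (fun i => cl i = j) = (I j).filter fun i => cl i = j := by
      ext i
      simp only [Finset.mem_filter, hA]
      constructor <;> rintro ⟨h1, rfl⟩ <;> exact ⟨h1, rfl⟩
    rw [this]
    refine Finset.sum_congr rfl fun i hi => ?_
    rw [(Finset.mem_filter.1 hi).2]; ring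
  rw [e, Finset.mul_sum]
  refine (Finset.abs_sum_le_sum_abs _ _).trans (Finset.sum_le_sum fun j _ => ?_)
  rw [abs_mul, abs_of_nonneg (hc j)]
  calc c j * _ ≤ c j * (ε * n j) := mul_le_mul_of_nonneg_left (key j) (hc j)
    _ = _ := by ring

theorem card_masks_le_exp (cl : Fin m → Fin k) (D : Fin m → ℝ) (hm : 1 ≤ m) :
    ((masks cl D).card : ℝ) ≤ Real.exp (2 * k * logFactor m) := by
  have h1 : ((masks cl D).card : ℝ) ≤ ((m + 1 : ℕ) : ℝ) ^ (2 * k) := by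
    rw [pow_mul]; exact_mod_cast card_masks_le cl D
  have hm1 : (1 : ℝ) ≤ m := by exact_mod_cast hm
  exact h1.trans (pow_le_exp_logFactor hm (by push_cast; linarith) (by push_cast; rfl))

/-- The families of increments of the coarse chain, which starts at `0`. -/
theorem exists_coarseChain (a : Fin k → Pt d) (x : Fin m → Pt d) (cl : Fin m → Fin k)
    (w : Fin m → ℝ) {ε : ℝ} {H : ℕ} (hε : 0 < ε) (hε1 : ε ≤ 1) (hm : 1 ≤ m) (hkm : k ≤ m)
    (hεm : 1 / ε ≤ m) (hH : (2 : ℝ) ^ H ≤ 2 * m) :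
    ∃ F : ℕ → Finset (Fin m → ℝ),
      (∀ h < H, ((F h).card : ℝ) ≤ Real.exp (10502 * k * 4 ^ h * logFactor m)) ∧
      ∀ (S : Fin k → Pt d), ∀ A ∈ masks cl (fun i => ‖x i - a (cl i)‖),
        (∀ i ∈ A, ε * centerDist (a (cl i)) S < ‖x i - a (cl i)‖) →
        ∃ v : ℕ → Fin m → ℝ, v 0 = 0 ∧
          (∀ h ≤ H, ∀ i ∈ A, |v h i - pointCost (x i) S|
            ≤ 13 / 2 ^ h * max ‖x i - a (cl i)‖ (centerDist (a (cl i)) S) ^ 2) ∧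
          ∀ h < H, restr w A (v (h + 1) - v h) ∈ F h := by
  classical
  have hl := one_le_logFactor hm
  have hnet : ∀ h : ℕ, ∃ 𝒱 : Finset (Fin m → ℝ), h ≤ H →
      (𝒱.card : ℝ) ≤ Real.exp (2100 * k * 4 ^ h * logFactor m) ∧
      ∀ S : Fin k → Pt d, ∃ v ∈ 𝒱, (h = 0 → v = 0) ∧ ∀ i,
        ε * centerDist (a (cl i)) S < ‖x i - a (cl i)‖ →
        |v i - pointCost (x i) S| ≤
          13 / 2 ^ h * max ‖x i - a (cl i)‖ (centerDist (a (cl i)) S) ^ 2 := by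
    intro h
    -- At level `0` the vector `0` is precise enough, as the cost is at most `4 * max D δ ^ 2`.
    rcases Nat.eq_zero_or_pos h with rfl | hpos
    · refine ⟨{0}, fun _ => ⟨?_, fun S => ⟨0, by simp, fun _ => rfl, fun i _ => ?_⟩⟩⟩
      · rw [Finset.card_singleton, Nat.cast_one]
        exact Real.one_le_exp (by positivity)
      · have : Nonempty (Fin k) := ⟨cl i⟩
        have h1 := centerDist_le_add (x i) (a (cl i)) S
        rw [Pi.zero_apply, zero_sub, abs_neg, abs_of_nonneg (pointCost_nonneg _ _),
          ← centerDist_sq, pow_zero, div_one]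
        have h2 := le_max_left ‖x i - a (cl i)‖ (centerDist (a (cl i)) S)
        have h3 := le_max_right ‖x i - a (cl i)‖ (centerDist (a (cl i)) S)
        set ρ := max ‖x i - a (cl i)‖ (centerDist (a (cl i)) S)
        have h4 : centerDist (x i) S ^ 2 ≤ (2 * ρ) ^ 2 :=
          pow_le_pow_left₀ (centerDist_nonneg _ _) (by linarith) 2
        nlinarith
    · by_cases hh : h ≤ H
      · obtain ⟨𝒱, h1, h2⟩ := exists_coarseNet a x cl (h := h) hε hε1 hm hkm hεm hpos
          ((pow_le_pow_right₀ one_le_two hh).trans hH)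
        refine ⟨𝒱, fun _ => ⟨h1, fun S => ?_⟩⟩
        obtain ⟨v, hv, hv'⟩ := h2 S
        exact ⟨v, hv, fun h0 => by omega, hv'⟩
      · exact ⟨∅, fun h => absurd h hh⟩
  choose 𝒱 h𝒱 using hnet
  refine ⟨fun h => increments w (masks cl fun i => ‖x i - a (cl i)‖) (𝒱 h) (𝒱 (h + 1)), ?_, ?_⟩
  · intro h hh
    refine (card_increments_le _ _ _ _).trans ?_
    have h1 := card_masks_le_exp cl (fun i => ‖x i - a (cl i)‖) hm
    have h2 := (h𝒱 h hh.le).1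
    have h3 := (h𝒱 (h + 1) hh).1
    have h4 : (1 : ℝ) ≤ 4 ^ h := one_le_pow₀ (by norm_num)
    calc _ ≤ Real.exp (2 * k * logFactor m) * (Real.exp (2100 * k * 4 ^ h * logFactor m)
          * Real.exp (2100 * k * 4 ^ (h + 1) * logFactor m)) := by gcongr
      _ = Real.exp ((2 * 1 + 10500 * 4 ^ h) * (k * logFactor m)) := by
          rw [← Real.exp_add, ← Real.exp_add, pow_succ]; congr 1; ring
      _ ≤ Real.exp ((2 * 4 ^ h + 10500 * 4 ^ h) * (k * logFactor m)) := by gcongr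
      _ = _ := by congr 1; ring
  · intro S A hA hAε
    choose! v hv using fun h (hh : h ≤ H) => (h𝒱 h hh).2 S
    refine ⟨v, (hv 0 (Nat.zero_le _)).2.1 rfl, fun h hh i hi => (hv h hh).2.2 i (hAε i hi), ?_⟩
    intro h hh
    exact restr_mem_increments hA (hv h hh.le).1 (hv (h + 1) hh).1

open Classical in
/-- Rounded values of the squared distances of the reference points to `S`, in units of `D l ^ 2`
for some sample point `l`. -/
def baseValues (D : Fin m → ℝ) (ε : ℝ) : Finset ℝ :=
  (Finset.univ ×ˢ Finset.range (⌊1 / ε ^ 2⌋₊ + 1)).image fun p : Fin m × ℕ => p.2 * D p.1 ^ 2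

/-- If `δ` exceeds all `D i`, `i ∈ A`, by at most a factor `1 / ε`, then `δ ^ 2` can be rounded down in
units of the smallest `D i ^ 2`, with an error that is small compared with each `D i * δ`. -/
theorem exists_baseValue {D : Fin m → ℝ} {ε δ : ℝ} (hm : 1 ≤ m) (hε : 0 < ε) (hδ : 0 ≤ δ)
    (A : Finset (Fin m)) (hA : ∀ i ∈ A, ε * δ < D i ∧ D i < δ) :
    ∃ c ∈ baseValues D ε, 0 ≤ c ∧ c ≤ δ ^ 2 ∧ ∀ i ∈ A, |c - δ ^ 2| ≤ D i * δ := by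
  classical
  rcases A.eq_empty_or_nonempty with h | h
  · subst h
    exact ⟨0, Finset.mem_image.2 ⟨(⟨0, hm⟩, 0), by simp, by simp⟩, le_rfl, sq_nonneg _, by simp⟩
  · obtain ⟨l, hl, hmin⟩ := Finset.exists_min_image A D h
    obtain ⟨h1, h2⟩ := hA l hl
    have hD : 0 < D l := lt_of_le_of_lt (by positivity) h1
    have hq0 : 0 ≤ δ ^ 2 / D l ^ 2 := by positivity
    have hf := Nat.floor_le hq0
    have hf' := Nat.lt_floor_add_one (δ ^ 2 / D l ^ 2)
    rw [le_div_iff₀ (by positivity)] at hf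
    rw [div_lt_iff₀ (by positivity)] at hf'
    refine ⟨⌊δ ^ 2 / D l ^ 2⌋₊ * D l ^ 2, Finset.mem_image.2 ⟨(l, ⌊δ ^ 2 / D l ^ 2⌋₊), ?_, rfl⟩,
      by positivity, hf, fun i hi => ?_⟩
    · simp only [Finset.mem_product, Finset.mem_univ, true_and, Finset.mem_range, Nat.lt_succ_iff]
      apply Nat.floor_le_floor
      rw [div_le_div_iff₀ (by positivity) (by positivity)]
      have : (ε * δ) ^ 2 ≤ D l ^ 2 := pow_le_pow_left₀ (by positivity) h1.le 2
      nlinarith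
    · have h3 := hmin i hi
      have h4 : D l ^ 2 ≤ D i * δ := by
        rw [sq]; exact mul_le_mul h3 h2.le hD.le (hD.le.trans h3)
      rw [abs_le]; constructor <;> linarith

/-- The families of increments of the fine chain, which starts at a vector that is constant on
clusters. The clusters in question are either few, or the bound `1 / ε ^ 2` is affordable. -/
theorem exists_fineChain (a : Fin k → Pt d) (x : Fin m → Pt d) (cl : Fin m → Fin k)
    (w : Fin m → ℝ) {ε κ : ℝ} {H : ℕ} (hε : 0 < ε) (hε1 : ε ≤ 1) (hm : 1 ≤ m) (hkm : k ≤ m)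
    (hεm : 1 / ε ≤ m) (hH : (2 : ℝ) ^ H ≤ 2 * m) (hκ : 1 ≤ κ) :
    ∃ F : ℕ → Finset (Fin m → ℝ),
      (∀ h < H, ((F h).card : ℝ) ≤ Real.exp (10510 * k * κ * 4 ^ h * logFactor m)) ∧
      ∀ (S : Fin k → Pt d) (J : Finset (Fin k)), (κ = 1 / ε ^ 2 ∨ (J.card : ℝ) ≤ κ) →
        ∀ A ∈ masks cl (fun i => ‖x i - a (cl i)‖),
        (∀ i ∈ A, cl i ∈ J ∧ ε * centerDist (a (cl i)) S < ‖x i - a (cl i)‖ ∧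
          ‖x i - a (cl i)‖ < centerDist (a (cl i)) S) →
        ∃ (v : ℕ → Fin m → ℝ) (c : Fin k → ℝ), (v 0 = fun i => c (cl i)) ∧
          (∀ j, 0 ≤ c j ∧ c j ≤ centerDist (a j) S ^ 2) ∧
          (∀ h ≤ H, ∀ i ∈ A, |v h i - pointCost (x i) S|
            ≤ 13 / 2 ^ h * (‖x i - a (cl i)‖ * centerDist (a (cl i)) S)) ∧
          ∀ h < H, restr w A (v (h + 1) - v h) ∈ F h := by
  classical
  have hl := one_le_logFactor hm
  have hm1 : (1 : ℝ) ≤ m := by exact_mod_cast hm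
  set D : Fin m → ℝ := fun i => ‖x i - a (cl i)‖ with hD
  set 𝒞 : Finset (Fin m → ℝ) := (Fintype.piFinset fun _ : Fin k => baseValues D ε).image
    fun c i => c (cl i) with h𝒞
  have h𝒞card : (𝒞.card : ℝ) ≤ Real.exp (3 * k * logFactor m) := by
    have h1 : 𝒞.card ≤ (m * (⌊1 / ε ^ 2⌋₊ + 1)) ^ k := by
      refine Finset.card_image_le.trans ?_
      rw [Fintype.card_piFinset]
      have : (baseValues D ε).card ≤ m * (⌊1 / ε ^ 2⌋₊ + 1) :=
        Finset.card_image_le.trans (by simp)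
      simpa using Nat.pow_le_pow_left this k
    have h2 : (⌊1 / ε ^ 2⌋₊ : ℝ) ≤ m ^ 2 := by
      refine (Nat.floor_le (by positivity)).trans ?_
      rw [← one_div_pow]
      gcongr
    have h3 : ((m * (⌊1 / ε ^ 2⌋₊ + 1) : ℕ) : ℝ) ≤ (100 * m) ^ 3 := by
      push_cast
      calc (m : ℝ) * (⌊1 / ε ^ 2⌋₊ + 1) ≤ m * (m ^ 2 + m ^ 2) := by
            gcongr
            exact one_le_pow₀ hm1
        _ = 2 * (m : ℝ) ^ 3 := by ring
        _ ≤ _ := by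
            rw [mul_pow]
            have : (0 : ℝ) ≤ (m : ℝ) ^ 3 := by positivity
            linarith
    calc (𝒞.card : ℝ) ≤ ((m * (⌊1 / ε ^ 2⌋₊ + 1) : ℕ) : ℝ) ^ k := by exact_mod_cast h1
      _ ≤ ((100 * m) ^ 3) ^ k := by gcongr
      _ = _ := by
          rw [← exp_logFactor hm, ← Real.exp_nat_mul, ← Real.exp_nat_mul]; congr 1; push_cast; ring
  -- The set of heavy clusters depends on `S`, so the nets for all possible such sets are combined;
  -- this costs a factor `2 ^ k`, which is negligible.
  set 𝒥 : Finset (Finset (Fin k)) :=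
    Finset.univ.filter fun J => κ = 1 / ε ^ 2 ∨ (J.card : ℝ) ≤ κ with h𝒥
  have hnet : ∀ (h : ℕ) (J : Finset (Fin k)), ∃ 𝒱 : Finset (Fin m → ℝ), h < H → J ∈ 𝒥 →
      (𝒱.card : ℝ) ≤ Real.exp (2100 * k * κ * 4 ^ (h + 1) * logFactor m) ∧
      ∀ S : Fin k → Pt d, ∃ v ∈ 𝒱, ∀ i, cl i ∈ J → ε * centerDist (a (cl i)) S < D i →
        |v i - pointCost (x i) S| ≤
          13 / 2 ^ (h + 1) * (D i * max (D i) (centerDist (a (cl i)) S)) := by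
    intro h J
    by_cases hh : h < H
    · by_cases hJ : J ∈ 𝒥
      · obtain ⟨𝒱, h1⟩ := exists_fineNet a x cl (h := h + 1) (J := J) hε hε1 hm hkm hεm
          (Nat.le_add_left 1 h) ((pow_le_pow_right₀ one_le_two hh).trans hH) hκ
          (Finset.mem_filter.1 hJ).2
        exact ⟨𝒱, fun _ _ => h1⟩
      · exact ⟨∅, fun _ h => absurd h hJ⟩
    · exact ⟨∅, fun h => absurd h hh⟩
  choose 𝒱 h𝒱 using hnet
  set 𝒲 : ℕ → Finset (Fin k) → Finset (Fin m → ℝ) := fun h J => if h = 0 then 𝒞 else 𝒱 (h - 1) J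
    with h𝒲
  refine ⟨fun h => 𝒥.biUnion fun J => increments w (masks cl D) (𝒲 h J) (𝒲 (h + 1) J), ?_, ?_⟩
  · intro h hh
    have h4 : (1 : ℝ) ≤ 4 ^ h := one_le_pow₀ (by norm_num)
    have h4κ : 1 ≤ κ * 4 ^ h := by nlinarith
    have hk0 : 0 ≤ k * logFactor m := by positivity
    have hJ : ∀ J ∈ 𝒥, ((increments w (masks cl D) (𝒲 h J) (𝒲 (h + 1) J)).card : ℝ)
        ≤ Real.exp (10505 * k * κ * 4 ^ h * logFactor m) := by
      intro J hJ
      refine (card_increments_le _ _ _ _).trans ?_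
      have h1 := card_masks_le_exp cl D hm
      have h3 : ((𝒲 (h + 1) J).card : ℝ) ≤ Real.exp (2100 * k * κ * 4 ^ (h + 1) * logFactor m) := by
        simpa [h𝒲] using (h𝒱 h J hh hJ).1
      have h2 : ((𝒲 h J).card : ℝ) ≤ Real.exp (2103 * k * κ * 4 ^ h * logFactor m) := by
        rcases Nat.eq_zero_or_pos h with rfl | hpos
        · have e : 𝒲 0 J = 𝒞 := by simp [h𝒲]
          rw [e]
          refine h𝒞card.trans (Real.exp_le_exp.2 ?_)
          rw [pow_zero]
          nlinarith
        · have e : 𝒲 h J = 𝒱 (h - 1) J := by simp [h𝒲, hpos.ne']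
          rw [e]
          refine ((h𝒱 (h - 1) J (by omega) hJ).1).trans (Real.exp_le_exp.2 ?_)
          rw [Nat.sub_add_cancel hpos]
          have : 0 ≤ κ * 4 ^ h * (k * logFactor m) := by positivity
          nlinarith
      calc _ ≤ Real.exp (2 * k * logFactor m) * (Real.exp (2103 * k * κ * 4 ^ h * logFactor m)
            * Real.exp (2100 * k * κ * 4 ^ (h + 1) * logFactor m)) := by gcongr
        _ = Real.exp ((2 * 1 + 10503 * (κ * 4 ^ h)) * (k * logFactor m)) := by
            rw [← Real.exp_add, ← Real.exp_add, pow_succ]; congr 1; ring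
        _ ≤ Real.exp ((2 * (κ * 4 ^ h) + 10503 * (κ * 4 ^ h)) * (k * logFactor m)) := by gcongr
        _ = _ := by congr 1; ring
    have hJcard : (𝒥.card : ℝ) ≤ Real.exp (k * logFactor m) := by
      have h1 : 𝒥.card ≤ 2 ^ k := by
        refine (Finset.card_filter_le _ _).trans ?_
        simp
      have h2 : (𝒥.card : ℝ) ≤ ((2 : ℕ) : ℝ) ^ k := by exact_mod_cast h1
      exact h2.trans (pow_le_exp_logFactor hm (by push_cast; linarith) le_rfl)
    calc ((𝒥.biUnion fun J => increments w (masks cl D) (𝒲 h J) (𝒲 (h + 1) J)).card : ℝ)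
        ≤ ∑ J ∈ 𝒥, ((increments w (masks cl D) (𝒲 h J) (𝒲 (h + 1) J)).card : ℝ) := by
          exact_mod_cast Finset.card_biUnion_le
      _ ≤ 𝒥.card * Real.exp (10505 * k * κ * 4 ^ h * logFactor m) := by
          simpa using Finset.sum_le_card_nsmul _ _ _ hJ
      _ ≤ Real.exp (k * logFactor m) * Real.exp (10505 * k * κ * 4 ^ h * logFactor m) := by gcongr
      _ = Real.exp ((1 + 10505 * (κ * 4 ^ h)) * (k * logFactor m)) := by
          rw [← Real.exp_add]; congr 1; ring
      _ ≤ Real.exp ((5 * (κ * 4 ^ h) + 10505 * (κ * 4 ^ h)) * (k * logFactor m)) := by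
          gcongr; linarith
      _ = _ := by congr 1; ring
  · intro S J hJ A hA hAδ
    have hJ' : J ∈ 𝒥 := Finset.mem_filter.2 ⟨Finset.mem_univ _, hJ⟩
    have hbase : ∀ j, ∃ c ∈ baseValues D ε, 0 ≤ c ∧ c ≤ centerDist (a j) S ^ 2 ∧
        ∀ i ∈ A.filter (fun i => cl i = j), |c - centerDist (a j) S ^ 2|
          ≤ D i * centerDist (a j) S := fun j => by
      refine exists_baseValue hm hε (centerDist_nonneg _ _) _ fun i hi => ?_
      obtain ⟨hiA, rfl⟩ := Finset.mem_filter.1 hi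
      exact (hAδ i hiA).2
    choose c hcmem hc0 hcle hcA using hbase
    choose! v hv hv' using fun h (hh : h < H) => (h𝒱 h J hh hJ').2 S
    set u : ℕ → Fin m → ℝ := fun h => if h = 0 then fun i => c (cl i) else v (h - 1) with hu
    have humem : ∀ h ≤ H, u h ∈ 𝒲 h J := by
      intro h hh
      rcases Nat.eq_zero_or_pos h with rfl | hpos
      · simp only [hu, h𝒲, if_true]
        exact Finset.mem_image.2 ⟨c, Fintype.mem_piFinset.2 hcmem, rfl⟩
      · simp only [hu, h𝒲, if_neg hpos.ne']
        exact hv (h - 1) (by omega)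
    refine ⟨u, c, by simp [hu], fun j => ⟨hc0 j, hcle j⟩, fun h hh i hi => ?_, fun h hh => ?_⟩
    · obtain ⟨hiJ, hi1, hi2⟩ := hAδ i hi
      rcases Nat.eq_zero_or_pos h with rfl | hpos
      · simp only [hu, if_true, pow_zero, div_one]
        have h1 := hcA (cl i) i (Finset.mem_filter.2 ⟨hi, rfl⟩)
        have : Nonempty (Fin k) := ⟨cl i⟩
        have h2 := centerDist_le_add (x i) (a (cl i)) S
        have h3 := centerDist_le_add (a (cl i)) (x i) S
        rw [norm_sub_rev] at h3
        rw [← centerDist_sq]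
        have h4 := centerDist_nonneg (x i) S
        change |c (cl i) - centerDist (x i) S ^ 2| ≤ 13 * (D i * centerDist (a (cl i)) S)
        change ε * centerDist (a (cl i)) S < D i at hi1
        change D i < centerDist (a (cl i)) S at hi2
        change centerDist (x i) S ≤ centerDist (a (cl i)) S + D i at h2
        change centerDist (a (cl i)) S ≤ centerDist (x i) S + D i at h3
        set δ := centerDist (a (cl i)) S
        set y := centerDist (x i) S
        have hD0 : 0 ≤ D i := norm_nonneg _
        have h5 : |δ ^ 2 - y ^ 2| ≤ 3 * (D i * δ) := by
          rw [show δ ^ 2 - y ^ 2 = (δ - y) * (δ + y) by ring, abs_mul]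
          have a1 : |δ - y| ≤ D i := abs_le.2 ⟨by linarith, by linarith⟩
          have a2 : |δ + y| ≤ 3 * δ := abs_le.2 ⟨by linarith, by linarith⟩
          calc _ ≤ D i * (3 * δ) := mul_le_mul a1 a2 (abs_nonneg _) hD0
            _ = _ := by ring
        have h6 := abs_add_le (c (cl i) - δ ^ 2) (δ ^ 2 - y ^ 2)
        rw [sub_add_sub_cancel] at h6
        have h7 : 0 ≤ D i * δ := mul_nonneg hD0 (hD0.trans hi2.le)
        linarith
      · have h1 := hv' (h - 1) (by omega) i hiJ hi1
        rw [Nat.sub_add_cancel hpos, max_eq_right hi2.le] at h1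
        simpa only [hu, if_neg hpos.ne'] using h1
    · exact Finset.mem_biUnion.2
        ⟨J, hJ', restr_mem_increments hA (humem h hh.le) (humem (h + 1) hh)⟩

end sample

/-! ### Uniform bounds for the signed sums -/

section deviation

variable {d k m : ℕ} {a : Fin k → Pt d} {x : Fin m → Pt d} {cl : Fin m → Fin k}
  {w : Fin m → ℝ} {n : Fin k → ℝ} {Φ : ℝ}

/-- The total of the increments of a chain. The number of levels costs a factor `logFactor m`, and
the sizes of the nets cost `k * κ * logFactor m`. -/
theorem chain_budget {H : ℕ} {T κ κ' ε M : ℝ} (hm : 1 ≤ m) (hε : 0 < ε) (hκ' : 0 ≤ κ') (hM : 0 ≤ M)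
    (hH : (H : ℝ) ≤ 3 * logFactor m) (hT : T ^ 2 * κ' ≤ 21030 * (k * κ * logFactor m))
    (hmε : 3 * 10 ^ 9 * (k * κ * logFactor m ^ 3) / ε ^ 2 ≤ m) :
    H * (20 * T * √(16 * κ' * M ^ 2 / m)) ≤ ε * M := by
  have hm1 : (0 : ℝ) < m := by exact_mod_cast hm
  have hl := one_le_logFactor hm
  rw [div_le_iff₀ (by positivity)] at hmε
  refine (le_abs_self _).trans (abs_le_of_sq_le_sq ?_ (by positivity))
  rw [mul_pow, mul_pow, Real.sq_sqrt (by positivity), mul_pow, mul_pow]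
  have h1 : (H : ℝ) ^ 2 ≤ (3 * logFactor m) ^ 2 := by gcongr
  have h0 : 0 ≤ T ^ 2 * κ' := by positivity
  calc (H : ℝ) ^ 2 * (20 ^ 2 * T ^ 2 * (16 * κ' * M ^ 2 / m))
      = H ^ 2 * (T ^ 2 * κ') * (6400 * M ^ 2 / m) := by ring
    _ ≤ (3 * logFactor m) ^ 2 * (21030 * (k * κ * logFactor m)) * (6400 * M ^ 2 / m) := by gcongr
    _ = 1211328000 * (k * κ * logFactor m ^ 3) * (M ^ 2 / m) := by ring
    _ ≤ (m * ε ^ 2) * (M ^ 2 / m) := by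
        have : 0 ≤ k * κ * logFactor m ^ 3 := by
          have : 0 ≤ 21030 * (k * κ * logFactor m) := h0.trans hT
          have h3 : k * κ * logFactor m ^ 3 = k * κ * logFactor m * logFactor m ^ 2 := by ring
          rw [h3]
          exact mul_nonneg (by linarith) (sq_nonneg _)
        refine mul_le_mul_of_nonneg_right ?_ (by positivity)
        linarith
    _ = _ := by field_simp

/-- Points much closer to their reference point than `S` is: their cost may be replaced by the
squared distance of the reference point to `S`, which is constant on clusters. -/
theorem WeightedSample.abs_sum_far_le (hs : WeightedSample a x cl w n Φ) (hm : 1 ≤ m) {ε : ℝ}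
    (hε : 0 < ε) (hε1 : ε ≤ 1) (hmε : 160 * logFactor m * k / ε ^ 2 ≤ m) {σ : Fin m → Bool}
    (hσ : ∀ y ∈ clusterVectors w cl (fun i => ‖x i - a (cl i)‖),
      |∑ i, sgn (σ i) * y i| ≤ √(10 * logFactor m) * √(∑ i, y i ^ 2)) (S : Fin k → Pt d)
    {A : Finset (Fin m)}
    (hA : ∀ i, i ∈ A ↔ ‖x i - a (cl i)‖ ≤ ε * centerDist (a (cl i)) S) :
    |∑ i ∈ A, sgn (σ i) * (w i * pointCost (x i) S)| ≤ 13 * ε * scaleCost a n Φ S := by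
  classical
  set D : Fin m → ℝ := fun i => ‖x i - a (cl i)‖ with hD
  have h1 := hs.abs_sum_sgn_cluster_le hm hε hmε hσ
    (I := fun j => Finset.univ.filter fun i => D i ≤ ε * centerDist (a j) S)
    (fun j => mem_intervals D (fun _ => True) (fun i => ε * centerDist (a j) S < D i)
      (fun _ _ _ _ => trivial) (fun i l h1 h2 => h1.trans_le h2) fun i => by simp)
    (fun j => centerDist (a j) S ^ 2) (fun j => sq_nonneg _) (A := A)
    (fun i => by simp [hA, hD])
  have h2 : |∑ i ∈ A, sgn (σ i) * (w i * (pointCost (x i) S - centerDist (a (cl i)) S ^ 2))|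
      ≤ 12 * ε * scaleCost a n Φ S := by
    refine (abs_sum_sgn_le A _ (fun i => w i * (3 * ε * centerDist (a (cl i)) S ^ 2)) σ
      fun i hi => ?_).trans ?_
    · have hi' := (hA i).1 hi
      have : Nonempty (Fin k) := ⟨cl i⟩
      have h2 := centerDist_le_add (x i) (a (cl i)) S
      have h3 := centerDist_le_add (a (cl i)) (x i) S
      rw [norm_sub_rev] at h3
      rw [← centerDist_sq, abs_mul, abs_of_nonneg (hs.w_nonneg i)]
      refine mul_le_mul_of_nonneg_left ?_ (hs.w_nonneg i)
      have h4 := centerDist_nonneg (x i) S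
      have h5 := centerDist_nonneg (a (cl i)) S
      set δ := centerDist (a (cl i)) S
      set y := centerDist (x i) S
      have h6 : ε * δ ≤ δ := mul_le_of_le_one_left h5 hε1
      rw [show y ^ 2 - δ ^ 2 = (y - δ) * (y + δ) by ring, abs_mul]
      have a1 : |y - δ| ≤ ε * δ := abs_le.2 ⟨by linarith, by linarith⟩
      have a2 : |y + δ| ≤ 3 * δ := abs_le.2 ⟨by linarith, by linarith⟩
      calc _ ≤ ε * δ * (3 * δ) := mul_le_mul a1 a2 (abs_nonneg _) (by positivity)
        _ = _ := by ring
    · calc _ ≤ ∑ i, w i * (3 * ε * centerDist (a (cl i)) S ^ 2) :=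
            Finset.sum_le_univ_sum_of_nonneg fun i => mul_nonneg (hs.w_nonneg i) (by positivity)
        _ = 3 * ε * ∑ i, w i * centerDist (a (cl i)) S ^ 2 := by
            rw [Finset.mul_sum]; exact Finset.sum_congr rfl fun i _ => by ring
        _ ≤ 3 * ε * (4 * scaleCost a n Φ S) := by
            have := hs.sum_w_mul_centerDist_le S
            gcongr
        _ = _ := by ring
  have e : ∑ i ∈ A, sgn (σ i) * (w i * pointCost (x i) S)
      = ∑ i ∈ A, sgn (σ i) * (w i * centerDist (a (cl i)) S ^ 2)
        + ∑ i ∈ A, sgn (σ i) * (w i * (pointCost (x i) S - centerDist (a (cl i)) S ^ 2)) := by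
    rw [← Finset.sum_add_distrib]
    exact Finset.sum_congr rfl fun i _ => by ring
  rw [e]
  have h3 := hs.sum_le_scaleCost S
  have h4 : ε * ∑ j, n j * centerDist (a j) S ^ 2 ≤ ε * scaleCost a n Φ S := by gcongr
  refine (abs_add_le _ _).trans ?_
  linarith

/-- The number of levels of the chains. -/
theorem exists_levels {ε : ℝ} (hε : 0 < ε) (hε1 : ε ≤ 1) (hm : 1 ≤ m) (hεm : 1 / ε ≤ m) :
    ∃ H : ℕ, (2 : ℝ) ^ H ≤ 2 * m ∧ 1 / 2 ^ H ≤ ε ∧ (H : ℝ) ≤ 3 * logFactor m ∧ H ≤ m := by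
  have hm1 : (1 : ℝ) ≤ m := by exact_mod_cast hm
  have hl := one_le_logFactor hm
  obtain ⟨N, h1, h2⟩ := exists_nat_pow_near (x := 1 / ε) (y := (2 : ℝ))
    (by rw [le_div_iff₀ hε]; linarith) one_lt_two
  have h3 : (2 : ℝ) ^ N ≤ m := h1.trans hεm
  refine ⟨N + 1, by rw [pow_succ]; linarith, ?_, ?_, ?_⟩
  · rw [div_le_iff₀ (by positivity)]
    rw [div_lt_iff₀ hε] at h2
    linarith
  · have h4 : N * Real.log 2 ≤ Real.log m := by
      rw [← Real.log_pow]
      exact Real.log_le_log (by positivity) h3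
    have h5 : Real.log m ≤ logFactor m := Real.log_le_log (by linarith) (by linarith)
    have h6 := Real.log_two_gt_d9
    have h7 : (N : ℝ) * 0.5 ≤ N * Real.log 2 := by gcongr; linarith
    push_cast
    linarith
  · have h4 : N + 1 ≤ 2 ^ N := Nat.lt_two_pow_self
    have h5 : 2 ^ N ≤ m := by exact_mod_cast h3
    omega

/-- With high probability over the random signs, the signed sums of the weighted costs are small
for all `S` simultaneously. -/
theorem WeightedSample.pr_sign_deviation_le (hs : WeightedSample a x cl w n Φ) (hm : 1 ≤ m)
    (hk : 1 ≤ k) {ε κ : ℝ} (hε : 0 < ε) (hε1 : ε ≤ 1) (hκ : 1 ≤ κ)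
    (hκε : κ = 1 / ε ^ 2 ∨ (k : ℝ) ≤ κ ^ 2)
    (hmε : 3 * 10 ^ 9 * (k * κ * logFactor m ^ 3) / ε ^ 2 ≤ m) :
    pr signWt (fun σ : Fin m → Bool => ∃ S : Fin k → Pt d, 120 * ε * scaleCost a n Φ S
      < |∑ i, sgn (σ i) * (w i * pointCost (x i) S)|) ≤ 1 / 24 := by
  classical
  have hm1 : (1 : ℝ) ≤ m := by exact_mod_cast hm
  have hk1 : (1 : ℝ) ≤ k := by exact_mod_cast hk
  have hl := one_le_logFactor hm
  have hl3 : logFactor m ≤ logFactor m ^ 3 := le_self_pow₀ hl (by norm_num)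
  have hprod : k * logFactor m ≤ k * κ * logFactor m ^ 3 := by
    calc k * logFactor m = k * 1 * logFactor m := by ring
      _ ≤ _ := by gcongr
  have hmε' := (div_le_iff₀ (by positivity : 0 < ε ^ 2)).1 hmε
  have hε2 : ε ^ 2 ≤ ε := by rw [sq]; exact mul_le_of_le_one_left hε.le hε1
  have hkl : (k : ℝ) ≤ k * logFactor m := le_mul_of_one_le_right (by linarith) hl
  have hkm : k ≤ m := by
    have : (k : ℝ) ≤ m := by
      have : (m : ℝ) * ε ^ 2 ≤ m * 1 := by gcongr; linarith
      linarith
    exact_mod_cast this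
  have hεm : 1 / ε ≤ m := by
    rw [div_le_iff₀ hε]
    have : (m : ℝ) * ε ^ 2 ≤ m * ε := by gcongr
    linarith
  have hm160 : 160 * logFactor m * k / ε ^ 2 ≤ m := by
    rw [div_le_iff₀ (by positivity)]; linarith
  obtain ⟨H, hH1, hH2, hH3, hH4⟩ := exists_levels hε hε1 hm hεm
  obtain ⟨FA, hFA, hFA'⟩ := exists_coarseChain a x cl w hε hε1 hm hkm hεm hH1
  obtain ⟨FB, hFB, hFB'⟩ := exists_fineChain a x cl w hε hε1 hm hkm hεm hH1 hκ
  set TA := √(2 * (10502 * k + 3) * logFactor m) with hTA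
  set TB := √(2 * (10510 * k * κ + 3) * logFactor m) with hTB
  have hTA2 : TA ^ 2 = 2 * (10502 * k + 3) * logFactor m := Real.sq_sqrt (by positivity)
  have hTB2 : TB ^ 2 = 2 * (10510 * k * κ + 3) * logFactor m := Real.sq_sqrt (by positivity)
  have pA := pr_exists_level_le FA hm hH4 (Real.sqrt_nonneg _) hTA2 hFA
  have pB := pr_exists_level_le FB hm hH4 (Real.sqrt_nonneg _) hTB2 hFB
  have pC := pr_clusterVectors_le w cl (fun i => ‖x i - a (cl i)‖) hm hkm
  refine (pr_mono signWt_nonneg (B := fun σ => _ ∨ _ ∨ _) ?_).trans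
    ((pr_or_le signWt_nonneg).trans ((add_le_add pC ((pr_or_le signWt_nonneg).trans
      (add_le_add pA pB))).trans (by norm_num)))
  rintro σ ⟨S, hS⟩
  by_contra hcon
  push Not at hcon
  obtain ⟨gC, gA, gB⟩ := hcon
  -- It remains to prove a deterministic bound under the three good events.
  set D : Fin m → ℝ := fun i => ‖x i - a (cl i)‖ with hD
  set δ : Fin k → ℝ := fun j => centerDist (a j) S with hδ
  set M := scaleCost a n Φ S with hM
  have hM0 : 0 ≤ M := hs.scaleCost_nonneg S
  set heavy : Fin k → Prop := fun j => κ * M < k * (n j * δ j ^ 2) with hheavy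
  have up : ∀ t : ℝ, ∀ i l, t < D i → D i ≤ D l → t < D l := fun t i l h1 h2 => h1.trans_le h2
  have up' : ∀ t : ℝ, ∀ i l, t ≤ D i → D i ≤ D l → t ≤ D l := fun t i l h1 h2 => h1.trans h2
  set Far := Finset.univ.filter fun i => D i ≤ ε * δ (cl i) with hFar
  set IA : Fin k → Finset (Fin m) := fun j => Finset.univ.filter fun i =>
    ε * δ j < D i ∧ (δ j ≤ D i ∨ ¬ heavy j) with hIA
  set IB : Fin k → Finset (Fin m) := fun j => Finset.univ.filter fun i =>
    (ε * δ j < D i ∧ heavy j) ∧ ¬ δ j ≤ D i with hIB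
  -- Whether a cluster is heavy does not depend on the point, so both sets are cut out of each cluster
  -- by an interval of values of `D`.
  have hIAmem : ∀ j, IA j ∈ intervals D := fun j => mem_intervals D
    (fun i => ε * δ j < D i ∧ (δ j ≤ D i ∨ ¬ heavy j)) (fun _ => False)
    (fun i l h1 h2 => ⟨up _ i l h1.1 h2, h1.2.imp_left fun h => up' _ i l h h2⟩)
    (fun i l h1 => h1.elim) fun i => by simp [hIA]
  have hIBmem : ∀ j, IB j ∈ intervals D := fun j => mem_intervals D
    (fun i => ε * δ j < D i ∧ heavy j) (fun i => δ j ≤ D i)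
    (fun i l h1 h2 => ⟨up _ i l h1.1 h2, h1.2⟩) (up' _) fun i => by simp [hIB]
  set A := Finset.univ.filter fun i => i ∈ IA (cl i) with hA
  set B := Finset.univ.filter fun i => i ∈ IB (cl i) with hB
  have memA : ∀ i ∈ A, ε * δ (cl i) < D i ∧ (δ (cl i) ≤ D i ∨ ¬ heavy (cl i)) := by
    intro i hi
    simpa [hA, hIA] using hi
  have memB : ∀ i ∈ B, ε * δ (cl i) < D i ∧ heavy (cl i) ∧ D i < δ (cl i) := by
    intro i hi
    simpa [hB, hIB, and_assoc] using hi
  have split : ∀ f : Fin m → ℝ, ∑ i, f i = ∑ i ∈ Far, f i + ∑ i ∈ A, f i + ∑ i ∈ B, f i := by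
    intro f
    simp only [hFar, hA, hB, Finset.sum_filter, ← Finset.sum_add_distrib]
    refine Finset.sum_congr rfl fun i _ => ?_
    simp only [hIA, hIB, Finset.mem_filter, Finset.mem_univ, true_and]
    by_cases c1 : D i ≤ ε * δ (cl i)
    · simp [c1, not_lt.2 c1]
    · by_cases c2 : δ (cl i) ≤ D i
      · simp [c1, not_le.1 c1, c2]
      · by_cases c3 : heavy (cl i) <;> simp [c1, not_le.1 c1, c2, c3]
  have bFar : |∑ i ∈ Far, sgn (σ i) * (w i * pointCost (x i) S)| ≤ 13 * ε * M :=
    hs.abs_sum_far_le hm hε hε1 hm160 gC S (fun i => by simp [hFar, hD, hδ])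
  have hlast : ∀ E : ℝ, E ≤ 4 * M → 13 / 2 ^ H * E ≤ 52 * ε * M := by
    intro E hE
    calc 13 / 2 ^ H * E ≤ 13 / 2 ^ H * (4 * M) := by gcongr
      _ = 52 * (1 / 2 ^ H) * M := by ring
      _ ≤ _ := by gcongr
  have bA : |∑ i ∈ A, sgn (σ i) * (w i * pointCost (x i) S)| ≤ 53 * ε * M := by
    obtain ⟨v, hv0, hv, hvF⟩ := hFA' S A (mem_masks cl D hIAmem fun i => by simp [hA])
      fun i hi => (memA i hi).1
    have h1 := abs_sum_sgn_sub_le (f := fun i => pointCost (x i) S) (T := TA) hs.w_nonneg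
      (Real.sqrt_nonneg _) hv (σ := σ) fun h hh => gA h (Finset.mem_range.2 hh) _ (hvF h hh)
    have h2 : |∑ i ∈ A, sgn (σ i) * (w i * v 0 i)| = 0 := by simp [hv0]
    have h3 := hs.sum_coarse_envelope_le hm hκ S A fun i hi =>
      (memA i hi).2.imp_right fun h => not_lt.1 h
    have h4 : TA ^ 2 * κ ≤ 21030 * (k * κ * logFactor m) := by
      rw [hTA2]
      have : κ * logFactor m ≤ k * (κ * logFactor m) := le_mul_of_one_le_left (by positivity) hk1
      have h8 : 0 ≤ k * (κ * logFactor m) := by positivity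
      linarith
    have h5 := chain_budget hm hε (by linarith : 0 ≤ κ) hM0 hH3 h4 hmε
    have h6 : (H : ℝ) * (20 * TA * √(∑ i ∈ A, (w i * max ‖x i - a (cl i)‖
        (centerDist (a (cl i)) S) ^ 2) ^ 2)) ≤ H * (20 * TA * √(16 * κ * M ^ 2 / m)) := by
      gcongr
    have h7 := hlast _ (hs.sum_w_mul_max_le hm S A)
    linarith
  have bB : |∑ i ∈ B, sgn (σ i) * (w i * pointCost (x i) S)| ≤ 54 * ε * M := by
    -- The quantities `n j * δ j ^ 2` have sum at most `M`, so that there are at most `k / κ` heavy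
    -- clusters. If `M = 0` then there are none.
    set J := Finset.univ.filter heavy with hJ
    have hJcard : κ = 1 / ε ^ 2 ∨ (J.card : ℝ) ≤ κ := by
      refine hκε.imp_right fun hκ2 => ?_
      rcases eq_or_lt_of_le hM0 with hM00 | hMpos
      · have : J = ∅ := by
          rw [hJ, Finset.filter_eq_empty_iff]
          intro j _ hj
          simp only [hheavy, ← hM00, mul_zero] at hj
          have h1 := hs.sum_le_scaleCost S
          have h2 : n j * δ j ^ 2 ≤ ∑ j, n j * centerDist (a j) S ^ 2 :=
            Finset.single_le_sum (f := fun j => n j * centerDist (a j) S ^ 2)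
              (fun j _ => mul_nonneg (hs.n_nonneg j) (sq_nonneg _)) (Finset.mem_univ j)
          have h3 : n j * δ j ^ 2 ≤ 0 := by linarith
          nlinarith
        rw [this]; simp; linarith
      · have h1 : (J.card : ℝ) * (κ * M) ≤ k * M := by
          calc (J.card : ℝ) * (κ * M) = ∑ _j ∈ J, κ * M := by simp
            _ ≤ ∑ j ∈ J, k * (n j * δ j ^ 2) :=
                Finset.sum_le_sum fun j hj => (Finset.mem_filter.1 hj).2.le
            _ ≤ ∑ j, k * (n j * δ j ^ 2) := Finset.sum_le_univ_sum_of_nonneg fun j =>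
                mul_nonneg (by linarith) (mul_nonneg (hs.n_nonneg j) (sq_nonneg _))
            _ ≤ k * M := by
                rw [← Finset.mul_sum]
                have := hs.sum_le_scaleCost S
                gcongr
        have h2 : (J.card : ℝ) * κ ≤ κ ^ 2 := by
          refine le_trans ?_ hκ2
          refine le_of_mul_le_mul_right ?_ hMpos
          linarith
        refine le_of_mul_le_mul_right (h2.trans_eq (sq κ)) (by linarith)
    obtain ⟨v, c, hv0, hc, hv, hvF⟩ := hFB' S J hJcard B (mem_masks cl D hIBmem fun i => by simp [hB])
      fun i hi => ⟨Finset.mem_filter.2 ⟨Finset.mem_univ _, (memB i hi).2.1⟩, (memB i hi).1,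
        (memB i hi).2.2⟩
    have h1 := abs_sum_sgn_sub_le (f := fun i => pointCost (x i) S) (T := TB) hs.w_nonneg
      (Real.sqrt_nonneg _) hv (σ := σ) fun h hh => gB h (Finset.mem_range.2 hh) _ (hvF h hh)
    have h2 : |∑ i ∈ B, sgn (σ i) * (w i * v 0 i)| ≤ ε * M := by
      rw [hv0]
      refine (hs.abs_sum_sgn_cluster_le hm hε hm160 gC hIBmem c (fun j => (hc j).1)
        (fun i => by simp [hB])).trans ?_
      gcongr
      refine le_trans (Finset.sum_le_sum fun j _ => ?_) (hs.sum_le_scaleCost S)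
      exact mul_le_mul_of_nonneg_left (hc j).2 (hs.n_nonneg j)
    have h3 := hs.sum_fine_envelope_le hm S B
    have h4 : TB ^ 2 * 1 ≤ 21030 * (k * κ * logFactor m) := by
      rw [hTB2]
      have h8 : (1 : ℝ) ≤ k * κ := by nlinarith
      have : logFactor m ≤ k * κ * logFactor m := le_mul_of_one_le_left (by positivity) h8
      linarith
    have h5 := chain_budget hm hε zero_le_one hM0 hH3 h4 hmε
    have h6 : (H : ℝ) * (20 * TB * √(∑ i ∈ B, (w i * (‖x i - a (cl i)‖ *
        centerDist (a (cl i)) S)) ^ 2)) ≤ H * (20 * TB * √(16 * 1 * M ^ 2 / m)) := by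
      rw [mul_one]
      gcongr
    have h7 := hlast (∑ i ∈ B, w i * (‖x i - a (cl i)‖ * centerDist (a (cl i)) S))
      (le_trans (Finset.sum_le_sum fun i _ => mul_le_mul_of_nonneg_left ?_ (hs.w_nonneg i))
        (hs.sum_w_mul_max_le hm S B))
    · linarith
    · rw [sq]
      exact mul_le_mul (le_max_left _ _) (le_max_right _ _) (centerDist_nonneg _ _)
        ((norm_nonneg _).trans (le_max_left _ _))
  rw [split] at hS
  have h1 := abs_add_le (∑ i ∈ Far, sgn (σ i) * (w i * pointCost (x i) S)
    + ∑ i ∈ A, sgn (σ i) * (w i * pointCost (x i) S))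
    (∑ i ∈ B, sgn (σ i) * (w i * pointCost (x i) S))
  have h2 := abs_add_le (∑ i ∈ Far, sgn (σ i) * (w i * pointCost (x i) S))
    (∑ i ∈ A, sgn (σ i) * (w i * pointCost (x i) S))
  linarith

end deviation

/-! ### Sensitivity sampling -/

section sampling

variable {d k m : ℕ} {P : Finset (Pt d)} {A : Fin k → Pt d} {asg : Pt d → Fin k} {γ : ℝ}

theorem pointCost_eq (h : IsNearestAssignment P A asg) {p : Pt d} (hp : p ∈ P) :
    pointCost p A = ‖p - A (asg p)‖ ^ 2 := by
  have : Nonempty (Fin k) := ⟨asg p⟩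
  refine le_antisymm (pointCost_le p A _) (le_ciInf fun j => ?_)
  exact pow_le_pow_left₀ (norm_nonneg _) (h p hp j) 2

theorem sum_cluster (f : Pt d → ℝ) : ∑ p ∈ P, f p = ∑ j : Fin k, ∑ p ∈ cluster P asg j, f p :=
  (Finset.sum_fiberwise P asg f).symm

theorem card_cluster_pos {p : Pt d} (hp : p ∈ P) :
    (0 : ℝ) < (cluster P asg (asg p)).card := by
  exact_mod_cast Finset.card_pos.2 ⟨p, by simp [cluster, hp]⟩

/-- The scores have sum at most `1`, with equality unless some cluster has cost zero: then the
quotients `0 / 0` in the scores contribute nothing. -/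
theorem sum_score_le_one (P : Finset (Pt d)) (A : Fin k → Pt d) (asg : Pt d → Fin k) :
    ∑ p ∈ P, score P A asg p ≤ 1 := by
  have hcost : cost P A = ∑ j : Fin k, cost (cluster P asg j) A := sum_cluster _
  have key : ∀ j : Fin k, ∑ p ∈ cluster P asg j, score P A asg p
      ≤ (1 / 4) * (1 / k + 1 / k + 2 * (cost (cluster P asg j) A / cost P A)) := by
    intro j
    have hk : (0 : ℝ) < k := by exact_mod_cast j.pos
    have e : ∀ p ∈ cluster P asg j, score P A asg p = (1 / 4) *
        (1 / ((k : ℝ) * ((cluster P asg j).card : ℝ))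
          + pointCost p A / ((k : ℝ) * cost (cluster P asg j) A)
          + pointCost p A / cost P A + avgCost P A asg j / cost P A) := by
      intro p hp
      have : asg p = j := (Finset.mem_filter.1 hp).2
      simp only [score, this]
    rw [Finset.sum_congr rfl e, ← Finset.mul_sum]
    simp only [Finset.sum_add_distrib, ← Finset.sum_div, Finset.sum_const, nsmul_eq_mul]
    change (1 / 4) * (_ + cost (cluster P asg j) A / _ + cost (cluster P asg j) A / _ + _) ≤ _
    have h1 : ((cluster P asg j).card : ℝ) * (1 / (k * (cluster P asg j).card)) ≤ 1 / k := by
      have : ((cluster P asg j).card : ℝ) * (1 / (k * (cluster P asg j).card))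
          = (cluster P asg j).card / (cluster P asg j).card * (1 / k) := by
        rw [mul_one_div, div_mul_div_comm, mul_one, mul_comm (k : ℝ)]
      rw [this]
      exact mul_le_of_le_one_left (by positivity) (div_self_le_one _)
    have h2 : cost (cluster P asg j) A / (k * cost (cluster P asg j) A) ≤ 1 / k := by
      have : cost (cluster P asg j) A / (k * cost (cluster P asg j) A)
          = cost (cluster P asg j) A / cost (cluster P asg j) A * (1 / k) := by
        rw [div_mul_div_comm, mul_one, mul_comm (cost _ _) (k : ℝ)]
      rw [this]
      exact mul_le_of_le_one_left (by positivity) (div_self_le_one _)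
    have h3 : ((cluster P asg j).card : ℝ) * avgCost P A asg j ≤ cost (cluster P asg j) A := by
      unfold avgCost
      rw [mul_div_left_comm]
      exact mul_le_of_le_one_right (cost_nonneg _ _) (div_self_le_one _)
    have h4 : ((cluster P asg j).card : ℝ) * (avgCost P A asg j / cost P A)
        ≤ cost (cluster P asg j) A / cost P A := by
      rw [← mul_div_assoc]
      exact div_le_div_of_nonneg_right h3 (cost_nonneg _ _)
    rw [← mul_div_assoc] at h1 h4
    linarith
  rw [sum_cluster (asg := asg)]
  refine (Finset.sum_le_sum fun j _ => key j).trans ?_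
  rw [← Finset.mul_sum, Finset.sum_add_distrib, ← Finset.mul_sum, ← Finset.sum_div, ← hcost]
  have h1 : cost P A / cost P A ≤ 1 := div_self_le_one _
  have h2 : ∑ _j : Fin k, ((1 : ℝ) / k + 1 / k) ≤ 2 := by
    have h3 : (k : ℝ) / k ≤ 1 := div_self_le_one _
    have : ∑ _j : Fin k, ((1 : ℝ) / k + 1 / k) = 2 * ((k : ℝ) / k) := by simp; ring
    rw [this]; linarith
  linarith

theorem score_le_samplingProb {p : Pt d} (hp : p ∈ P) :
    score P A asg p ≤ samplingProb P A asg p := by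
  have hpos : 0 < ∑ q ∈ P, score P A asg q :=
    Finset.sum_pos (fun q hq => score_pos P A asg hq) ⟨p, hp⟩
  rw [samplingProb, le_div_iff₀ hpos]
  exact mul_le_of_le_one_right (score_pos P A asg hp).le (sum_score_le_one P A asg)

theorem samplingProb_pos {p : Pt d} (hp : p ∈ P) : 0 < samplingProb P A asg p :=
  (score_pos P A asg hp).trans_le (score_le_samplingProb hp)

theorem sum_samplingProb_real (hP : P.Nonempty) : ∑ p : P, samplingProb P A asg p = 1 := by
  have hpos : 0 < ∑ q ∈ P, score P A asg q := Finset.sum_pos (fun q hq => score_pos P A asg hq) hP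
  rw [Finset.sum_coe_sort P (fun p => samplingProb P A asg p)]
  unfold samplingProb
  rw [← Finset.sum_div, div_self hpos.ne']

/-- The bound on the weights from the first term of the score. -/
theorem one_div_samplingProb_le {p : Pt d} (hp : p ∈ P) :
    1 / samplingProb P A asg p ≤ 4 * k * (cluster P asg (asg p)).card := by
  have hk : (0 : ℝ) < k := by exact_mod_cast (asg p).pos
  have hc := card_cluster_pos (asg := asg) hp
  have h1 := pointCost_nonneg p A
  have h2 := cost_nonneg P A
  have h3 := cost_nonneg (cluster P asg (asg p)) A
  have h4 : 0 ≤ avgCost P A asg (asg p) := div_nonneg h3 hc.le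
  have h5 : 1 / (4 * k * (cluster P asg (asg p)).card) ≤ samplingProb P A asg p := by
    refine le_trans ?_ (score_le_samplingProb hp)
    have e : 1 / (4 * k * ((cluster P asg (asg p)).card : ℝ))
        = 1 / 4 * (1 / ((k : ℝ) * ((cluster P asg (asg p)).card : ℝ))) := by field_simp
    rw [e, score]
    refine mul_le_mul_of_nonneg_left ?_ (by norm_num)
    have a1 : 0 ≤ pointCost p A / ((k : ℝ) * cost (cluster P asg (asg p)) A) := by positivity
    have a2 : 0 ≤ pointCost p A / cost P A := by positivity
    have a3 : 0 ≤ avgCost P A asg (asg p) / cost P A := by positivity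
    linarith
  have := one_div_le_one_div_of_le (by positivity) h5
  rwa [one_div_one_div] at this

/-- The bound on the weighted costs from the third term of the score. -/
theorem pointCost_div_samplingProb_le {p : Pt d} (hp : p ∈ P) :
    pointCost p A / samplingProb P A asg p ≤ 4 * cost P A := by
  have hk : (0 : ℝ) < k := by exact_mod_cast (asg p).pos
  have hc := card_cluster_pos (asg := asg) hp
  have h1 := pointCost_nonneg p A
  have h2 := cost_nonneg P A
  have h3 := cost_nonneg (cluster P asg (asg p)) A
  have h4 : 0 ≤ avgCost P A asg (asg p) := div_nonneg h3 hc.le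
  have h5 : pointCost p A / cost P A ≤ 4 * samplingProb P A asg p := by
    have h6 := score_le_samplingProb (A := A) (asg := asg) hp
    rw [score] at h6
    have a0 : 0 ≤ 1 / ((k : ℝ) * ((cluster P asg (asg p)).card : ℝ)) := by positivity
    have a1 : 0 ≤ pointCost p A / ((k : ℝ) * cost (cluster P asg (asg p)) A) := by positivity
    have a3 : 0 ≤ avgCost P A asg (asg p) / cost P A := by positivity
    linarith
  rw [div_le_iff₀ (samplingProb_pos hp)]
  -- If `cost P A = 0` then the third term of the score vanishes, but so does the cost of `p`.
  rcases eq_or_lt_of_le h2 with h0 | h0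
  · have : pointCost p A ≤ cost P A :=
      Finset.single_le_sum (f := fun p => pointCost p A) (fun q _ => pointCost_nonneg q A) hp
    rw [← h0]; linarith
  · rw [div_le_iff₀ h0] at h5
    linarith

theorem weightedSample (hA : IsNearestAssignment P A asg) (hm : 1 ≤ m) (q : Fin m → P)
    (hq : ∀ j, ∑ i with asg (q i) = j, sampleWeight P A asg q i ≤ 4 * (cluster P asg j).card) :
    WeightedSample A (fun i => (q i : Pt d)) (fun i => asg (q i)) (sampleWeight P A asg q)
      (fun j => ((cluster P asg j).card : ℝ)) (cost P A) := by
  have hm1 : (0 : ℝ) < m := by exact_mod_cast hm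
  have hw : ∀ i, m * sampleWeight P A asg q i = 1 / samplingProb P A asg (q i) := fun i => by
    have := samplingProb_pos (A := A) (asg := asg) (q i).2
    rw [sampleWeight]; field_simp
  refine ⟨fun i => ?_, fun j => by positivity, cost_nonneg _ _, fun i => ?_, fun i => ?_, hq⟩
  · have := samplingProb_pos (A := A) (asg := asg) (q i).2
    rw [sampleWeight]; positivity
  · rw [hw]; exact one_div_samplingProb_le (q i).2
  · rw [← mul_assoc, hw, ← pointCost_eq hA (q i).2, one_div_mul_eq_div]
    exact pointCost_div_samplingProb_le (q i).2

/-- The normalization is comparable to the cost of `S`: by the triangle inequality through the points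
of `P`, the centers of `A` are served by `S` at a cost of at most `2 cost P A + 2 cost P S`. -/
theorem scaleCost_le (hγ : IsApproxSolution γ P A) (hA : IsNearestAssignment P A asg)
    (S : Fin k → Pt d) :
    scaleCost A (fun j => ((cluster P asg j).card : ℝ)) (cost P A) S
      ≤ (3 * γ + 2) * cost P S := by
  have h1 : ∑ j, ((cluster P asg j).card : ℝ) * centerDist (A j) S ^ 2
      = ∑ p ∈ P, centerDist (A (asg p)) S ^ 2 := by
    rw [sum_cluster (asg := asg)]
    refine Finset.sum_congr rfl fun j _ => ?_
    rw [← nsmul_eq_mul, ← Finset.sum_const]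
    exact Finset.sum_congr rfl fun p hp => by rw [(Finset.mem_filter.1 hp).2]
  have h2 : ∀ p ∈ P, centerDist (A (asg p)) S ^ 2 ≤ 2 * pointCost p A + 2 * pointCost p S := by
    intro p hp
    have : Nonempty (Fin k) := ⟨asg p⟩
    have h3 := centerDist_le_add (A (asg p)) p S
    rw [norm_sub_rev] at h3
    rw [pointCost_eq hA hp, ← centerDist_sq p S]
    have h4 : centerDist (A (asg p)) S ^ 2 ≤ (centerDist p S + ‖p - A (asg p)‖) ^ 2 :=
      pow_le_pow_left₀ (centerDist_nonneg _ _) h3 2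
    nlinarith [sq_nonneg (centerDist p S - ‖p - A (asg p)‖)]
  have h3 : ∑ p ∈ P, centerDist (A (asg p)) S ^ 2 ≤ 2 * cost P A + 2 * cost P S := by
    refine (Finset.sum_le_sum h2).trans_eq ?_
    rw [Finset.sum_add_distrib, ← Finset.mul_sum, ← Finset.mul_sum]
    rfl
  rw [scaleCost, h1]
  linarith [hγ S]

/-- The sum in the definition of the cluster weights, as a sum of i.i.d. terms. -/
theorem sum_cluster_sampleWeight (j : Fin k) (q : Fin m → P) (hm : 1 ≤ m) :
    ∑ i, (if asg (q i) = j then 1 / samplingProb P A asg (q i) / (cluster P asg j).card else 0)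
      = m / (cluster P asg j).card * ∑ i with asg (q i) = j, sampleWeight P A asg q i := by
  have hm1 : (0 : ℝ) < m := by exact_mod_cast hm
  rw [Finset.sum_filter, Finset.mul_sum]
  refine Finset.sum_congr rfl fun i _ => ?_
  rw [sampleWeight]
  split_ifs with h
  · subst h
    have h1 := (samplingProb_pos (A := A) (asg := asg) (q i).2).ne'
    have h2 := (card_cluster_pos (asg := asg) (q i).2).ne'
    field_simp
  · rw [mul_zero]

/-- The Chernoff bound for the weight sampled from one cluster, relative to its size. -/
theorem pr_sum_cluster_gt_le (hP : P.Nonempty) (hm : 1 ≤ m) (hkm : 2 * k * logFactor m ≤ m)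
    (j : Fin k) :
    pr (prodWt fun p : P => samplingProb P A asg p) (fun q : Fin m → P =>
      4 * (m : ℝ) < ∑ i, (if asg (q i) = j then
        1 / samplingProb P A asg (q i) / (cluster P asg j).card else 0))
      ≤ (100 * (m : ℝ))⁻¹ := by
  have hk : (0 : ℝ) < k := by exact_mod_cast j.pos
  have hpp : ∀ p : P, 0 < samplingProb P A asg p := fun p => samplingProb_pos p.2
  set f : P → ℝ := fun p => if asg p = j then
    1 / samplingProb P A asg p / (cluster P asg j).card else 0 with hf
  have h0 : ∀ p, 0 ≤ f p := fun p => by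
    simp only [hf]; split_ifs
    · have := hpp p; positivity
    · exact le_rfl
  have hB : ∀ p, f p ≤ 4 * k := fun p => by
    simp only [hf]; split_ifs with h
    · subst h
      rw [div_le_iff₀ (card_cluster_pos p.2)]
      exact one_div_samplingProb_le p.2
    · positivity
  have hmean : ∑ p : P, samplingProb P A asg p * f p ≤ 1 := by
    have e : ∀ p : P, samplingProb P A asg p * f p
        = if asg p = j then 1 / ((cluster P asg j).card : ℝ) else 0 := by
      intro p
      simp only [hf]; split_ifs
      · rw [← mul_div_assoc, mul_one_div_cancel (hpp p).ne']
      · rw [mul_zero]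
    rw [Finset.sum_congr rfl fun p _ => e p,
      Finset.sum_coe_sort P (fun p => if asg p = j then 1 / ((cluster P asg j).card : ℝ) else 0),
      ← Finset.sum_filter, Finset.sum_const, nsmul_eq_mul, mul_one_div]
    exact div_self_le_one _
  have := pr_sum_gt_four_le (ι := Fin m) (fun p => (hpp p).le) (sum_samplingProb_real hP) f
    (B := 4 * k) (by positivity) h0 hB hmean
  rw [Fintype.card_fin] at this
  refine this.trans ?_
  rw [← exp_logFactor hm, ← Real.exp_neg, Real.exp_le_exp, neg_le_neg_iff,
    le_div_iff₀ (by positivity)]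
  linarith

/-- The weight sampled from each cluster rarely exceeds four times its size. -/
theorem pr_cluster_weight_le (hP : P.Nonempty) (hm : 1 ≤ m) (hkm : 2 * k * logFactor m ≤ m) :
    pr (prodWt fun p : P => samplingProb P A asg p) (fun q : Fin m → P =>
      ¬ ∀ j, ∑ i with asg (q i) = j, sampleWeight P A asg q i ≤ 4 * (cluster P asg j).card)
      ≤ 1 / 100 := by
  have hm1 : (1 : ℝ) ≤ m := by exact_mod_cast hm
  have hl := one_le_logFactor hm
  have hw : ∀ q : Fin m → P, 0 ≤ prodWt (fun p : P => samplingProb P A asg p) q :=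
    prodWt_nonneg fun p => (samplingProb_pos p.2).le
  have hsum : ∑ _j : Fin k, (100 * (m : ℝ))⁻¹ ≤ 1 / 100 := by
    rw [Finset.sum_const, Finset.card_univ, Fintype.card_fin, nsmul_eq_mul,
      mul_inv_le_iff₀ (by positivity)]
    have : (k : ℝ) ≤ k * logFactor m := le_mul_of_one_le_right (by positivity) hl
    linarith [(by positivity : (0 : ℝ) ≤ k)]
  refine (pr_mono hw ?_).trans ((pr_exists_le hw Finset.univ _).trans
    ((Finset.sum_le_sum fun j _ => pr_sum_cluster_gt_le hP hm hkm j).trans hsum))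
  intro q hq
  push Not at hq
  obtain ⟨j, hj⟩ := hq
  -- A cluster with positive weight is not empty.
  have hn : (0 : ℝ) < (cluster P asg j).card := by
    rcases (Finset.univ.filter fun i => asg (q i) = j).eq_empty_or_nonempty with h | ⟨i, hi⟩
    · rw [h, Finset.sum_empty] at hj
      exact absurd hj (not_lt.2 (by positivity))
    · rw [← (Finset.mem_filter.1 hi).2]
      exact card_cluster_pos (q i).2
  refine ⟨j, Finset.mem_univ _, ?_⟩
  rw [sum_cluster_sampleWeight j q hm]
  calc 4 * (m : ℝ) = m / (cluster P asg j).card * (4 * (cluster P asg j).card) := by field_simp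
    _ < _ := mul_lt_mul_of_pos_left hj (by positivity)

/-- For each single `S`, the weighted cost concentrates: the variance is at most `O(k / m)` times
the squared cost. -/
theorem pr_single_deviation_le (hP : P.Nonempty) (hk : 1 ≤ k) (hm : 1 ≤ m)
    (hγ : IsApproxSolution γ P A) (hA : IsNearestAssignment P A asg) {ε : ℝ} (hε : 0 < ε)
    (hmε : 128 * k * (3 * γ + 2) / ε ^ 2 ≤ m) (S : Fin k → Pt d) (hS : 0 < cost P S) :
    pr (prodWt fun p : P => samplingProb P A asg p) (fun q : Fin m → P =>
      ε / 2 * cost P S < |∑ i, 1 / (m * samplingProb P A asg (q i)) * pointCost (q i : Pt d) S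
        - cost P S|) ≤ 1 / 2 := by
  have hm1 : (0 : ℝ) < m := by exact_mod_cast hm
  have hk1 : (1 : ℝ) ≤ k := by exact_mod_cast hk
  have hpp : ∀ p : P, 0 < samplingProb P A asg p := fun p => samplingProb_pos p.2
  set M := scaleCost A (fun j => ((cluster P asg j).card : ℝ)) (cost P A) S with hM
  have hMle : M ≤ (3 * γ + 2) * cost P S := scaleCost_le hγ hA S
  have hΦM : cost P A ≤ M :=
    le_add_of_nonneg_right (Finset.sum_nonneg fun j _ => by positivity)
  have hM0 : 0 ≤ M := (cost_nonneg _ _).trans hΦM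
  have hsens : ∀ p : P, pointCost (p : Pt d) S / samplingProb P A asg p ≤ 16 * k * M := by
    intro p
    have : Nonempty (Fin k) := ⟨asg p⟩
    have h1 := centerDist_le_add (p : Pt d) (A (asg p)) S
    have h2 : pointCost (p : Pt d) S
        ≤ 2 * pointCost (p : Pt d) A + 2 * centerDist (A (asg p)) S ^ 2 := by
      rw [pointCost_eq hA p.2, ← centerDist_sq]
      have h4 : centerDist (p : Pt d) S ^ 2
          ≤ (centerDist (A (asg p)) S + ‖(p : Pt d) - A (asg p)‖) ^ 2 :=
        pow_le_pow_left₀ (centerDist_nonneg _ _) h1 2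
      nlinarith [sq_nonneg (centerDist (A (asg p)) S - ‖(p : Pt d) - A (asg p)‖)]
    have h3 := pointCost_div_samplingProb_le (A := A) (asg := asg) p.2
    have h4 := one_div_samplingProb_le (A := A) (asg := asg) p.2
    have h5 : ((cluster P asg (asg p)).card : ℝ) * centerDist (A (asg p)) S ^ 2 ≤ M := by
      refine le_trans ?_ (le_add_of_nonneg_left (cost_nonneg P A))
      exact Finset.single_le_sum
        (f := fun j => ((cluster P asg j).card : ℝ) * centerDist (A j) S ^ 2)
        (fun j _ => by positivity) (Finset.mem_univ _)
    have h6 : 1 / samplingProb P A asg p * centerDist (A (asg p)) S ^ 2 ≤ 4 * k * M := by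
      calc _ ≤ 4 * k * (cluster P asg (asg p)).card * centerDist (A (asg p)) S ^ 2 := by gcongr
        _ = 4 * k * ((cluster P asg (asg p)).card * centerDist (A (asg p)) S ^ 2) := by ring
        _ ≤ _ := by gcongr
    have h7 : M ≤ k * M := le_mul_of_one_le_left hM0 hk1
    calc pointCost (p : Pt d) S / samplingProb P A asg p
        ≤ (2 * pointCost (p : Pt d) A + 2 * centerDist (A (asg p)) S ^ 2)
          / samplingProb P A asg p := div_le_div_of_nonneg_right h2 (hpp p).le
      _ = 2 * (pointCost (p : Pt d) A / samplingProb P A asg p)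
          + 2 * (1 / samplingProb P A asg p * centerDist (A (asg p)) S ^ 2) := by ring
      _ ≤ _ := by linarith
  have hcostsum : ∑ p : P, pointCost (p : Pt d) S = cost P S :=
    Finset.sum_coe_sort P (fun p => pointCost p S)
  set f : P → ℝ := fun p => 1 / (m * samplingProb P A asg p) * pointCost (p : Pt d) S with hf
  have hmean : (Fintype.card (Fin m) : ℝ) * ∑ p : P, samplingProb P A asg p * f p = cost P S := by
    rw [Fintype.card_fin, Finset.mul_sum, ← hcostsum]
    refine Finset.sum_congr rfl fun p _ => ?_
    have := (hpp p).ne'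
    simp only [hf]; field_simp
  have hsq : ∑ p : P, samplingProb P A asg p * f p ^ 2
      ≤ 16 * k * M / m ^ 2 * cost P S := by
    rw [← hcostsum, Finset.mul_sum]
    refine Finset.sum_le_sum fun p _ => ?_
    have e : samplingProb P A asg p * f p ^ 2
        = pointCost (p : Pt d) S / samplingProb P A asg p / m ^ 2 * pointCost (p : Pt d) S := by
      have := (hpp p).ne'
      simp only [hf]; field_simp
    rw [e]
    refine mul_le_mul_of_nonneg_right ?_ (pointCost_nonneg _ _)
    exact div_le_div_of_nonneg_right (hsens p) (by positivity)
  have := pr_abs_sum_gt_le_half (ι := Fin m) (fun p => (hpp p).le) (sum_samplingProb_real hP) f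
    (t := ε / 2 * cost P S) (by positivity) (by
      rw [div_le_iff₀ (by positivity)] at hmε
      rw [Fintype.card_fin]
      calc 2 * ((m : ℝ) * ∑ p : P, samplingProb P A asg p * f p ^ 2)
          ≤ 2 * (m * (16 * k * M / m ^ 2 * cost P S)) := by gcongr
        _ = 32 * k * M * cost P S / m := by field_simp; ring
        _ ≤ 32 * k * ((3 * γ + 2) * cost P S) * cost P S / m := by gcongr
        _ = (128 * k * (3 * γ + 2)) / m * (cost P S ^ 2 / 4) := by ring
        _ ≤ ε ^ 2 * (cost P S ^ 2 / 4) := by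
            gcongr
            rw [div_le_iff₀ hm1]; linarith
        _ = _ := by ring)
  rwa [hmean] at this

/-- The probability of an event for the samples, as a finite sum. -/
theorem sampleLaw_real (hP : P.Nonempty) (E : (Fin m → P) → Prop) :
    (sampleLaw P hP A asg m).real {q | E q}
      = pr (prodWt fun p : P => samplingProb P A asg p) E := by
  classical
  have h1 : {q | E q} = ((Finset.univ.filter E : Finset (Fin m → P)) : Set (Fin m → P)) := by
    ext q; simp
  have : IsProbabilityMeasure (sampleLaw P hP A asg m) := by unfold sampleLaw; infer_instance
  rw [h1, ← sum_measureReal_singleton, Finset.sum_filter]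
  unfold pr
  refine Finset.sum_congr rfl fun q _ => ?_
  congr 1
  rw [sampleLaw, measureReal_def, Measure.pi_singleton, ENNReal.toReal_prod, prodWt]
  refine Finset.prod_congr rfl fun i _ => ?_
  rw [PMF.toMeasure_apply_singleton _ _ (measurableSet_singleton _), samplingPMF,
    PMF.ofFintype_apply, ENNReal.toReal_ofReal (samplingProb_pos (q i).2).le]

/-- The guarantee of sensitivity sampling, with the logarithmic factor in terms of `m`. -/
theorem coreset_of_le (hP : P.Nonempty) (hk : 1 ≤ k) (hm : 1 ≤ m) (hγ1 : 1 ≤ γ)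
    (hγ : IsApproxSolution γ P A) (hA : IsNearestAssignment P A asg) {ε ε₁ κ : ℝ}
    (hε1 : ε < 1) (hε₁ : 0 < ε₁) (hεε : ε = 480 * (3 * γ + 2) * ε₁) (hκ : 1 ≤ κ)
    (hκε : κ = 1 / ε₁ ^ 2 ∨ (k : ℝ) ≤ κ ^ 2)
    (hmε : 3 * 10 ^ 9 * (k * κ * logFactor m ^ 3) / ε₁ ^ 2 ≤ m) :
    (2 : ℝ) / 3 ≤ (sampleLaw P hP A asg m).real
      {q | IsCoreset k ε P (fun i => (q i : Pt d)) (sampleWeight P A asg q)} := by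
  classical
  have hm1 : (0 : ℝ) < m := by exact_mod_cast hm
  have hk1 : (1 : ℝ) ≤ k := by exact_mod_cast hk
  have hl := one_le_logFactor hm
  have hl3 : logFactor m ≤ logFactor m ^ 3 := le_self_pow₀ hl (by norm_num)
  have hprod : k * logFactor m ≤ k * κ * logFactor m ^ 3 := by
    calc k * logFactor m = k * 1 * logFactor m := by ring
      _ ≤ _ := by gcongr
  have hkl : (k : ℝ) ≤ k * logFactor m := le_mul_of_one_le_right (by linarith) hl
  have hmε' := (div_le_iff₀ (by positivity : 0 < ε₁ ^ 2)).1 hmε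
  have hG : 1 ≤ 480 * (3 * γ + 2) := by linarith
  have hε₁ε : ε₁ ≤ ε := by rw [hεε]; exact le_mul_of_one_le_left hε₁.le hG
  have hε : 0 < ε := hε₁.trans_le hε₁ε
  have hε₁1 : ε₁ ≤ 1 := hε₁ε.trans hε1.le
  set p : P → ℝ := fun p => samplingProb P A asg p with hp
  have hp0 : ∀ a, 0 ≤ p a := fun a => (samplingProb_pos a.2).le
  have hpsum : ∑ a, p a = 1 := sum_samplingProb_real hP
  have hkm : 2 * k * logFactor m ≤ m := by
    have : (m : ℝ) * ε₁ ^ 2 ≤ m * 1 := by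
      gcongr
      exact pow_le_one₀ hε₁.le hε₁1
    linarith
  have hvar : 128 * k * (3 * γ + 2) / ε ^ 2 ≤ m := by
    rw [div_le_iff₀ (by positivity)]
    have h1 : (3 * γ + 2) * ε₁ ^ 2 ≤ ε ^ 2 := by
      rw [hεε, mul_pow]
      gcongr
      rw [sq]
      nlinarith
    have h2 : (m : ℝ) * ((3 * γ + 2) * ε₁ ^ 2) ≤ m * ε ^ 2 := by gcongr
    have h3 : 128 * k * (3 * γ + 2) ≤ m * ε₁ ^ 2 * (3 * γ + 2) :=
      mul_le_mul_of_nonneg_right (by linarith) (by linarith)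
    linarith
  -- Tuples of cost zero are excluded: for them the Chebyshev bound is not available with a positive
  -- deviation, but the weighted cost of any sample is zero as well.
  set h : {S : Fin k → Pt d // 0 < cost P S} → P → ℝ :=
    fun S a => 1 / (m * samplingProb P A asg a) * pointCost (a : Pt d) S.1 with hh
  have hsymm := pr_exists_deviation_le (ι := Fin m) hp0 hpsum h (fun S => cost P S.1)
    (fun S => ε / 2 * cost P S.1)
    (fun S => pr_single_deviation_le hP hk hm hγ hA hε hvar S.1 S.2)
  set E : (Fin m → P) → Prop := fun q =>
    ∀ j, ∑ i with asg (q i) = j, sampleWeight P A asg q i ≤ 4 * (cluster P asg j).card with hE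
  have hEc : pr (prodWt p) (fun q => ¬ E q) ≤ 1 / 100 := pr_cluster_weight_le hP hm hkm
  -- For samples with too much weight in some cluster the trivial bound `1` is used.
  have hcond : ∀ q : Fin m → P, pr signWt (fun σ : Fin m → Bool =>
      ∃ S, ε / 2 * cost P S.1 / 2 < |∑ i, sgn (σ i) * h S (q i)|)
      ≤ 1 / 24 + if ¬ E q then 1 else 0 := by
    intro q
    by_cases hq : E q
    · simp only [hq, not_true_eq_false, if_false, add_zero]
      refine (pr_mono signWt_nonneg fun σ hσ => ?_).trans
        ((weightedSample hA hm q hq).pr_sign_deviation_le hm hk hε₁ hε₁1 hκ hκε hmε)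
      obtain ⟨S, hS⟩ := hσ
      refine ⟨S.1, lt_of_le_of_lt ?_ hS⟩
      have := scaleCost_le hγ hA S.1
      calc 120 * ε₁ * scaleCost A (fun j => ((cluster P asg j).card : ℝ)) (cost P A) S.1
          ≤ 120 * ε₁ * ((3 * γ + 2) * cost P S.1) := by gcongr
        _ = _ := by rw [hεε]; ring
    · simp only [hq, not_false_eq_true, if_true]
      have := pr_le_one (A := fun σ : Fin m → Bool =>
        ∃ S, ε / 2 * cost P S.1 / 2 < |∑ i, sgn (σ i) * h S (q i)|) signWt_nonneg sum_signWt
      linarith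
  have hbad : pr (prodWt p) (fun q : Fin m → P =>
      ∃ S, 2 * (ε / 2 * cost P S.1) < |∑ i, h S (q i) - cost P S.1|) ≤ 1 / 3 := by
    refine hsymm.trans ?_
    have h1 : ∑ q : Fin m → P, prodWt p q * pr signWt (fun σ : Fin m → Bool =>
        ∃ S, ε / 2 * cost P S.1 / 2 < |∑ i, sgn (σ i) * h S (q i)|)
        ≤ ∑ q : Fin m → P, prodWt p q * (1 / 24 + if ¬ E q then 1 else 0) :=
      Finset.sum_le_sum fun q _ => mul_le_mul_of_nonneg_left (hcond q) (prodWt_nonneg hp0 q)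
    have h2 : ∑ q : Fin m → P, prodWt p q * (1 / 24 + if ¬ E q then 1 else 0)
        = 1 / 24 + pr (prodWt p) (fun q => ¬ E q) := by
      rw [pr_eq_sum]
      simp only [mul_add, Finset.sum_add_distrib]
      rw [← Finset.sum_mul, sum_prodWt hpsum, one_mul]
      congr 1
      exact Finset.sum_congr rfl fun q _ => by congr
    linarith
  rw [sampleLaw_real]
  have h3 := pr_add_pr_not (p := prodWt p) (A := fun q : Fin m → P =>
    ∃ S, 2 * (ε / 2 * cost P S.1) < |∑ i, h S (q i) - cost P S.1|)
  rw [sum_prodWt hpsum] at h3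
  refine le_trans (by linarith : (2 : ℝ) / 3 ≤ pr (prodWt p) (fun q : Fin m → P =>
    ¬ ∃ S, 2 * (ε / 2 * cost P S.1) < |∑ i, h S (q i) - cost P S.1|))
    (pr_mono (prodWt_nonneg hp0) fun q hq S => ?_)
  rcases eq_or_lt_of_le (cost_nonneg P S) with h0 | h0
  · have hz : ∀ a ∈ P, pointCost a S = 0 :=
      (Finset.sum_eq_zero_iff_of_nonneg fun a _ => pointCost_nonneg a S).1 h0.symm
    rw [← h0, Finset.sum_eq_zero fun i _ => by rw [hz _ (q i).2, mul_zero]]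
    simp
  · push Not at hq
    have := hq ⟨S, h0⟩
    rw [← mul_assoc, mul_div_cancel₀ ε two_ne_zero] at this
    exact this

end sampling

/-! ### The logarithmic factor -/

theorem one_add_log_pow_three_le {z : ℝ} (hz : 1 ≤ z) : (1 + Real.log z) ^ 3 ≤ 27 * z := by
  set y := z ^ (1 / 3 : ℝ) with hy
  have hy0 : 0 < y := by positivity
  have hy3 : y ^ 3 = z := by
    rw [hy, ← Real.rpow_natCast, ← Real.rpow_mul (by linarith)]; norm_num
  have h1 : Real.log z = 3 * Real.log y := by rw [← hy3, Real.log_pow]; norm_num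
  have h2 := Real.log_le_sub_one_of_pos hy0
  have h3 : 1 + Real.log z ≤ 3 * y := by rw [h1]; linarith
  have h4 : 0 ≤ 1 + Real.log z := by linarith [Real.log_nonneg hz]
  calc (1 + Real.log z) ^ 3 ≤ (3 * y) ^ 3 := by gcongr
    _ = 27 * z := by rw [mul_pow, hy3]; norm_num

/-- A bound on `m` with a logarithmic factor in `Y` implies one with a logarithmic factor in `m`. -/
theorem exists_const_logFactor (K : ℝ) (hK : 1 ≤ K) :
    ∃ C : ℝ, 0 < C ∧ ∀ (X Y : ℝ) (m : ℕ), 1 ≤ X → 1 ≤ Y → Real.log X ≤ 4 * Y →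
      C * X * Y ^ 3 ≤ m → K * X * logFactor m ^ 3 ≤ m := by
  set b : ℝ := 27 * 112 ^ 3 * K with hb
  have hb1 : 1 ≤ b := by rw [hb]; linarith
  refine ⟨b ^ 6, by positivity, fun X Y m hX hY hXY hm => ?_⟩
  have hC1 : 1 ≤ b ^ 6 := one_le_pow₀ hb1
  have hpos : 0 < b ^ 6 * X * Y ^ 3 := by positivity
  -- Only the excess `z` of `m` over the assumed bound can be large compared with `X` and `Y`, and
  -- the third power of its logarithm is absorbed by `z` itself.
  set z := m / (b ^ 6 * X * Y ^ 3) with hz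
  have hz1 : 1 ≤ z := by rw [hz, le_div_iff₀ hpos]; linarith
  have hmz : (m : ℝ) = b ^ 6 * X * Y ^ 3 * z := by rw [hz]; field_simp
  have hlz := Real.log_nonneg hz1
  have hlog : logFactor m ≤ 112 * b * Y * (1 + Real.log z) := by
    have e : logFactor m
        = Real.log 100 + 6 * Real.log b + Real.log X + 3 * Real.log Y + Real.log z := by
      rw [logFactor, hmz, Real.log_mul (by norm_num) (by positivity),
        Real.log_mul (by positivity) (by positivity), Real.log_mul (by positivity) (by positivity),
        Real.log_mul (by positivity) (by positivity), Real.log_pow, Real.log_pow]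
      push_cast; ring
    have h1 : Real.log 100 ≤ 99 := by
      have := Real.log_le_sub_one_of_pos (by norm_num : (0 : ℝ) < 100); linarith
    have h2 := Real.log_le_sub_one_of_pos (by linarith : 0 < b)
    have h3 := Real.log_le_sub_one_of_pos (by linarith : 0 < Y)
    have h4 : b ≤ b * Y := le_mul_of_one_le_right (by linarith) hY
    have h5 : Y ≤ b * Y := le_mul_of_one_le_left (by linarith) hb1
    have h6 : 1 * Real.log z ≤ b * Y * Real.log z := by
      gcongr
      linarith
    have h7 : 0 ≤ b * Y * Real.log z := by positivity
    rw [e]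
    linarith
  have hl0 : 0 ≤ logFactor m := by
    refine Real.log_nonneg ?_
    have : (1 : ℝ) ≤ m := by
      refine le_trans ?_ hm
      have h8 : (1 : ℝ) ≤ Y ^ 3 := one_le_pow₀ hY
      have h9 : 1 ≤ b ^ 6 * X := by nlinarith
      nlinarith
    linarith
  have hb3 : b ≤ b ^ 3 := le_self_pow₀ hb1 (by norm_num)
  calc K * X * logFactor m ^ 3 ≤ K * X * (112 * b * Y * (1 + Real.log z)) ^ 3 := by gcongr
    _ = K * X * (112 ^ 3 * b ^ 3 * Y ^ 3) * (1 + Real.log z) ^ 3 := by ring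
    _ ≤ K * X * (112 ^ 3 * b ^ 3 * Y ^ 3) * (27 * z) := by
        gcongr
        exact one_add_log_pow_three_le hz1
    _ = b * b ^ 3 * X * Y ^ 3 * z := by rw [hb]; ring
    _ ≤ b ^ 3 * b ^ 3 * X * Y ^ 3 * z := by gcongr
    _ = m := by rw [hmz]; ring

end KMeans

end

theorem theorem1 :
    ∃ c : ℕ, ∀ γ : ℝ, 1 ≤ γ → ∃ C : ℝ, 0 < C ∧
      ∀ (d k : ℕ) (_ : 1 ≤ k) (P : Finset (KMeans.Pt d)) (hP : P.Nonempty)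
        (A : Fin k → KMeans.Pt d) (asg : KMeans.Pt d → Fin k)
        (_ : KMeans.IsApproxSolution γ P A) (_ : KMeans.IsNearestAssignment P A asg)
        (ε : ℝ) (_ : 0 < ε) (_ : ε < 1) (m : ℕ)
        (_ : C * ((k : ℝ) / ε ^ 2 * min (Real.sqrt k) (1 / ε ^ 2))
          * (1 + Real.log ((k : ℝ) / ε)) ^ c ≤ (m : ℝ)),
        (2 : ℝ) / 3 ≤ (KMeans.sampleLaw P hP A asg m).real
          {q | KMeans.IsCoreset k ε P (fun i => (q i : KMeans.Pt d))
            (KMeans.sampleWeight P A asg q)} := by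
  refine ⟨3, fun γ hγ1 => ?_⟩
  -- The internal precision is `ε / G`. The factor `480 = 4 * 120` combines the constant of the bound
  -- for signed sums with the loss in the symmetrization, and `3 γ + 2` is the comparison of scales.
  set G : ℝ := 480 * (3 * γ + 2) with hG
  have hG1 : 1 ≤ G := by rw [hG]; linarith
  obtain ⟨C, hC, hCm⟩ := KMeans.exists_const_logFactor (3 * 10 ^ 9 * G ^ 4)
    (by nlinarith [one_le_pow₀ hG1 (n := 4)])
  refine ⟨C, hC, fun d k hk P hP A asg hγ hA ε hε hε1 m hm => ?_⟩
  have hk1 : (1 : ℝ) ≤ k := by exact_mod_cast hk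
  have hsq1 : 1 ≤ √(k : ℝ) := Real.one_le_sqrt.2 hk1
  have hε2 : 1 ≤ 1 / ε ^ 2 := by
    rw [le_div_iff₀ (by positivity), one_mul]; exact pow_le_one₀ hε.le hε1.le
  have hkε : 1 ≤ k / ε := by rw [le_div_iff₀ hε]; linarith
  set κ₀ := min √(k : ℝ) (1 / ε ^ 2) with hκ₀
  have hκ₀1 : 1 ≤ κ₀ := le_min hsq1 hε2
  set X := (k : ℝ) / ε ^ 2 * κ₀ with hX
  set Y := 1 + Real.log (k / ε) with hY
  have hX1 : 1 ≤ X := by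
    have h1 : (1 : ℝ) ≤ k / ε ^ 2 := by
      rw [div_eq_mul_one_div]; nlinarith
    rw [hX]; nlinarith
  have hY1 : 1 ≤ Y := le_add_of_nonneg_right (Real.log_nonneg hkε)
  have hXY : Real.log X ≤ 4 * Y := by
    have h1 : X ≤ (k / ε) ^ 4 := by
      calc X ≤ k / ε ^ 2 * (1 / ε ^ 2) := by
            rw [hX]; gcongr; exact min_le_right _ _
        _ = k ^ 1 / ε ^ 4 := by field_simp
        _ ≤ k ^ 4 / ε ^ 4 := by
            gcongr
            norm_num
        _ = _ := by rw [div_pow]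
    have h2 : Real.log X ≤ 4 * Real.log (k / ε) := by
      rw [← Nat.cast_ofNat (R := ℝ) (n := 4), ← Real.log_pow]
      exact Real.log_le_log (by linarith) h1
    rw [hY]; linarith
  have hmain := hCm X Y m hX1 hY1 hXY hm
  have hm1 : 1 ≤ m := by
    have : (0 : ℝ) < m := lt_of_lt_of_le (by positivity) hm
    exact_mod_cast this
  set ε₁ := ε / G with hε₁
  have hε₁0 : 0 < ε₁ := by positivity
  have hinv : 1 / ε₁ ^ 2 = G ^ 2 * (1 / ε ^ 2) := by rw [hε₁]; field_simp
  have hG2 : 1 ≤ G ^ 2 := one_le_pow₀ hG1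
  refine KMeans.coreset_of_le (κ := min √(k : ℝ) (1 / ε₁ ^ 2)) hP hk hm1 hγ1 hγ hA hε1 hε₁0
    (by rw [hε₁, ← hG]; field_simp) (le_min hsq1 (by rw [hinv]; nlinarith)) ?_ ?_
  · rcases min_choice √(k : ℝ) (1 / ε₁ ^ 2) with h | h
    · right; rw [h, Real.sq_sqrt (by linarith)]
    · left; exact h
  · have hκ : min √(k : ℝ) (1 / ε₁ ^ 2) ≤ G ^ 2 * κ₀ := by
      rw [hκ₀, mul_min_of_nonneg _ _ (by positivity), hinv]
      exact min_le_min_right _ (le_mul_of_one_le_left (by positivity) hG2)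
    have hl := KMeans.one_le_logFactor hm1
    calc 3 * 10 ^ 9 * (k * min √(k : ℝ) (1 / ε₁ ^ 2) * KMeans.logFactor m ^ 3) / ε₁ ^ 2
        ≤ 3 * 10 ^ 9 * (k * (G ^ 2 * κ₀) * KMeans.logFactor m ^ 3) / ε₁ ^ 2 := by gcongr
      _ = 3 * 10 ^ 9 * (k * (G ^ 2 * κ₀) * KMeans.logFactor m ^ 3) * (1 / ε₁ ^ 2) := by ring
      _ = 3 * 10 ^ 9 * G ^ 4 * X * KMeans.logFactor m ^ 3 := by rw [hinv, hX]; ring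
      _ ≤ m := hmain
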